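/- **Theorem 3 (Main Theorem).** A uniform facility location (UFL) instance is a tuple $(V,d,f,\vec N)$, where $(V,d)$ is a metric space on $n$ points, $f\ge 0$ is the facility cost and $\vec N=(N_v)_{v\in V}\in\mathbb Z_{\ge 0}^V$ gives the number of clients at each location. For $S\subseteq V$ put $\mathrm{cost}_d(S;\vec N)=|S|\cdot f+\sum_{v\in V}N_v\,d(v,S)$ with $d(v,S)=\min_{s\in S}d(v,s)$ (and $d(v,\emptyset)=\infty$, $0\cdot\infty=0$), and $\mathrm{opt}=\min_{S\subseteq V}\mathrm{cost}_d(S;\vec N)$. In the super-set output setting a randomized algorithm $\mathcal A$ publishes a nonempty set $R\subseteq V$ together with a metric $\rho$ on $V$, where $\rho$ may depend on $(V,d,f)$, $\varepsilon$ and the random bits, but not on $\vec N$. Every client then connects to the location of $R$ that is nearest to it under $\rho$ (ties being broken by a fixed order of $V$), and the set $S\subseteq R$ of open facilities consists of the locations in $R$ with at least one connected client. The algorithm is $\varepsilon$-differentially private if, for all $\vec N,\vec N'$ with $|\vec N-\vec N'|_1=1$ and every event $\mathcal T$ of outputs, $\Pr[\mathcal A(\vec N)\in\mathcal T]\le e^{\varepsilon}\Pr[\mathcal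 A(\vec N')\in\mathcal T]$, where the output is the pair $(R,\rho)$. There are a single randomized algorithm $\mathcal A$, a polynomial $p$ and an absolute constant $C$ such that the following holds for every metric $(V,d)$ with $|V|=n\ge 2$, every $f\ge 0$ and every $\varepsilon>0$. 1. (Efficiency) On input $(V,d,f,\vec N)$ and $\varepsilon$, for every $\vec N$ and every outcome of the random samples, $\mathcal A$ halts within $p(s)$ steps of a unit-cost real RAM (arithmetic and comparison of real numbers, no rounding, sampling of independent uniform $[0,1]$ and $\mathrm{Lap}(1)$ variables). Here, with $\delta$ and $\Delta$ the smallest and the largest distance between two distinct points, $s=n+\lceil\log_2(\Delta/\delta)\rceil+\lceil\log_2(f/\delta)\rceil$, the last term being $0$ if $f\le\delta$. 2. (Privacy) $\mathcal A$ is $\varepsilon$-differentially private. 3. (Approximation) For every $\vec N$, the set $S$ of open facilities satisfies $$\mathbb E\big[\mathrm{cost}_d(S;\vec N)\big]\le C\cdot\log n\cdot\max\{1,1/\varepsilon\}\cdot\mathrm{opt},$$ which is an expected multiplicative approximation ratio of $O(\log n/\varepsilon)$ for $\varepsilon\le 1$. The same bound holds when the distance $d(v,S)$ of each client is replaced by the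 distance under $d$ from the client to the facility to which it is actually connected. -/

import Mathlib

open MeasureTheory
open scoped ENNReal

noncomputable section

namespace UFL

/-! ### Uniform facility location on the locations `Fin n` -/

/-- `d` is a metric on the `n` locations. -/
structure IsMetric {n : ℕ} (d : Fin n → Fin n → ℝ) : Prop where
  eq_zero_iff : ∀ u v, d u v = 0 ↔ u = v
  symm : ∀ u v, d u v = d v u
  triangle : ∀ u v w, d u w ≤ d u v + d v w

/-- `d(v, S) = min_{s ∈ S} d(v, s)`, which is `∞` when `S` is empty. -/
def distTo {n : ℕ} (d : Fin n → Fin n → ℝ) (v : Fin n) (S : Finset (Fin n)) : ℝ≥0∞ :=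
  ⨅ s ∈ S, ENNReal.ofReal (d v s)

/-- `cost_d(S; N) = |S| f + ∑_v N_v d(v, S)`, with `0 * ∞ = 0`. -/
def cost {n : ℕ} (d : Fin n → Fin n → ℝ) (f : ℝ) (N : Fin n → ℕ) (S : Finset (Fin n)) : ℝ≥0∞ :=
  (S.card : ℝ≥0∞) * ENNReal.ofReal f + ∑ v, (N v : ℝ≥0∞) * distTo d v S

/-- The cost of an optimum solution. -/
def opt {n : ℕ} (d : Fin n → Fin n → ℝ) (f : ℝ) (N : Fin n → ℕ) : ℝ≥0∞ :=
  ⨅ S : Finset (Fin n), cost d f N S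

/-! ### The super-set output setting

The published output is a nonempty set `R` of potential facilities together with a metric `ρ`. -/

/-- The location of `R` to which the clients at `v` connect: the one nearest to `v` under `ρ`,
ties being broken in favour of the smallest index. (The value for empty `R` is irrelevant.) -/
def connect {n : ℕ} (ρ : Fin n → Fin n → ℝ) (R : Finset (Fin n)) (v : Fin n) : Fin n :=
  open Classical in
  if h : (R.filter fun s => ∀ t ∈ R, ρ v s ≤ ρ v t).Nonempty then Finset.min' _ h else v

/-- The facilities that are really opened: those with at least one connected client. -/
def opened {n : ℕ} (ρ : Fin n → Fin n → ℝ) (R : Finset (Fin n)) (N : Fin n → ℕ) :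
    Finset (Fin n) :=
  (Finset.univ.filter fun v => 1 ≤ N v).image (connect ρ R)

/-- Facility cost of the opened facilities plus the true distances (under `d`) from the clients
to the facilities that they are connected to. -/
def connectedCost {n : ℕ} (d : Fin n → Fin n → ℝ) (f : ℝ) (N : Fin n → ℕ)
    (ρ : Fin n → Fin n → ℝ) (R : Finset (Fin n)) : ℝ≥0∞ :=
  ((opened ρ R N).card : ℝ≥0∞) * ENNReal.ofReal f
    + ∑ v, (N v : ℝ≥0∞) * ENNReal.ofReal (d v (connect ρ R v))

/-! ### Differential privacy -/

/-- `law N` is the output distribution on the client vector `N`; neighbouring client vectors are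
those at `ℓ₁`-distance one. -/
def IsDP {n : ℕ} {S : Type} [MeasurableSpace S] (ε : ℝ) (law : (Fin n → ℕ) → Measure S) : Prop :=
  ∀ N N' : Fin n → ℕ, ∑ v, |(N v : ℤ) - (N' v : ℤ)| = 1 →
    ∀ T : Set S, MeasurableSet T → law N T ≤ ENNReal.ofReal (Real.exp ε) * law N' T

/-! ### Random tapes -/

/-- The Laplace distribution `Lap(1)`, with density `exp (-|x|) / 2`. -/
def laplace : Measure ℝ :=
  volume.withDensity fun x => ENNReal.ofReal (Real.exp (-|x|) / 2)

instance instIsProbabilityMeasureLaplace : IsProbabilityMeasure laplace := by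
  have h1 : ∫ x : ℝ, Real.exp (-|x|) / 2 = 1 := by
    rw [integral_div, integral_comp_abs (f := fun x => Real.exp (-x)), integral_exp_neg_Ioi_zero]
    norm_num
  have h2 : Integrable fun x : ℝ => Real.exp (-|x|) / 2 := by
    by_contra h
    rw [integral_undef h] at h1
    norm_num at h1
  refine ⟨?_⟩
  rw [laplace, withDensity_apply _ MeasurableSet.univ, Measure.restrict_univ,
    ← ofReal_integral_eq_lintegral_ofReal h2 (Filter.Eventually.of_forall fun x => by positivity),
    h1, ENNReal.ofReal_one]

/-- The randomness of an algorithm: a tape of uniform samples from `[0, 1]` and a tape of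
`Lap(1)` samples. -/
abbrev Tape : Type := (ℕ → unitInterval) × (ℕ → ℝ)

/-- All samples on the two tapes are independent. -/
def tapeMeasure : Measure Tape :=
  (Measure.infinitePi fun _ : ℕ => (volume : Measure unitInterval)).prod
    (Measure.infinitePi fun _ : ℕ => laplace)

/-! ### Randomised real random access machines

A structured programming language for the unit-cost real RAM. The memory consists of arrays of
natural numbers and of arrays of real numbers; an array has a name (a number fixed in the program)
and two indices (computed at run time). Natural numbers can be added, subtracted (truncated at `0`)
and compared; reals can be added, subtracted, multiplied, divided (`x / 0 = 0`) and compared. A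
natural number can be converted to a real number, but there is no rounding. The only constants are
natural numbers. -/

structure State where
  nat : ℕ → ℕ → ℕ → ℕ
  real : ℕ → ℕ → ℕ → ℝ
  /-- the number of uniform samples used so far -/
  uniformUsed : ℕ
  /-- the number of Laplace samples used so far -/
  laplaceUsed : ℕ

def State.setNat (s : State) (a i j x : ℕ) : State :=
  { s with nat := fun a' i' j' => if a' = a ∧ i' = i ∧ j' = j then x else s.nat a' i' j' }

def State.setReal (s : State) (a i j : ℕ) (x : ℝ) : State :=
  { s with
    real := fun a' i' j' =>
      open Classical in if a' = a ∧ i' = i ∧ j' = j then x else s.real a' i' j' }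

inductive NatExp : Type
  | const (k : ℕ)
  | get (a : ℕ) (i j : NatExp)
  | add (x y : NatExp)
  | sub (x y : NatExp)

def NatExp.eval (s : State) : NatExp → ℕ
  | .const k => k
  | .get a i j => s.nat a (i.eval s) (j.eval s)
  | .add x y => x.eval s + y.eval s
  | .sub x y => x.eval s - y.eval s

/-- The number of elementary operations in an evaluation. -/
def NatExp.size : NatExp → ℕ
  | .const _ => 1
  | .get _ i j => i.size + j.size + 1
  | .add x y => x.size + y.size + 1
  | .sub x y => x.size + y.size + 1

inductive RealExp : Type
  | ofNat (k : NatExp)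
  | get (a : ℕ) (i j : NatExp)
  | add (x y : RealExp)
  | sub (x y : RealExp)
  | mul (x y : RealExp)
  | div (x y : RealExp)

def RealExp.eval (s : State) : RealExp → ℝ
  | .ofNat k => (k.eval s : ℝ)
  | .get a i j => s.real a (i.eval s) (j.eval s)
  | .add x y => x.eval s + y.eval s
  | .sub x y => x.eval s - y.eval s
  | .mul x y => x.eval s * y.eval s
  | .div x y => x.eval s / y.eval s

def RealExp.size : RealExp → ℕ
  | .ofNat k => k.size + 1
  | .get _ i j => i.size + j.size + 1
  | .add x y => x.size + y.size + 1
  | .sub x y => x.size + y.size + 1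
  | .mul x y => x.size + y.size + 1
  | .div x y => x.size + y.size + 1

inductive Test : Type
  | natLE (x y : NatExp)
  | realLE (x y : RealExp)
  | not (b : Test)
  | and (b c : Test)

def Test.holds (s : State) : Test → Prop
  | .natLE x y => x.eval s ≤ y.eval s
  | .realLE x y => x.eval s ≤ y.eval s
  | .not b => ¬ b.holds s
  | .and b c => b.holds s ∧ c.holds s

def Test.size : Test → ℕ
  | .natLE x y => x.size + y.size + 1
  | .realLE x y => x.size + y.size + 1
  | .not b => b.size + 1
  | .and b c => b.size + c.size + 1

inductive Program : Type
  | skip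
  /-- `a[i, j] := x` for natural numbers -/
  | setNat (a : ℕ) (i j x : NatExp)
  /-- `a[i, j] := x` for real numbers -/
  | setReal (a : ℕ) (i j : NatExp) (x : RealExp)
  /-- `a[i, j] :=` a fresh uniform sample from `[0, 1]` -/
  | uniform (a : ℕ) (i j : NatExp)
  /-- `a[i, j] :=` a fresh sample from `Lap(1)` -/
  | laplace (a : ℕ) (i j : NatExp)
  | seq (P Q : Program)
  | ite (b : Test) (P Q : Program)
  | while (b : Test) (P : Program)

/-- `Exec ω P s t s'`: started in state `s` with random tapes `ω`, the program `P` halts after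
exactly `t` elementary steps in state `s'`. -/
inductive Exec (ω : Tape) : Program → State → ℕ → State → Prop
  | skip (s : State) : Exec ω .skip s 1 s
  | setNat (s : State) (a : ℕ) (i j x : NatExp) :
      Exec ω (.setNat a i j x) s (i.size + j.size + x.size + 1)
        (s.setNat a (i.eval s) (j.eval s) (x.eval s))
  | setReal (s : State) (a : ℕ) (i j : NatExp) (x : RealExp) :
      Exec ω (.setReal a i j x) s (i.size + j.size + x.size + 1)
        (s.setReal a (i.eval s) (j.eval s) (x.eval s))
  | uniform (s : State) (a : ℕ) (i j : NatExp) :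
      Exec ω (.uniform a i j) s (i.size + j.size + 1)
        { s.setReal a (i.eval s) (j.eval s) (ω.1 s.uniformUsed : ℝ) with
          uniformUsed := s.uniformUsed + 1 }
  | laplace (s : State) (a : ℕ) (i j : NatExp) :
      Exec ω (.laplace a i j) s (i.size + j.size + 1)
        { s.setReal a (i.eval s) (j.eval s) (ω.2 s.laplaceUsed) with
          laplaceUsed := s.laplaceUsed + 1 }
  | seq {P Q : Program} {s s' s'' : State} {t t' : ℕ} :
      Exec ω P s t s' → Exec ω Q s' t' s'' → Exec ω (.seq P Q) s (t + t') s''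
  | iteTrue {b : Test} {P Q : Program} {s s' : State} {t : ℕ} :
      b.holds s → Exec ω P s t s' → Exec ω (.ite b P Q) s (b.size + t) s'
  | iteFalse {b : Test} {P Q : Program} {s s' : State} {t : ℕ} :
      ¬ b.holds s → Exec ω Q s t s' → Exec ω (.ite b P Q) s (b.size + t) s'
  | whileFalse {b : Test} {P : Program} {s : State} :
      ¬ b.holds s → Exec ω (.while b P) s b.size s
  | whileTrue {b : Test} {P : Program} {s s' s'' : State} {t t' : ℕ} :
      b.holds s → Exec ω P s t s' → Exec ω (.while b P) s' t' s'' →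
        Exec ω (.while b P) s (b.size + t + t') s''

/-- A program has at most one run for given tapes and a given initial state. -/
theorem Exec.deterministic {ω : Tape} {P : Program} {s s₁ s₂ : State} {t₁ t₂ : ℕ}
    (h₁ : Exec ω P s t₁ s₁) (h₂ : Exec ω P s t₂ s₂) : t₁ = t₂ ∧ s₁ = s₂ := by
  induction h₁ generalizing t₂ s₂ with
  | skip => cases h₂; exact ⟨rfl, rfl⟩
  | setNat => cases h₂; exact ⟨rfl, rfl⟩
  | setReal => cases h₂; exact ⟨rfl, rfl⟩
  | uniform => cases h₂; exact ⟨rfl, rfl⟩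
  | laplace => cases h₂; exact ⟨rfl, rfl⟩
  | seq _ _ ihP ihQ =>
    cases h₂ with
    | seq hP hQ =>
      obtain ⟨rfl, rfl⟩ := ihP hP
      obtain ⟨rfl, rfl⟩ := ihQ hQ
      exact ⟨rfl, rfl⟩
  | iteTrue hb _ ih =>
    cases h₂ with
    | iteTrue _ h => obtain ⟨rfl, rfl⟩ := ih h; exact ⟨rfl, rfl⟩
    | iteFalse hb' _ => exact absurd hb hb'
  | iteFalse hb _ ih =>
    cases h₂ with
    | iteTrue hb' _ => exact absurd hb' hb
    | iteFalse _ h => obtain ⟨rfl, rfl⟩ := ih h; exact ⟨rfl, rfl⟩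
  | whileFalse hb =>
    cases h₂ with
    | whileFalse _ => exact ⟨rfl, rfl⟩
    | whileTrue hb' _ _ => exact absurd hb' hb
  | whileTrue hb _ _ ihP ihW =>
    cases h₂ with
    | whileFalse hb' => exact absurd hb hb'
    | whileTrue _ hP hW =>
      obtain ⟨rfl, rfl⟩ := ihP hP
      obtain ⟨rfl, rfl⟩ := ihW hW
      exact ⟨rfl, rfl⟩

/-! ### Input, output and input size -/

/-- Natural number arrays: `0[0, 0] = n` and `1[v, 0] = N v`. Real arrays: `0[u, v] = d u v`,
`1[0, 0] = f` and `1[0, 1] = ε`. All other cells are `0`. -/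
def initialState (n : ℕ) (d : Fin n → Fin n → ℝ) (f ε : ℝ) (N : Fin n → ℕ) : State where
  nat := fun a i j =>
    if a = 0 ∧ i = 0 ∧ j = 0 then n
    else if h : a = 1 ∧ i < n ∧ j = 0 then N ⟨i, h.2.1⟩
    else 0
  real := fun a i j =>
    if h : a = 0 ∧ i < n ∧ j < n then d ⟨i, h.2.1⟩ ⟨j, h.2.2⟩
    else if a = 1 ∧ i = 0 ∧ j = 0 then f
    else if a = 1 ∧ i = 0 ∧ j = 1 then ε
    else 0
  uniformUsed := 0
  laplaceUsed := 0

/-- The output set `R` is given by the nonzero cells `2[v, 0]` of the natural number memory. -/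
def outputSet (n : ℕ) (s : State) : Finset (Fin n) :=
  Finset.univ.filter fun v => s.nat 2 v 0 ≠ 0

/-- The output metric is given by the cells `2[u, v]` of the real memory. -/
def outputMetric (n : ℕ) (s : State) : Fin n → Fin n → ℝ :=
  fun u v => s.real 2 u v

/-- `n` plus the binary logarithms (rounded up, and replaced by `0` if negative) of the ratio of
the largest to the smallest nonzero distance, and of the ratio of the facility cost to the smallest
nonzero distance. -/
def inputSize {n : ℕ} (d : Fin n → Fin n → ℝ) (f : ℝ) : ℕ :=
  n + (Finset.univ.sup fun q : (Fin n × Fin n) × (Fin n × Fin n) =>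
      ⌈Real.logb 2 (d q.1.1 q.1.2 / d q.2.1 q.2.2)⌉₊)
    + (Finset.univ.sup fun q : Fin n × Fin n => ⌈Real.logb 2 (f / d q.1 q.2)⌉₊)

end UFL

end

noncomputable section

namespace UFL

/-! Put e = min ε 1 and r_j = e f / 4 ^ j. Without looking at the clients, a random hierarchical
partition in the manner of Fakcharoenphol, Rao and Talwar is drawn: from one scale U and one family
of priorities, every point u gets at level j the center of least priority in its ball of radius (1 +
U) / 2 · r_j, and the clusters of level j + 1 are the classes of points with equal centers at the
levels 0, …, j. The last radius is below all distances, so the last clusters are singletons. The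
published metric ρ counts the levels that separate two points. It is an ultrametric, so nearest
points under ρ follow the hierarchy.

The clients enter only through noisy counts. A cluster with radius r_j, j ≥ 1, is marked if its
count plus (2 ^ j / e) · Lap(1) reaches 4 H 4 ^ j / e, where H is the harmonic number of n; clusters
with radius r_0 need no test. A cluster is active if it and all larger clusters are marked, and R
takes one canonical point from each active cluster without active children. Radii shrink by 4 and
noise grows by 2, which makes two series converge at once. Privacy: one client changes one count per
level by one, at the price ∑_{j ≥ 1} e / 2 ^ j ≤ e (`sum_noiseShift_le`, `isDP_output`). Cost: noise
of scale 2 ^ j / e on clients that pay r_j costs f / 2 ^ j. Hence the number of levels does not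
enter the ratio.

For the cost, let S be any nonempty solution and let T v be the sum of the radii of the levels at
which v and its nearest point in S have different centers (`separation`). If the cluster of v at
radius r_j misses S, then r_j ≤ T v. Two deterministic bounds follow. A client whose active clusters
end above radius r_j travels at most 8 r_j; this is paid by T v, or else its cluster at radius r_j
meets S and is unmarked, so the clients there pay O(H f) plus noise, charged to a point of S
(`connection_le`). An opened facility whose cluster meets S is charged injectively to S; otherwise
its cluster is the untested one with radius r_0 and contains a client with T ≥ e f, or it holds
enough clients to pay f through T, or its mark is due to noise alone (`facilities_le`). The expected
number of marks of the last kind is at most 1 (`lintegral_card_falseMarks_le`). Only the second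
charge loses the factor 1 / e.

Finally T v has expectation at most 13 H d(v, S) (`lintegral_separation_le`). If the centers of u
and v differ, some w of least priority in the union of the two balls lies in only one of them
(`exists_cut`). The radius is cut by w with probability at most 2 d(u, v) / r_j; independently, w
beats all points at least as close to {u, v} with probability one over its rank. Each w matters at
no more than one level with r_j ≥ 8 d(u, v), and the inverse ranks sum to at most H.

On the machine side, programs with bounded loops (`Cmd`) have a state transformer, a frame rule and
a polynomial time bound. Only the computation of the number of levels needs a genuine while loop. -/

theorem State.setNat_nat_of_ne (s : State) {a a' i j x : ℕ} (h : a' ≠ a) :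
    (s.setNat a i j x).nat a' = s.nat a' := by
  funext i' j'
  simp [State.setNat, h]

theorem State.setReal_real_of_ne (s : State) {a a' i j : ℕ} {x : ℝ} (h : a' ≠ a) :
    (s.setReal a i j x).real a' = s.real a' := by
  funext i' j'
  simp [State.setReal, h]

@[simp]
theorem State.setNat_real (s : State) {a i j x : ℕ} : (s.setNat a i j x).real = s.real := rfl

/-! ### Programs built from bounded loops -/

/-- The cell `a[0, 0]`. -/
def NatExp.var (a : ℕ) : NatExp := .get a (.const 0) (.const 0)

/-- The cell `a[0, 0]` of the real memory. -/
def RealExp.var (a : ℕ) : RealExp := .get a (.const 0) (.const 0)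

/-- Equality of natural numbers. -/
def Test.natEq (x y : NatExp) : Test := .and (.natLE x y) (.natLE y x)

/-- Programs all of whose loops are bounded: `loop c b P` runs `P` with the counter `c[0, 0]`
ranging over the natural numbers below `b[0, 0]`. -/
inductive Cmd : Type
  | setNat (a : ℕ) (i j x : NatExp)
  | setReal (a : ℕ) (i j : NatExp) (x : RealExp)
  | uniform (a : ℕ) (i j : NatExp)
  | laplace (a : ℕ) (i j : NatExp)
  | seq (P Q : Cmd)
  | ite (b : Test) (P Q : Cmd)
  | when (b : Test) (P : Cmd)
  | loop (c b : ℕ) (P : Cmd)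

namespace Cmd

/-- The body of the while loop that implements a bounded loop. -/
def loopWhile (c b : ℕ) (P : Program) : Program :=
  .while (.natLE (.add (.var c) (.const 1)) (.var b))
    (.seq P (.setNat c (.const 0) (.const 0) (.add (.var c) (.const 1))))

def compile : Cmd → Program
  | setNat a i j x => .setNat a i j x
  | setReal a i j x => .setReal a i j x
  | uniform a i j => .uniform a i j
  | laplace a i j => .laplace a i j
  | seq P Q => .seq P.compile Q.compile
  | ite b P Q => .ite b P.compile Q.compile
  | when b P => .ite b P.compile .skip
  | loop c b P => .seq (.setNat c (.const 0) (.const 0) (.const 0)) (loopWhile c b P.compile)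

/-- The state in which a command ends. -/
def den (ω : Tape) : Cmd → State → State
  | setNat a i j x, s => s.setNat a (i.eval s) (j.eval s) (x.eval s)
  | setReal a i j x, s => s.setReal a (i.eval s) (j.eval s) (x.eval s)
  | uniform a i j, s =>
      { s.setReal a (i.eval s) (j.eval s) (ω.1 s.uniformUsed : ℝ) with
          uniformUsed := s.uniformUsed + 1 }
  | laplace a i j, s =>
      { s.setReal a (i.eval s) (j.eval s) (ω.2 s.laplaceUsed) with
          laplaceUsed := s.laplaceUsed + 1 }
  | seq P Q, s => Q.den ω (P.den ω s)
  | ite b P Q, s => open Classical in if b.holds s then P.den ω s else Q.den ω s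
  | when b P, s => open Classical in if b.holds s then P.den ω s else s
  | loop c b P, s =>
      Nat.rec (s.setNat c 0 0 0) (fun k s' => (P.den ω s').setNat c 0 0 (k + 1)) (s.nat b 0 0)

/-- The arrays of natural numbers that a command may change. -/
def writesNat : Cmd → ℕ → Bool
  | setNat a _ _ _, x => a == x
  | setReal _ _ _ _, _ => false
  | uniform _ _ _, _ => false
  | laplace _ _ _, _ => false
  | seq P Q, x => P.writesNat x || Q.writesNat x
  | ite _ P Q, x => P.writesNat x || Q.writesNat x
  | when _ P, x => P.writesNat x
  | loop c _ P, x => c == x || P.writesNat x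

/-- The arrays of real numbers that a command may change. -/
def writesReal : Cmd → ℕ → Bool
  | setNat _ _ _ _, _ => false
  | setReal a _ _ _, x => a == x
  | uniform a _ _, x => a == x
  | laplace a _ _, x => a == x
  | seq P Q, x => P.writesReal x || Q.writesReal x
  | ite _ P Q, x => P.writesReal x || Q.writesReal x
  | when _ P, x => P.writesReal x
  | loop _ _ P, x => P.writesReal x

/-- Whether a command draws Laplace samples. -/
def drawsLaplace : Cmd → Bool
  | setNat _ _ _ _ => false
  | setReal _ _ _ _ => false
  | uniform _ _ _ => false
  | laplace _ _ _ => true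
  | seq P Q => P.drawsLaplace || Q.drawsLaplace
  | ite _ P Q => P.drawsLaplace || Q.drawsLaplace
  | when _ P => P.drawsLaplace
  | loop _ _ P => P.drawsLaplace

/-- Whether a command draws uniform samples. -/
def drawsUniform : Cmd → Bool
  | setNat _ _ _ _ => false
  | setReal _ _ _ _ => false
  | uniform _ _ _ => true
  | laplace _ _ _ => false
  | seq P Q => P.drawsUniform || Q.drawsUniform
  | ite _ P Q => P.drawsUniform || Q.drawsUniform
  | when _ P => P.drawsUniform
  | loop _ _ P => P.drawsUniform

/-- All loop bounds are cells `0[0, 0]` or `7[0, 0]`, and neither these nor the loop counters are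
changed inside a loop. -/
def wellFormed : Cmd → Bool
  | setNat a _ _ _ => a != 0 && a != 7
  | setReal _ _ _ _ => true
  | uniform _ _ _ => true
  | laplace _ _ _ => true
  | seq P Q => P.wellFormed && Q.wellFormed
  | ite _ P Q => P.wellFormed && Q.wellFormed
  | when _ P => P.wellFormed
  | loop c b P => P.wellFormed && c != 0 && c != 7 && (b == 0 || b == 7) && !P.writesNat c

/-- A bound for the running time in terms of a bound for the two cells that bound the loops. -/
def time : Cmd → Polynomial ℕ
  | setNat _ i j x => .C (i.size + j.size + x.size + 1)
  | setReal _ i j x => .C (i.size + j.size + x.size + 1)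
  | uniform _ i j => .C (i.size + j.size + 1)
  | laplace _ i j => .C (i.size + j.size + 1)
  | seq P Q => P.time + Q.time
  | ite b P Q => .C b.size + P.time + Q.time
  | when b P => .C b.size + P.time + 1
  | loop _ _ P => .C 20 + .X * (P.time + .C 20)

/-- The frame rule: every stage is specified by the arrays it writes, and everything else is carried
along by evaluating a Boolean. -/
theorem den_nat_of_not_writes (ω : Tape) (P : Cmd) (a : ℕ) (h : P.writesNat a = false)
    (s : State) : (P.den ω s).nat a = s.nat a := by
  induction P generalizing s with
  | setNat a' i j x =>
    simp only [writesNat, beq_eq_false_iff_ne] at h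
    funext i' j'
    simp [den, State.setNat, h.symm]
  | setReal => rfl
  | uniform => rfl
  | laplace => rfl
  | seq P Q ihP ihQ =>
    simp only [writesNat, Bool.or_eq_false_iff] at h
    rw [den, ihQ h.2, ihP h.1]
  | ite b P Q ihP ihQ =>
    simp only [writesNat, Bool.or_eq_false_iff] at h
    rw [den]; split_ifs
    · exact ihP h.1 s
    · exact ihQ h.2 s
  | when b P ihP =>
    rw [den]; split_ifs
    · exact ihP h s
    · rfl
  | loop c b P ihP =>
    simp only [writesNat, Bool.or_eq_false_iff, beq_eq_false_iff_ne] at h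
    rw [den]
    generalize s.nat b 0 0 = m
    induction m with
    | zero => exact State.setNat_nat_of_ne s h.1.symm
    | succ k ih => exact (State.setNat_nat_of_ne _ h.1.symm).trans ((ihP h.2 _).trans ih)

theorem den_real_of_not_writes (ω : Tape) (P : Cmd) (a : ℕ) (h : P.writesReal a = false)
    (s : State) : (P.den ω s).real a = s.real a := by
  induction P generalizing s with
  | setReal a' i j x =>
    simp only [writesReal, beq_eq_false_iff_ne] at h
    funext i' j'
    simp [den, State.setReal, h.symm]
  | setNat => rfl
  | uniform a' i j =>
    simp only [writesReal, beq_eq_false_iff_ne] at h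
    funext i' j'
    simp [den, State.setReal, h.symm]
  | laplace a' i j =>
    simp only [writesReal, beq_eq_false_iff_ne] at h
    funext i' j'
    simp [den, State.setReal, h.symm]
  | seq P Q ihP ihQ =>
    simp only [writesReal, Bool.or_eq_false_iff] at h
    rw [den, ihQ h.2, ihP h.1]
  | ite b P Q ihP ihQ =>
    simp only [writesReal, Bool.or_eq_false_iff] at h
    rw [den]; split_ifs
    · exact ihP h.1 s
    · exact ihQ h.2 s
  | when b P ihP =>
    rw [den]; split_ifs
    · exact ihP h s
    · rfl
  | loop c b P ihP =>
    simp only [writesReal] at h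
    rw [den]
    generalize s.nat b 0 0 = m
    induction m with
    | zero => rfl
    | succ k ih => exact (ihP h _).trans ih

theorem den_laplaceUsed (ω : Tape) (P : Cmd) (h : P.drawsLaplace = false)
    (s : State) : (P.den ω s).laplaceUsed = s.laplaceUsed := by
  induction P generalizing s with
  | setReal => rfl
  | setNat => rfl
  | uniform => rfl
  | laplace => simp [drawsLaplace] at h
  | seq P Q ihP ihQ =>
    simp only [drawsLaplace, Bool.or_eq_false_iff] at h
    rw [den, ihQ h.2, ihP h.1]
  | ite b P Q ihP ihQ =>
    simp only [drawsLaplace, Bool.or_eq_false_iff] at h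
    rw [den]; split_ifs
    · exact ihP h.1 s
    · exact ihQ h.2 s
  | when b P ihP =>
    rw [den]; split_ifs
    · exact ihP h s
    · rfl
  | loop c b P ihP =>
    simp only [drawsLaplace] at h
    rw [den]
    generalize s.nat b 0 0 = m
    induction m with
    | zero => rfl
    | succ k ih => exact (ihP h _).trans ih

theorem den_uniformUsed (ω : Tape) (P : Cmd) (h : P.drawsUniform = false)
    (s : State) : (P.den ω s).uniformUsed = s.uniformUsed := by
  induction P generalizing s with
  | setReal => rfl
  | setNat => rfl
  | laplace => rfl
  | uniform => simp [drawsUniform] at h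
  | seq P Q ihP ihQ =>
    simp only [drawsUniform, Bool.or_eq_false_iff] at h
    rw [den, ihQ h.2, ihP h.1]
  | ite b P Q ihP ihQ =>
    simp only [drawsUniform, Bool.or_eq_false_iff] at h
    rw [den]; split_ifs
    · exact ihP h.1 s
    · exact ihQ h.2 s
  | when b P ihP =>
    rw [den]; split_ifs
    · exact ihP h s
    · rfl
  | loop c b P ihP =>
    simp only [drawsUniform] at h
    rw [den]
    generalize s.nat b 0 0 = m
    induction m with
    | zero => rfl
    | succ k ih => exact (ihP h _).trans ih

/-- This keeps the loop bounds constant during the whole run, so a polynomial in their initial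
values can bound the running time. -/
theorem not_writesNat_of_wellFormed (P : Cmd) (h : P.wellFormed = true) :
    P.writesNat 0 = false ∧ P.writesNat 7 = false := by
  induction P with
  | setNat a i j x => simpa [wellFormed, writesNat] using h
  | setReal => simp [writesNat]
  | uniform => simp [writesNat]
  | laplace => simp [writesNat]
  | seq P Q ihP ihQ =>
    simp only [wellFormed, Bool.and_eq_true] at h
    simp [writesNat, ihP h.1, ihQ h.2]
  | ite b P Q ihP ihQ =>
    simp only [wellFormed, Bool.and_eq_true] at h
    simp [writesNat, ihP h.1, ihQ h.2]
  | when b P ihP => exact ihP h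
  | loop c b P ihP =>
    simp only [wellFormed, Bool.and_eq_true, bne_iff_ne, ne_eq] at h
    simp [writesNat, ihP h.1.1.1.1, h.1.1.1.2, h.1.1.2]

/-- `F k` is the state at the start of round `k`; the induction is on the number `i` of rounds that
remain. -/
theorem exec_loopWhile {ω : Tape} {c b : ℕ} {P : Program} {T m : ℕ} {F : ℕ → State}
    (hc : ∀ k, (F k).nat c 0 0 = k) (hb : ∀ k, (F k).nat b 0 0 = m)
    (hP : ∀ k, ∃ t ≤ T, ∃ s', Exec ω P (F k) t s' ∧ s'.nat c 0 0 = k ∧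
      s'.setNat c 0 0 (k + 1) = F (k + 1)) (i k : ℕ) (hik : k + i = m) :
    ∃ t ≤ 9 + i * (T + 20), Exec ω (loopWhile c b P) (F k) t (F m) := by
  induction i generalizing k with
  | zero =>
    obtain rfl : k = m := by omega
    refine ⟨_, ?_, .whileFalse ?_⟩
    · simp [Test.size, NatExp.size, NatExp.var]
    · simp [Test.holds, NatExp.eval, NatExp.var, hc, hb]
  | succ i ih =>
    obtain ⟨t, ht, h⟩ := ih (k + 1) (by omega)
    obtain ⟨t', ht', s', hs', hk, hF⟩ := hP k
    have hset := Exec.setNat (ω := ω) s' c (.const 0) (.const 0) (.add (.var c) (.const 1))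
    simp only [NatExp.eval, NatExp.var, NatExp.size, hk, hF] at hset
    refine ⟨_, ?_, .whileTrue ?_ (.seq hs' hset) h⟩
    -- A test takes 9 steps and the increment of the counter 8, within the allowance of 20 per
    -- round.
    · simp only [Test.size, NatExp.size, NatExp.var]
      have : (i + 1) * (T + 20) = i * (T + 20) + (T + 20) := by ring
      omega
    · simp only [Test.holds, NatExp.eval, NatExp.var, hc, hb]; omega

theorem exec_compile (ω : Tape) (P : Cmd) (hP : P.wellFormed = true) (M : ℕ) (s : State)
    (h0 : s.nat 0 0 0 ≤ M) (h7 : s.nat 7 0 0 ≤ M) :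
    ∃ t ≤ P.time.eval M, Exec ω P.compile s t (P.den ω s) := by
  induction P generalizing s with
  | setNat a i j x => exact ⟨_, by simp [time], .setNat _ _ _ _ _⟩
  | setReal a i j x => exact ⟨_, by simp [time], .setReal _ _ _ _ _⟩
  | uniform a i j => exact ⟨_, by simp [time], .uniform _ _ _ _⟩
  | laplace a i j => exact ⟨_, by simp [time], .laplace _ _ _ _⟩
  | seq P Q ihP ihQ =>
    simp only [wellFormed, Bool.and_eq_true] at hP
    obtain ⟨t, ht, h⟩ := ihP hP.1 s h0 h7
    have hw := not_writesNat_of_wellFormed P hP.1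
    obtain ⟨t', ht', h'⟩ := ihQ hP.2 (P.den ω s)
      (by rwa [den_nat_of_not_writes _ _ _ hw.1]) (by rwa [den_nat_of_not_writes _ _ _ hw.2])
    exact ⟨_, by simp only [time, Polynomial.eval_add]; omega, .seq h h'⟩
  | ite b P Q ihP ihQ =>
    simp only [wellFormed, Bool.and_eq_true] at hP
    by_cases hb : b.holds s
    · obtain ⟨t, ht, h⟩ := ihP hP.1 s h0 h7
      refine ⟨b.size + t, ?_, by rw [den, if_pos hb]; exact .iteTrue hb h⟩
      · simp only [time, Polynomial.eval_add, Polynomial.eval_C]; omega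
    · obtain ⟨t, ht, h⟩ := ihQ hP.2 s h0 h7
      refine ⟨b.size + t, ?_, by rw [den, if_neg hb]; exact .iteFalse hb h⟩
      · simp only [time, Polynomial.eval_add, Polynomial.eval_C]; omega
  | when b P ihP =>
    by_cases hb : b.holds s
    · obtain ⟨t, ht, h⟩ := ihP hP s h0 h7
      refine ⟨b.size + t, ?_, by rw [den, if_pos hb]; exact .iteTrue hb h⟩
      · simp only [time, Polynomial.eval_add, Polynomial.eval_C]; omega
    · refine ⟨b.size + 1, ?_, by rw [den, if_neg hb]; exact .iteFalse hb (.skip _)⟩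
      · simp only [time, Polynomial.eval_add, Polynomial.eval_C, Polynomial.eval_one]; omega
  | loop c b P ihP =>
    simp only [wellFormed, Bool.and_eq_true, bne_iff_ne, ne_eq, Bool.or_eq_true, beq_iff_eq,
      Bool.not_eq_true'] at hP
    obtain ⟨⟨⟨⟨hwf, hc0⟩, hc7⟩, hb⟩, hcw⟩ := hP
    have hw := not_writesNat_of_wellFormed P hwf
    set F : ℕ → State := fun m =>
      Nat.rec (s.setNat c 0 0 0) (fun k s' => (P.den ω s').setNat c 0 0 (k + 1)) m with hF
    have hFs : ∀ k, F (k + 1) = (P.den ω (F k)).setNat c 0 0 (k + 1) := fun k => rfl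
    have hFc : ∀ k, (F k).nat c 0 0 = k := by
      intro k
      cases k with
      | zero => simp [hF, State.setNat]
      | succ k => simp [hFs, State.setNat]
    have hF0 : ∀ k, (F k).nat 0 0 0 = s.nat 0 0 0 := by
      intro k
      induction k with
      | zero => simp [hF, State.setNat, Ne.symm hc0]
      | succ k ih =>
        rw [← ih, hFs]
        simp [State.setNat, Ne.symm hc0, den_nat_of_not_writes _ _ _ hw.1]
    have hF7 : ∀ k, (F k).nat 7 0 0 = s.nat 7 0 0 := by
      intro k
      induction k with
      | zero => simp [hF, State.setNat, Ne.symm hc7]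
      | succ k ih =>
        rw [← ih, hFs]
        simp [State.setNat, Ne.symm hc7, den_nat_of_not_writes _ _ _ hw.2]
    have hFb : ∀ k, (F k).nat b 0 0 = s.nat b 0 0 := by
      intro k; rcases hb with rfl | rfl
      · exact hF0 k
      · exact hF7 k
    have hm : s.nat b 0 0 ≤ M := by rcases hb with rfl | rfl <;> assumption
    obtain ⟨t, ht, h⟩ := exec_loopWhile (ω := ω) (P := P.compile) (T := P.time.eval M) hFc hFb
      (fun k => by
        obtain ⟨t, ht, h⟩ := ihP hwf (F k) (by rwa [hF0]) (by rwa [hF7])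
        exact ⟨t, ht, _, h, by rw [den_nat_of_not_writes _ _ _ hcw, hFc], rfl⟩)
      (s.nat b 0 0) 0 (by omega)
    refine ⟨_, ?_, .seq (.setNat _ _ _ _ _) h⟩
    simp only [time, NatExp.size, Polynomial.eval_add, Polynomial.eval_mul, Polynomial.eval_C,
      Polynomial.eval_X]
    have := Nat.mul_le_mul_right (P.time.eval M + 20) hm
    omega

theorem den_when_pos {ω : Tape} {b : Test} {P : Cmd} {s : State} (h : b.holds s) :
    (when b P).den ω s = P.den ω s := by
  rw [den, if_pos h]

theorem den_when_neg {ω : Tape} {b : Test} {P : Cmd} {s : State} (h : ¬ b.holds s) :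
    (when b P).den ω s = s := by
  rw [den, if_neg h]

/-- The arrays that `P` does not write are the same in `s` and `s'`. -/
structure Frame (P : Cmd) (s s' : State) : Prop where
  nat : ∀ a, P.writesNat a = false → s'.nat a = s.nat a
  real : ∀ a, P.writesReal a = false → s'.real a = s.real a

theorem frame_den (ω : Tape) (P : Cmd) (s : State) : Frame P s (P.den ω s) :=
  ⟨fun a h => den_nat_of_not_writes ω P a h s, fun a h => den_real_of_not_writes ω P a h s⟩

/-- Induction over the rounds of a bounded loop. -/
theorem den_loop_induction {ω : Tape} {c b : ℕ} {P : Cmd} {s : State} {m : ℕ}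
    (hm : s.nat b 0 0 = m) (Inv : ℕ → State → Prop) (h0 : Inv 0 (s.setNat c 0 0 0))
    (hstep : ∀ k < m, ∀ s', s'.nat c 0 0 = k → Frame (loop c b P) s s' → Inv k s' →
      Inv (k + 1) ((P.den ω s').setNat c 0 0 (k + 1))) :
    Inv m ((loop c b P).den ω s) := by
  rw [den, hm]
  suffices h : ∀ k ≤ m, ∀ s', s' = Nat.rec (motive := fun _ => State) (s.setNat c 0 0 0)
      (fun k s' => (P.den ω s').setNat c 0 0 (k + 1)) k →
        s'.nat c 0 0 = k ∧ Frame (loop c b P) s s' ∧ Inv k s' from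
    (h m le_rfl _ rfl).2.2
  intro k
  induction k with
  | zero =>
    rintro - s' rfl
    refine ⟨by simp [State.setNat], ⟨fun a ha => ?_, fun a ha => rfl⟩, h0⟩
    simp only [writesNat, Bool.or_eq_false_iff, beq_eq_false_iff_ne] at ha
    exact State.setNat_nat_of_ne s ha.1.symm
  | succ k ih =>
    rintro hk s' rfl
    obtain ⟨h1, h2, h3⟩ := ih (by omega) _ rfl
    refine ⟨by simp [State.setNat], ⟨fun a ha => ?_, fun a ha => ?_⟩,
      hstep k (by omega) _ h1 h2 h3⟩
    · have hf := h2.nat a ha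
      simp only [writesNat, Bool.or_eq_false_iff, beq_eq_false_iff_ne] at ha
      exact (State.setNat_nat_of_ne _ ha.1.symm).trans
        ((den_nat_of_not_writes ω P a ha.2 _).trans hf)
    · exact (den_real_of_not_writes ω P a ha _).trans (h2.real a ha)

end Cmd

/-! ### The quantities computed by the algorithm, as functions on natural numbers. -/

open Classical in
/-- The last index below `k` that satisfies `P`, and `0` if there is none. -/
def lastSat (P : ℕ → Prop) : ℕ → ℕ
  | 0 => 0
  | k + 1 => if P k then k else lastSat P k

open Classical in
/-- The last index below `k` at which `p` attains its minimum over `E`, where the search starts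
with the index `top`. -/
def lastArgmin (E : ℕ → Prop) (p : ℕ → ℝ) (top : ℕ) : ℕ → ℕ
  | 0 => top
  | k + 1 => if E k ∧ p k ≤ p (lastArgmin E p top k) then k else lastArgmin E p top k

/-- The labels of the clusters. At level `0` all points are together; two points are together at
level `j + 1` if they are together at level `j` and have the same center `c j`. -/
def label (c : ℕ → ℕ → ℕ) (n : ℕ) : ℕ → ℕ → ℕ
  | 0, _ => 0
  | j + 1, u => lastSat (fun v => label c n j u = label c n j v ∧ c j u = c j v) n

open Classical in
/-- The number of levels below `L` at which `u` and `v` are separated. -/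
def treeDist (lab : ℕ → ℕ → ℕ) (L u v : ℕ) : ℕ :=
  ∑ j ∈ Finset.range L, if lab (j + 1) u = lab (j + 1) v then 0 else 1

open Classical in
/-- The number of clients in a cluster. -/
def clusterCount (lab : ℕ → ℕ → ℕ) (N : ℕ → ℕ) (n j x : ℕ) : ℕ :=
  ∑ v ∈ Finset.range n, if lab (j + 1) v = x then N v else 0

open Classical in
/-- The number of levels below `j` at which the cluster of `u` is active. -/
def activeLevels (lab : ℕ → ℕ → ℕ) (mark : ℕ → ℕ → Prop) : ℕ → ℕ → ℕ
  | 0, _ => 0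
  | j + 1, u =>
    if activeLevels lab mark j u = j ∧ (1 ≤ j → mark j (lab (j + 1) u)) then j + 1
    else activeLevels lab mark j u

/-- `u` is the canonical point of an active cluster without active children. -/
def IsChosen (lab : ℕ → ℕ → ℕ) (K : ℕ → ℕ) (n u : ℕ) : Prop :=
  ∀ v < n, lab (K u) v = lab (K u) u → K v ≤ K u ∧ v ≤ u

/-- The condition for `w` to be a possible center of `u` at level `j`: the distance of `u` and `w`
is at most `(1 + U) / 2 * (e * f / 4 ^ j)`. -/
def InBall (D : ℕ → ℕ → ℝ) (U e f : ℝ) (j u w : ℕ) : Prop :=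
  2 * D u w * (2 ^ j * 2 ^ j) ≤ (1 + U) * (e * f)

open Classical in
/-- The centers of the points `u < n` at the levels `j < L`. -/
def center (D : ℕ → ℕ → ℝ) (U e f : ℝ) (p : ℕ → ℝ) (n L j u : ℕ) : ℕ :=
  if j < L ∧ u < n then lastArgmin (InBall D U e f j u) p n n else 0

/-- The noisy test whether the cluster with label `x` at level `j` has enough clients. -/
def IsMarked (H e : ℝ) (cnt : ℕ → ℕ → ℕ) (X : ℕ → ℕ → ℝ) (j x : ℕ) : Prop :=
  4 * H * (2 ^ j * 2 ^ j) / e ≤ cnt j x + 2 ^ j / e * X j x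

namespace Cmd

/-! ### Labels -/

/-- Memory layout. Natural arrays: 3, 4, 5 hold the level j and the points u, v; 6[j, 0] = 2 ^ j; 7
the number of levels; 8[j, u] centers; 9[i, u] labels; 10[j, x] counts; 11[u, 0] depths. Real
arrays: 3 the scale U; 4[w, 0] priorities; 5[j, x] noise; 6 the harmonic number; 7 the value e; 8
the smallest distance. -/
def labelBody : Cmd :=
  when (.and (.natEq (.get 9 (.var 3) (.var 4)) (.get 9 (.var 3) (.var 5)))
      (.natEq (.get 8 (.var 3) (.var 4)) (.get 8 (.var 3) (.var 5))))
    (setNat 9 (.add (.var 3) (.const 1)) (.var 4) (.var 5))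

def labelRow : Cmd := loop 5 0 labelBody

def labelLevel : Cmd := loop 4 0 labelRow

def labelCmd : Cmd := loop 3 7 labelLevel

/-- Row j + 1 reads only row j of the labels and the centers, so it can be filled in place. Scanning
v upwards and overwriting leaves the last match, which is `lastSat`. -/
theorem labelRow_spec {ω : Tape} {s : State} {n j u : ℕ} {c : ℕ → ℕ → ℕ}
    (hn : s.nat 0 0 0 = n) (hj : s.nat 3 0 0 = j) (hu : s.nat 4 0 0 = u)
    (hc : s.nat 8 = c) (hun : u < n)
    (h : ∀ i x, s.nat 9 i x =
      if (i ≤ j ∧ x < n) ∨ (i = j + 1 ∧ x < u) then label c n i x else 0) (i x : ℕ) :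
    (labelRow.den ω s).nat 9 i x =
      if (i ≤ j ∧ x < n) ∨ (i = j + 1 ∧ x < u + 1) then label c n i x else 0 := by
  have key := den_loop_induction (ω := ω) (c := 5) (b := 0) (P := labelBody) hn
    (fun k s' => ∀ i x, s'.nat 9 i x =
      if (i ≤ j ∧ x < n) ∨ (i = j + 1 ∧ x < u) then label c n i x else
      if i = j + 1 ∧ x = u then lastSat (fun v => label c n j u = label c n j v ∧ c j u = c j v) k
      else 0) (by
        intro i x
        rw [State.setNat_nat_of_ne _ (by decide), h]
        simp [lastSat]) (by
        intro k hk s' hk' hf hI i x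
        have f3 := hf.nat 3 rfl
        have f4 := hf.nat 4 rfl
        have f8 := hf.nat 8 rfl
        rw [State.setNat_nat_of_ne _ (by decide)]
        simp only [labelBody, den, Test.natEq, Test.holds, NatExp.eval, NatExp.var, hk', f3, f4,
          f8, hj, hu, hc, ← le_antisymm_iff]
        have e1 := hI j u
        have e2 := hI j k
        simp only [le_refl, hun, and_self, Nat.left_eq_add, one_ne_zero, lt_self_iff_false,
          or_false, ↓reduceIte, hk] at e1 e2
        simp only [true_or, if_true] at e1 e2
        rw [e1, e2]
        by_cases hT : label c n j u = label c n j k ∧ c j u = c j k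
        · simp only [if_pos hT, State.setNat, lastSat]
          simp only [hI]
          split_ifs <;> grind
        · simp only [if_neg hT, lastSat, hI])
  refine (key i x).trans ?_
  by_cases h1 : (i ≤ j ∧ x < n) ∨ (i = j + 1 ∧ x < u)
  · rw [if_pos h1, if_pos (by omega)]
  · rw [if_neg h1]
    by_cases h2 : i = j + 1 ∧ x = u
    · rw [if_pos h2, if_pos (by omega), h2.1, h2.2, label]
    · rw [if_neg h2, if_neg (by omega)]

theorem labelLevel_spec {ω : Tape} {s : State} {n j : ℕ} {c : ℕ → ℕ → ℕ}
    (hn : s.nat 0 0 0 = n) (hj : s.nat 3 0 0 = j) (hc : s.nat 8 = c)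
    (h : ∀ i x, s.nat 9 i x = if i ≤ j ∧ x < n then label c n i x else 0) (i x : ℕ) :
    (labelLevel.den ω s).nat 9 i x = if i ≤ j + 1 ∧ x < n then label c n i x else 0 := by
  have key := den_loop_induction (ω := ω) (c := 4) (b := 0) (P := labelRow) hn
    (fun u s' => ∀ i x, s'.nat 9 i x =
      if (i ≤ j ∧ x < n) ∨ (i = j + 1 ∧ x < u) then label c n i x else 0) (by
        intro i x
        rw [State.setNat_nat_of_ne _ (by decide), h]
        simp) (by
        intro k hk s' hk' hf hI i x
        rw [State.setNat_nat_of_ne _ (by decide)]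
        exact labelRow_spec ((congrFun₂ (hf.nat 0 rfl) 0 0).trans hn)
          ((congrFun₂ (hf.nat 3 rfl) 0 0).trans hj) hk' ((hf.nat 8 rfl).trans hc) hk hI i x)
  refine (key i x).trans ?_
  congr 1
  simp only [eq_iff_iff]
  omega

theorem labelCmd_spec {ω : Tape} {s : State} {n L : ℕ} {c : ℕ → ℕ → ℕ}
    (hn : s.nat 0 0 0 = n) (hL : s.nat 7 0 0 = L) (hc : s.nat 8 = c)
    (h : ∀ i x, s.nat 9 i x = 0) (i x : ℕ) :
    (labelCmd.den ω s).nat 9 i x = if i ≤ L ∧ x < n then label c n i x else 0 :=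
  den_loop_induction (ω := ω) (c := 3) (b := 7) (P := labelLevel) hL
    (fun j s' => ∀ i x, s'.nat 9 i x = if i ≤ j ∧ x < n then label c n i x else 0) (by
      intro i x
      rw [State.setNat_nat_of_ne _ (by decide), h]
      split_ifs with h0
      · rw [Nat.le_zero.1 h0.1, label]
      · rfl) (by
      intro k hk s' hk' hf hI i x
      rw [State.setNat_nat_of_ne _ (by decide)]
      exact labelLevel_spec ((congrFun₂ (hf.nat 0 rfl) 0 0).trans hn) hk'
        ((hf.nat 8 rfl).trans hc) hI i x) i x

/-! ### The published metric -/

def distBody : Cmd :=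
  when (.not (.natEq (.get 9 (.add (.var 3) (.const 1)) (.var 4))
      (.get 9 (.add (.var 3) (.const 1)) (.var 5))))
    (setReal 2 (.var 4) (.var 5) (.add (.get 2 (.var 4) (.var 5)) (.ofNat (.const 1))))

def distRow : Cmd := loop 5 0 distBody

def distLevel : Cmd := loop 4 0 distRow

def distCmd : Cmd := loop 3 7 distLevel

theorem treeDist_succ (lab : ℕ → ℕ → ℕ) (L u v : ℕ) : treeDist lab (L + 1) u v =
    if lab (L + 1) u = lab (L + 1) v then treeDist lab L u v else treeDist lab L u v + 1 := by
  rw [treeDist, Finset.sum_range_succ, ← treeDist]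
  split_ifs <;> rfl

theorem distRow_spec {ω : Tape} {s : State} {n j u : ℕ} {lab : ℕ → ℕ → ℕ}
    (hn : s.nat 0 0 0 = n) (hj : s.nat 3 0 0 = j) (hu : s.nat 4 0 0 = u) (hl : s.nat 9 = lab)
    (h : ∀ x < n, ∀ y < n, s.real 2 x y =
      if x < u then (treeDist lab (j + 1) x y : ℝ) else treeDist lab j x y) :
    ∀ x < n, ∀ y < n, (distRow.den ω s).real 2 x y =
      if x < u + 1 then (treeDist lab (j + 1) x y : ℝ) else treeDist lab j x y := by
  have key := den_loop_induction (ω := ω) (c := 5) (b := 0) (P := distBody) hn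
    (fun k s' => ∀ x < n, ∀ y < n, s'.real 2 x y =
      if x < u ∨ (x = u ∧ y < k) then (treeDist lab (j + 1) x y : ℝ) else treeDist lab j x y) (by
        intro x hx y hy
        simpa using h x hx y hy) (by
        intro k hk s' hk' hf hI x hx y hy
        have f3 := hf.nat 3 rfl
        have f4 := hf.nat 4 rfl
        have f9 := hf.nat 9 rfl
        simp only [State.setNat, distBody, den, Test.natEq, Test.holds, NatExp.eval, NatExp.var,
          hk', f3, f4, f9, hj, hu, hl, ← le_antisymm_iff, RealExp.eval, State.setReal]
        by_cases hT : lab (j + 1) u = lab (j + 1) k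
        · simp only [hT, not_true, if_false]
          rw [hI x hx y hy]
          by_cases hxy : x = u ∧ y = k
          · obtain ⟨rfl, rfl⟩ := hxy
            simp [treeDist_succ, hT]
          · congr 1
            simp only [eq_iff_iff]; omega
        · simp only [hT, not_false_eq_true, if_true]
          by_cases hxy : x = u ∧ y = k
          · obtain ⟨rfl, rfl⟩ := hxy
            simp [treeDist_succ, hT, hI x hx y hy]
          · simp only [true_and, hxy, if_false]
            rw [hI x hx y hy]
            congr 1
            simp only [eq_iff_iff]; omega)
  intro x hx y hy
  refine (key x hx y hy).trans ?_
  congr 1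
  simp only [eq_iff_iff]
  omega

theorem distLevel_spec {ω : Tape} {s : State} {n j : ℕ} {lab : ℕ → ℕ → ℕ}
    (hn : s.nat 0 0 0 = n) (hj : s.nat 3 0 0 = j) (hl : s.nat 9 = lab)
    (h : ∀ x < n, ∀ y < n, s.real 2 x y = treeDist lab j x y) :
    ∀ x < n, ∀ y < n, (distLevel.den ω s).real 2 x y = treeDist lab (j + 1) x y := by
  have key := den_loop_induction (ω := ω) (c := 4) (b := 0) (P := distRow) hn
    (fun u s' => ∀ x < n, ∀ y < n, s'.real 2 x y =
      if x < u then (treeDist lab (j + 1) x y : ℝ) else treeDist lab j x y) (by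
        intro x hx y hy
        simpa using h x hx y hy) (by
        intro k hk s' hk' hf hI
        exact distRow_spec ((congrFun₂ (hf.nat 0 rfl) 0 0).trans hn)
          ((congrFun₂ (hf.nat 3 rfl) 0 0).trans hj) hk' ((hf.nat 9 rfl).trans hl) hI)
  intro x hx y hy
  rw [distLevel, key x hx y hy, if_pos hx]

theorem distCmd_spec {ω : Tape} {s : State} {n L : ℕ} {lab : ℕ → ℕ → ℕ}
    (hn : s.nat 0 0 0 = n) (hL : s.nat 7 0 0 = L) (hl : s.nat 9 = lab)
    (h : ∀ x y, s.real 2 x y = 0) :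
    ∀ x < n, ∀ y < n, (distCmd.den ω s).real 2 x y = treeDist lab L x y :=
  den_loop_induction (ω := ω) (c := 3) (b := 7) (P := distLevel) hL
    (fun j s' => ∀ x < n, ∀ y < n, s'.real 2 x y = treeDist lab j x y) (by
      intro x hx y hy
      simpa [treeDist] using h x y) (by
      intro k hk s' hk' hf hI
      exact distLevel_spec ((congrFun₂ (hf.nat 0 rfl) 0 0).trans hn) hk'
        ((hf.nat 9 rfl).trans hl) hI)

/-! ### Counting the clients -/

def countBody : Cmd :=
  setNat 10 (.var 3) (.get 9 (.add (.var 3) (.const 1)) (.var 5))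
    (.add (.get 10 (.var 3) (.get 9 (.add (.var 3) (.const 1)) (.var 5)))
      (.get 1 (.var 5) (.const 0)))

def countLevel : Cmd := loop 5 0 countBody

def countCmd : Cmd := loop 3 7 countLevel

theorem countLevel_spec {ω : Tape} {s : State} {n j : ℕ} {lab : ℕ → ℕ → ℕ} {N : ℕ → ℕ}
    (hn : s.nat 0 0 0 = n) (hj : s.nat 3 0 0 = j) (hl : s.nat 9 = lab)
    (hN : ∀ v, s.nat 1 v 0 = N v)
    (h : ∀ i x, s.nat 10 i x = if i < j then clusterCount lab N n i x else 0) (i x : ℕ) :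
    (countLevel.den ω s).nat 10 i x = if i < j + 1 then clusterCount lab N n i x else 0 := by
  have key := den_loop_induction (ω := ω) (c := 5) (b := 0) (P := countBody) hn
    (fun k s' => ∀ i x, s'.nat 10 i x = if i < j then clusterCount lab N n i x else
      if i = j then clusterCount lab N k i x else 0) (by
        intro i x
        rw [State.setNat_nat_of_ne _ (by decide), h]
        simp [clusterCount]) (by
        intro k hk s' hk' hf hI i x
        have f3 := hf.nat 3 rfl
        have f1 := hf.nat 1 rfl
        have f9 := hf.nat 9 rfl
        simp only [countBody, den, NatExp.eval, NatExp.var, hk', f3, f1, f9, hj, hl, hN]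
        rw [State.setNat_nat_of_ne _ (by decide)]
        simp only [State.setNat, true_and, hI]
        have hs : ∀ y, clusterCount lab N (k + 1) j y =
            clusterCount lab N k j y + if lab (j + 1) k = y then N k else 0 := fun y => by
          rw [clusterCount, Finset.sum_range_succ, ← clusterCount]
        simp only [lt_irrefl, if_false, if_true]
        by_cases hx : i = j ∧ x = lab (j + 1) k
        · obtain ⟨rfl, rfl⟩ := hx
          simp [hs]
        · rw [if_neg hx]
          by_cases hij : i = j
          · subst hij
            simp only [lt_irrefl, if_false, if_true, hs]
            rw [if_neg (fun e => hx ⟨rfl, e.symm⟩), add_zero]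
          · simp [hij])
  refine (key i x).trans ?_
  split_ifs <;> first | rfl | omega

theorem countCmd_spec {ω : Tape} {s : State} {n L : ℕ} {lab : ℕ → ℕ → ℕ} {N : ℕ → ℕ}
    (hn : s.nat 0 0 0 = n) (hL : s.nat 7 0 0 = L) (hl : s.nat 9 = lab)
    (hN : ∀ v, s.nat 1 v 0 = N v) (h : ∀ i x, s.nat 10 i x = 0) (i x : ℕ) :
    (countCmd.den ω s).nat 10 i x = if i < L then clusterCount lab N n i x else 0 :=
  den_loop_induction (ω := ω) (c := 3) (b := 7) (P := countLevel) hL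
    (fun j s' => ∀ i x, s'.nat 10 i x = if i < j then clusterCount lab N n i x else 0) (by
      intro i x
      simp [State.setNat_nat_of_ne, h]) (by
      intro k hk s' hk' hf hI i x
      rw [State.setNat_nat_of_ne _ (by decide)]
      exact countLevel_spec ((congrFun₂ (hf.nat 0 rfl) 0 0).trans hn) hk'
        ((hf.nat 9 rfl).trans hl) (fun v => by rw [hf.nat 1 rfl, hN]) hI i x) i x

/-! ### Active clusters -/

/-- The factor 4 ^ j is the square of the stored power of two, and a cluster is addressed by its
label. -/
def markTest : Test :=
  .realLE (.div (.mul (.mul (.ofNat (.const 4)) (.var 6))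
      (.mul (.ofNat (.get 6 (.var 3) (.const 0))) (.ofNat (.get 6 (.var 3) (.const 0)))))
        (.var 7))
    (.add (.ofNat (.get 10 (.var 3) (.get 9 (.add (.var 3) (.const 1)) (.var 4))))
      (.mul (.div (.ofNat (.get 6 (.var 3) (.const 0))) (.var 7))
        (.get 5 (.var 3) (.get 9 (.add (.var 3) (.const 1)) (.var 4)))))

/-- The implication "if j ≥ 1 then marked" is written as a negated conjunction. The equation between
the depth and j says that all larger clusters are active. -/
def activeTest : Test :=
  .and (.natEq (.get 11 (.var 4) (.const 0)) (.var 3))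
    (.not (.and (.natLE (.const 1) (.var 3)) (.not markTest)))

def activeBody : Cmd :=
  when activeTest (setNat 11 (.var 4) (.const 0) (.add (.var 3) (.const 1)))

def activeLevel : Cmd := loop 4 0 activeBody

def activeCmd : Cmd := loop 3 7 activeLevel

/-- Updating the depths in place is harmless: the round for u reads no depth except that of u. -/
theorem activeLevel_spec {ω : Tape} {s : State} {n j : ℕ} {lab cnt : ℕ → ℕ → ℕ}
    {X : ℕ → ℕ → ℝ} {H e : ℝ}
    (hn : s.nat 0 0 0 = n) (hj : s.nat 3 0 0 = j) (hl : s.nat 9 = lab) (hc : s.nat 10 = cnt)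
    (hX : s.real 5 = X) (hH : s.real 6 0 0 = H) (he : s.real 7 0 0 = e)
    (hp : s.nat 6 j 0 = 2 ^ j)
    (h : ∀ x < n, s.nat 11 x 0 = activeLevels lab (IsMarked H e cnt X) j x) :
    ∀ x < n, (activeLevel.den ω s).nat 11 x 0 =
      activeLevels lab (IsMarked H e cnt X) (j + 1) x := by
  have key := den_loop_induction (ω := ω) (c := 4) (b := 0) (P := activeBody) hn
    (fun k s' => ∀ x < n, s'.nat 11 x 0 =
      activeLevels lab (IsMarked H e cnt X) (if x < k then j + 1 else j) x) (by
        intro x hx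
        simp [State.setNat_nat_of_ne, h x hx]) (by
        intro k hk s' hk' hf hI x hx
        have f3 := hf.nat 3 rfl
        have f6 := hf.nat 6 rfl
        have f9 := hf.nat 9 rfl
        have f10 := hf.nat 10 rfl
        have g5 := hf.real 5 rfl
        have g6 := hf.real 6 rfl
        have g7 := hf.real 7 rfl
        rw [State.setNat_nat_of_ne _ (by decide)]
        have hM : Test.holds s' markTest ↔ IsMarked H e cnt X j (lab (j + 1) k) := by
          simp only [markTest, Test.holds, RealExp.eval, NatExp.eval, RealExp.var, NatExp.var, f3,
            f6, f9, f10, g5, g6, g7, hk', hj, hl, hc, hX, hH, he, hp, IsMarked]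
          norm_num
        have e1 := hI k hk
        rw [if_neg (lt_irrefl k)] at e1
        have hT : Test.holds s' activeTest ↔ activeLevels lab (IsMarked H e cnt X) j k = j ∧
            (1 ≤ j → IsMarked H e cnt X j (lab (j + 1) k)) := by
          simp only [activeTest, Test.natEq, Test.holds, NatExp.eval, NatExp.var, hk', f3,
            hj, ← le_antisymm_iff, hM, e1]
          tauto
        by_cases hxk : x = k
        · subst hxk
          rw [if_pos (Nat.lt_succ_self x), activeLevels]
          split_ifs with hc
          · rw [activeBody, den_when_pos (hT.2 hc)]
            simp [den, State.setNat, NatExp.eval, NatExp.var, hk', f3, hj]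
          · rw [activeBody, den_when_neg (fun h => hc (hT.1 h)), e1]
        · have : (x < k + 1) = (x < k) := by simp only [eq_iff_iff]; omega
          simp only [this]
          rw [← hI x hx]
          by_cases hc : Test.holds s' activeTest
          · rw [activeBody, den_when_pos hc]
            simp [den, State.setNat, NatExp.eval, NatExp.var, hk', hxk]
          · rw [activeBody, den_when_neg hc])
  intro x hx
  rw [activeLevel, key x hx, if_pos hx]

theorem activeCmd_spec {ω : Tape} {s : State} {n L : ℕ} {lab cnt : ℕ → ℕ → ℕ}
    {X : ℕ → ℕ → ℝ} {H e : ℝ}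
    (hn : s.nat 0 0 0 = n) (hL : s.nat 7 0 0 = L) (hl : s.nat 9 = lab) (hc : s.nat 10 = cnt)
    (hX : s.real 5 = X) (hH : s.real 6 0 0 = H) (he : s.real 7 0 0 = e)
    (hp : ∀ j < L, s.nat 6 j 0 = 2 ^ j) (h : ∀ x, s.nat 11 x 0 = 0) :
    ∀ x < n, (activeCmd.den ω s).nat 11 x 0 = activeLevels lab (IsMarked H e cnt X) L x :=
  den_loop_induction (ω := ω) (c := 3) (b := 7) (P := activeLevel) hL
    (fun j s' => ∀ x < n, s'.nat 11 x 0 = activeLevels lab (IsMarked H e cnt X) j x) (by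
      intro x hx
      simp [State.setNat_nat_of_ne, h, activeLevels]) (by
      intro k hk s' hk' hf hI x hx
      rw [State.setNat_nat_of_ne _ (by decide)]
      exact activeLevel_spec ((congrFun₂ (hf.nat 0 rfl) 0 0).trans hn) hk'
        ((hf.nat 9 rfl).trans hl) ((hf.nat 10 rfl).trans hc) ((hf.real 5 rfl).trans hX)
        ((congrFun₂ (hf.real 6 rfl) 0 0).trans hH) ((congrFun₂ (hf.real 7 rfl) 0 0).trans he)
        ((congrFun₂ (hf.nat 6 rfl) k 0).trans (hp k hk)) hI x hx)

/-! ### The published set -/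

def chooseTest : Test :=
  .and (.natEq (.get 9 (.get 11 (.var 4) (.const 0)) (.var 5))
      (.get 9 (.get 11 (.var 4) (.const 0)) (.var 4)))
    (.not (.and (.natLE (.get 11 (.var 5) (.const 0)) (.get 11 (.var 4) (.const 0)))
      (.natLE (.var 5) (.var 4))))

def chooseBody : Cmd := when chooseTest (setNat 2 (.var 4) (.const 0) (.const 0))

def chooseRow : Cmd :=
  seq (setNat 2 (.var 4) (.const 0) (.const 1)) (loop 5 0 chooseBody)

def chooseCmd : Cmd := loop 4 0 chooseRow

/-- The point u starts as chosen and is struck out by the first v in its cluster that is deeper or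
has a larger index. -/
theorem chooseRow_spec {ω : Tape} {s : State} {n u : ℕ} {lab : ℕ → ℕ → ℕ} {K : ℕ → ℕ}
    (hn : s.nat 0 0 0 = n) (hu : s.nat 4 0 0 = u) (hl : s.nat 9 = lab) (hun : u < n)
    (hK : ∀ v < n, s.nat 11 v 0 = K v) (h : ∀ x < u, s.nat 2 x 0 ≠ 0 ↔ IsChosen lab K n x) :
    ∀ x < u + 1, (chooseRow.den ω s).nat 2 x 0 ≠ 0 ↔ IsChosen lab K n x := by
  set s₁ := (setNat 2 (.var 4) (.const 0) (.const 1)).den ω s with hs₁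
  have f₁ : ∀ a, a ≠ 2 → s₁.nat a = s.nat a := fun a ha => State.setNat_nat_of_ne s ha
  have hs2 : ∀ x, s₁.nat 2 x 0 = if x = u then 1 else s.nat 2 x 0 := by
    intro x
    simp [hs₁, den, NatExp.eval, NatExp.var, State.setNat, hu]
  have key := den_loop_induction (ω := ω) (c := 5) (b := 0) (P := chooseBody) (s := s₁) (m := n)
    (by rw [f₁ 0 (by decide), hn])
    (fun k s' => (∀ x < u, s'.nat 2 x 0 ≠ 0 ↔ IsChosen lab K n x) ∧
      (s'.nat 2 u 0 ≠ 0 ↔ ∀ v < k, lab (K u) v = lab (K u) u → K v ≤ K u ∧ v ≤ u)) (by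
        simp only [State.setNat_nat_of_ne s₁ (show 2 ≠ 5 by decide), hs2]
        refine ⟨fun x hx => ?_, by simp⟩
        rw [if_neg (by omega), h x hx]) (by
        intro k hk s' hk' hf hI
        have f4 := (hf.nat 4 rfl).trans (f₁ 4 (by decide))
        have f9 := (hf.nat 9 rfl).trans (f₁ 9 (by decide))
        have f11 := (hf.nat 11 rfl).trans (f₁ 11 (by decide))
        simp only [State.setNat_nat_of_ne _ (show 2 ≠ 5 by decide)]
        have hT : Test.holds s' chooseTest ↔
            ¬ (lab (K u) k = lab (K u) u → K k ≤ K u ∧ k ≤ u) := by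
          simp only [chooseTest, Test.holds, Test.natEq, NatExp.eval, NatExp.var, hk', f4, f9, f11,
            hu, hl, ← le_antisymm_iff, hK u hun, hK k hk]
          tauto
        have hstep : (∀ v < k + 1, lab (K u) v = lab (K u) u → K v ≤ K u ∧ v ≤ u) ↔
            (∀ v < k, lab (K u) v = lab (K u) u → K v ≤ K u ∧ v ≤ u) ∧
              (lab (K u) k = lab (K u) u → K k ≤ K u ∧ k ≤ u) := by
          simp only [Nat.lt_succ_iff_lt_or_eq]
          exact ⟨fun h => ⟨fun v hv => h v (.inl hv), h k (.inr rfl)⟩,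
            fun h v hv => hv.elim (h.1 v) fun e => e ▸ h.2⟩
        rw [hstep, ← hI.2, chooseBody]
        by_cases hc : Test.holds s' chooseTest
        · rw [den_when_pos hc]
          refine ⟨fun x hx => ?_, ?_⟩
          · rw [← hI.1 x hx]
            simp [den, State.setNat, NatExp.eval, NatExp.var, f4, hu, hx.ne]
          · simp only [hT.1 hc, and_false, iff_false, not_not]
            simp [den, State.setNat, NatExp.eval, NatExp.var, f4, hu]
        · rw [den_when_neg hc]
          rw [hT, not_not] at hc
          exact ⟨hI.1, by tauto⟩)
  intro x hx
  rcases Nat.lt_succ_iff_lt_or_eq.1 hx with hx | rfl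
  · exact key.1 x hx
  · exact key.2

theorem chooseCmd_spec {ω : Tape} {s : State} {n : ℕ} {lab : ℕ → ℕ → ℕ} {K : ℕ → ℕ}
    (hn : s.nat 0 0 0 = n) (hl : s.nat 9 = lab) (hK : ∀ v < n, s.nat 11 v 0 = K v) :
    ∀ x < n, (chooseCmd.den ω s).nat 2 x 0 ≠ 0 ↔ IsChosen lab K n x :=
  den_loop_induction (ω := ω) (c := 4) (b := 0) (P := chooseRow) hn
    (fun k s' => ∀ x < k, s'.nat 2 x 0 ≠ 0 ↔ IsChosen lab K n x) (by simp) (by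
      intro k hk s' hk' hf hI
      simp only [State.setNat_nat_of_ne _ (show 2 ≠ 4 by decide)]
      exact chooseRow_spec ((congrFun₂ (hf.nat 0 rfl) 0 0).trans hn) hk'
        ((hf.nat 9 rfl).trans hl) hk (fun v hv => by rw [hf.nat 11 rfl, hK v hv]) hI)

end Cmd

namespace Cmd

/-! ### Sampling -/

/-- The random priorities of the points, with a sentinel at `n`. -/
def _root_.UFL.priority (n : ℕ) (ω : ℕ → unitInterval) (w : ℕ) : ℝ :=
  if w < n then (ω (w + 1) : ℝ) else if w = n then 2 else 0

/-- The harmonic number is accumulated along with the priorities. It takes the place of log n, which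
the machine cannot compute. -/
def sampleBody : Cmd :=
  seq (uniform 4 (.var 4) (.const 0))
    (setReal 6 (.const 0) (.const 0)
      (.add (.var 6) (.div (.ofNat (.const 1)) (.ofNat (.add (.var 4) (.const 1))))))

/-- The priority 2 of the sentinel n exceeds every sample from [0, 1], so any point of a ball
replaces the sentinel in the search for a center. -/
def sampleCmd : Cmd :=
  seq (uniform 3 (.const 0) (.const 0))
    (seq (setReal 4 (.var 0) (.const 0) (.ofNat (.const 2))) (loop 4 0 sampleBody))

theorem sampleCmd_spec {ω : Tape} {s : State} {n : ℕ} (hn : s.nat 0 0 0 = n)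
    (hu : s.uniformUsed = 0) (h4 : ∀ x, s.real 4 x 0 = 0) (h6 : s.real 6 0 0 = 0) :
    (sampleCmd.den ω s).real 3 0 0 = ω.1 0 ∧
    (∀ w, (sampleCmd.den ω s).real 4 w 0 = priority n ω.1 w) ∧
    (sampleCmd.den ω s).real 6 0 0 = (harmonic n : ℝ) := by
  set s₂ := (setReal 4 (.var 0) (.const 0) (.ofNat (.const 2))).den ω
    ((uniform 3 (.const 0) (.const 0)).den ω s) with hs₂
  have hn2 : s₂.nat 0 0 0 = n := hn
  have hu2 : s₂.uniformUsed = 1 := by simp [hs₂, den, State.setReal, hu]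
  have h32 : s₂.real 3 0 0 = ω.1 0 := by
    simp [hs₂, den, State.setReal, hu, NatExp.eval]
  have h42 : ∀ w, s₂.real 4 w 0 = if w = n then 2 else 0 := by
    intro w
    simp [hs₂, den, State.setReal, NatExp.eval, RealExp.eval, NatExp.var, hn, h4]
  have h62 : s₂.real 6 0 0 = 0 := by
    simp [hs₂, den, State.setReal, h6]
  have key := den_loop_induction (ω := ω) (c := 4) (b := 0) (P := sampleBody) hn2
    (fun k s' => s'.uniformUsed = k + 1 ∧
      (∀ w, s'.real 4 w 0 = if w < k then (ω.1 (w + 1) : ℝ) else if w = n then 2 else 0) ∧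
      s'.real 6 0 0 = (harmonic k : ℝ)) (by
        refine ⟨hu2, fun w => ?_, ?_⟩
        · simpa using h42 w
        · simpa using h62) (by
        rintro k hk s' hk' hf ⟨hI1, hI2, hI3⟩
        refine ⟨by simp [sampleBody, den, State.setNat, State.setReal, hI1], fun w => ?_, ?_⟩
        · simp only [State.setNat_real, sampleBody, den, State.setReal, NatExp.eval, NatExp.var,
            RealExp.eval, hI1, hk']
          by_cases hw : w = k
          · subst hw; simp
          · have : w < k + 1 ↔ w < k := by omega
            simp [hw, hI2, this]
        · simp [State.setNat_real, sampleBody, den, State.setReal, NatExp.eval, NatExp.var,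
            RealExp.eval, RealExp.var, hk', hI3, harmonic_succ])
  refine ⟨?_, key.2.1, key.2.2⟩
  have := (frame_den ω (loop 4 0 sampleBody) s₂).real 3 rfl
  exact (congrFun₂ this 0 0).trans h32

/-! ### Centers and noise -/

def centerTest : Test :=
  .and (.realLE (.mul (.mul (.ofNat (.const 2)) (.get 0 (.var 4) (.var 5)))
      (.mul (.ofNat (.get 6 (.var 3) (.const 0))) (.ofNat (.get 6 (.var 3) (.const 0)))))
      (.mul (.add (.ofNat (.const 1)) (.var 3)) (.mul (.var 7) (.var 1))))
    (.realLE (.get 4 (.var 5) (.const 0)) (.get 4 (.get 8 (.var 3) (.var 4)) (.const 0)))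

def centerBody : Cmd := when centerTest (setNat 8 (.var 3) (.var 4) (.var 5))

def centerRow : Cmd :=
  seq (setNat 8 (.var 3) (.var 4) (.var 0))
    (seq (loop 5 0 centerBody) (laplace 5 (.var 3) (.var 4)))

def centerLevel : Cmd := loop 4 0 centerRow

def centerCmd : Cmd := loop 3 7 centerLevel

/-- The cell 8[j, u] holds the best candidate so far. The test is non-strict, so among equal
priorities the last index wins. -/
theorem centerSearch_spec {ω : Tape} {s : State} {n j u : ℕ} {D : ℕ → ℕ → ℝ} {U e f : ℝ}
    {p : ℕ → ℝ} (hn : s.nat 0 0 0 = n) (hj : s.nat 3 0 0 = j) (hu : s.nat 4 0 0 = u)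
    (hD : s.real 0 = D) (hU : s.real 3 0 0 = U) (he : s.real 7 0 0 = e) (hf : s.real 1 0 0 = f)
    (hp : ∀ w, s.real 4 w 0 = p w) (hpw : s.nat 6 j 0 = 2 ^ j) (h : s.nat 8 j u = n) (i x : ℕ) :
    ((loop 5 0 centerBody).den ω s).nat 8 i x =
      if i = j ∧ x = u then lastArgmin (InBall D U e f j u) p n n else s.nat 8 i x :=
  den_loop_induction (ω := ω) (c := 5) (b := 0) (P := centerBody) hn
    (fun k s' => ∀ i x, s'.nat 8 i x =
      if i = j ∧ x = u then lastArgmin (InBall D U e f j u) p n k else s.nat 8 i x) (by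
        intro i x
        rw [State.setNat_nat_of_ne _ (by decide)]
        split_ifs with hc
        · rw [hc.1, hc.2, h, lastArgmin]
        · rfl) (by
        intro k hk s' hk' hfr hI i x
        have f3 := hfr.nat 3 rfl
        have f4 := hfr.nat 4 rfl
        have f6 := hfr.nat 6 rfl
        have g0 := hfr.real 0 rfl
        have g1 := hfr.real 1 rfl
        have g3 := hfr.real 3 rfl
        have g4 := hfr.real 4 rfl
        have g7 := hfr.real 7 rfl
        have e1 := hI j u
        rw [if_pos ⟨rfl, rfl⟩] at e1
        rw [State.setNat_nat_of_ne _ (by decide)]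
        have hT : Test.holds s' centerTest ↔ InBall D U e f j u k ∧
            p k ≤ p (lastArgmin (InBall D U e f j u) p n k) := by
          simp only [centerTest, Test.holds, RealExp.eval, NatExp.eval, RealExp.var, NatExp.var,
            f3, f4, f6, g0, g1, g3, g4, g7, hk', hj, hu, hD, hU, he, hf, hp, hpw, e1, InBall]
          norm_num
        by_cases hc : Test.holds s' centerTest
        · rw [centerBody, den_when_pos hc, lastArgmin, if_pos (hT.1 hc)]
          simp only [den, State.setNat, NatExp.eval, NatExp.var, f3, f4, hj, hu, hk', true_and]
          split_ifs with h1
          · rfl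
          · rw [hI, if_neg h1]
        · rw [centerBody, den_when_neg hc, lastArgmin, if_neg (fun h => hc (hT.2 h)), hI]) i x

/-- Drawing one Laplace sample per pair (j, u) in this loop puts sample number j n + u into the cell
(j, u); it later serves the cluster with label u at that level. -/
theorem centerRow_spec {ω : Tape} {s : State} {n j u : ℕ} {D : ℕ → ℕ → ℝ} {U e f : ℝ}
    {p : ℕ → ℝ} (hn : s.nat 0 0 0 = n) (hj : s.nat 3 0 0 = j) (hu : s.nat 4 0 0 = u)
    (hD : s.real 0 = D) (hU : s.real 3 0 0 = U) (he : s.real 7 0 0 = e) (hf : s.real 1 0 0 = f)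
    (hp : ∀ w, s.real 4 w 0 = p w) (hpw : s.nat 6 j 0 = 2 ^ j) :
    (∀ i x, (centerRow.den ω s).nat 8 i x =
      if i = j ∧ x = u then lastArgmin (InBall D U e f j u) p n n else s.nat 8 i x) ∧
    (∀ i x, (centerRow.den ω s).real 5 i x =
      if i = j ∧ x = u then ω.2 s.laplaceUsed else s.real 5 i x) ∧
    (centerRow.den ω s).laplaceUsed = s.laplaceUsed + 1 := by
  set s₁ := (setNat 8 (.var 3) (.var 4) (.var 0)).den ω s with hs₁
  have f₁ : ∀ a, a ≠ 8 → s₁.nat a = s.nat a := fun a ha => State.setNat_nat_of_ne s ha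
  have hs8 : ∀ i x, s₁.nat 8 i x = if i = j ∧ x = u then n else s.nat 8 i x := by
    intro i x
    simp [hs₁, den, State.setNat, NatExp.eval, NatExp.var, hj, hu, hn]
  have key := centerSearch_spec (ω := ω) (s := s₁) (j := j) (u := u) (p := p)
    (by rw [f₁ 0 (by decide), hn]) (by rw [f₁ 3 (by decide), hj]) (by rw [f₁ 4 (by decide), hu])
    hD hU he hf hp (by rw [f₁ 6 (by decide), hpw]) (by simp [hs8])
  set s₂ := (loop 5 0 centerBody).den ω s₁ with hs₂
  have fr := frame_den ω (loop 5 0 centerBody) s₁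
  rw [← hs₂] at fr
  have hl : s₂.laplaceUsed = s.laplaceUsed :=
    (den_laplaceUsed ω (loop 5 0 centerBody) rfl s₁).trans rfl
  have f3 : s₂.nat 3 0 0 = j := by rw [fr.nat 3 rfl, f₁ 3 (by decide), hj]
  have f4 : s₂.nat 4 0 0 = u := by rw [fr.nat 4 rfl, f₁ 4 (by decide), hu]
  have hden : centerRow.den ω s = (laplace 5 (.var 3) (.var 4)).den ω s₂ := rfl
  refine ⟨fun i x => ?_, fun i x => ?_, ?_⟩
  · refine (key i x).trans ?_
    rw [hs8]
    split_ifs <;> rfl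
  · rw [hden]
    simp only [den, State.setReal, NatExp.eval, NatExp.var, f3, f4, hl, true_and]
    rw [fr.real 5 rfl]
    simp [hs₁, den]
  · rw [hden]
    simp [den, hl]

theorem centerLevel_spec {ω : Tape} {s : State} {n j : ℕ} {D : ℕ → ℕ → ℝ} {U e f : ℝ}
    {p : ℕ → ℝ} (hn : s.nat 0 0 0 = n) (hj : s.nat 3 0 0 = j)
    (hD : s.real 0 = D) (hU : s.real 3 0 0 = U) (he : s.real 7 0 0 = e) (hf : s.real 1 0 0 = f)
    (hp : ∀ w, s.real 4 w 0 = p w) (hpw : s.nat 6 j 0 = 2 ^ j) (hl : s.laplaceUsed = j * n) :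
    (∀ i x, (centerLevel.den ω s).nat 8 i x =
      if i = j ∧ x < n then lastArgmin (InBall D U e f j x) p n n else s.nat 8 i x) ∧
    (∀ i x, (centerLevel.den ω s).real 5 i x =
      if i = j ∧ x < n then ω.2 (j * n + x) else s.real 5 i x) ∧
    (centerLevel.den ω s).laplaceUsed = (j + 1) * n := by
  rw [show (j + 1) * n = j * n + n by ring]
  refine den_loop_induction (ω := ω) (c := 4) (b := 0) (P := centerRow) hn
    (fun k s' => (∀ i x, s'.nat 8 i x =
      if i = j ∧ x < k then lastArgmin (InBall D U e f j x) p n n else s.nat 8 i x) ∧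
      (∀ i x, s'.real 5 i x = if i = j ∧ x < k then ω.2 (j * n + x) else s.real 5 i x) ∧
      s'.laplaceUsed = j * n + k) (by simp [State.setNat, hl]) ?_
  rintro k hk s' hk' hfr ⟨hI1, hI2, hI3⟩
  obtain ⟨h1, h2, h3⟩ := centerRow_spec (ω := ω) (D := D) (U := U) (e := e) (f := f) (p := p)
    (j := j) ((congrFun₂ (hfr.nat 0 rfl) 0 0).trans hn)
    ((congrFun₂ (hfr.nat 3 rfl) 0 0).trans hj) hk' ((hfr.real 0 rfl).trans hD)
    ((congrFun₂ (hfr.real 3 rfl) 0 0).trans hU) ((congrFun₂ (hfr.real 7 rfl) 0 0).trans he)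
    ((congrFun₂ (hfr.real 1 rfl) 0 0).trans hf)
    (fun w => (congrFun₂ (hfr.real 4 rfl) w 0).trans (hp w))
    ((congrFun₂ (hfr.nat 6 rfl) j 0).trans hpw)
  refine ⟨fun i x => ?_, fun i x => ?_, ?_⟩
  · rw [State.setNat_nat_of_ne _ (by decide), h1, hI1]
    by_cases hx : i = j ∧ x = k
    · rw [if_pos hx, if_pos (by omega), hx.2]
    · rw [if_neg hx]
      congr 1
      simp only [eq_iff_iff]; omega
  · rw [State.setNat_real, h2, hI2]
    by_cases hx : i = j ∧ x = k
    · rw [if_pos hx, if_pos (by omega), hx.2, hI3]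
    · rw [if_neg hx]
      congr 1
      simp only [eq_iff_iff]; omega
  · simp [State.setNat, h3, hI3, add_assoc]

theorem centerCmd_spec {ω : Tape} {s : State} {n L : ℕ} {D : ℕ → ℕ → ℝ} {U e f : ℝ}
    {p : ℕ → ℝ} (hn : s.nat 0 0 0 = n) (hL : s.nat 7 0 0 = L)
    (hD : s.real 0 = D) (hU : s.real 3 0 0 = U) (he : s.real 7 0 0 = e) (hf : s.real 1 0 0 = f)
    (hp : ∀ w, s.real 4 w 0 = p w) (hpw : ∀ j < L, s.nat 6 j 0 = 2 ^ j)
    (hl : s.laplaceUsed = 0) (h8 : ∀ i x, s.nat 8 i x = 0) (h5 : ∀ i x, s.real 5 i x = 0) :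
    (∀ i x, (centerCmd.den ω s).nat 8 i x = center D U e f p n L i x) ∧
    (∀ i x, (centerCmd.den ω s).real 5 i x = if i < L ∧ x < n then ω.2 (i * n + x) else 0) := by
  have key := den_loop_induction (ω := ω) (c := 3) (b := 7) (P := centerLevel) hL
    (fun k s' => (∀ i x, s'.nat 8 i x = center D U e f p n k i x) ∧
      (∀ i x, s'.real 5 i x = if i < k ∧ x < n then ω.2 (i * n + x) else 0) ∧
      s'.laplaceUsed = k * n) (by
        simp [State.setNat, hl, center, h8, h5]) (by
        rintro k hk s' hk' hfr ⟨hI1, hI2, hI3⟩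
        obtain ⟨h1, h2, h3⟩ := centerLevel_spec (ω := ω) (D := D) (U := U) (e := e) (f := f)
          (p := p) ((congrFun₂ (hfr.nat 0 rfl) 0 0).trans hn) hk' ((hfr.real 0 rfl).trans hD)
          ((congrFun₂ (hfr.real 3 rfl) 0 0).trans hU) ((congrFun₂ (hfr.real 7 rfl) 0 0).trans he)
          ((congrFun₂ (hfr.real 1 rfl) 0 0).trans hf)
          (fun w => (congrFun₂ (hfr.real 4 rfl) w 0).trans (hp w))
          ((congrFun₂ (hfr.nat 6 rfl) k 0).trans (hpw k hk)) hI3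
        refine ⟨fun i x => ?_, fun i x => ?_, ?_⟩
        · rw [State.setNat_nat_of_ne _ (by decide), h1, hI1]
          by_cases hx : i = k ∧ x < n
          · rw [if_pos hx, center, if_pos (by omega), hx.1]
          · rw [if_neg hx, center, center]
            congr 1
            simp only [eq_iff_iff]; omega
        · rw [State.setNat_real, h2, hI2]
          by_cases hx : i = k ∧ x < n
          · rw [if_pos hx, if_pos (by omega), hx.1]
          · rw [if_neg hx]
            congr 1
            simp only [eq_iff_iff]; omega
        · simp [State.setNat, h3])
  exact ⟨key.1, key.2.1⟩

/-! ### Preparation -/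

def clampCmd : Cmd :=
  ite (.realLE (.get 1 (.const 0) (.const 1)) (.ofNat (.const 1)))
    (setReal 7 (.const 0) (.const 0) (.get 1 (.const 0) (.const 1)))
    (setReal 7 (.const 0) (.const 0) (.ofNat (.const 1)))

def minTest : Test :=
  .and (.not (.natEq (.var 4) (.var 5))) (.realLE (.get 0 (.var 4) (.var 5)) (.var 8))

def minBody : Cmd := when minTest (setReal 8 (.const 0) (.const 0) (.get 0 (.var 4) (.var 5)))

def minRow : Cmd := loop 5 0 minBody

def prepareCmd : Cmd :=
  seq clampCmd (seq (setReal 8 (.const 0) (.const 0) (.get 0 (.const 0) (.const 1)))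
    (seq (loop 4 0 minRow) (setNat 6 (.const 0) (.const 0) (.const 1))))

/-- The minimum is tracked by the two properties that are used later: it is attained by some pair of
distinct points, and it bounds all pairs seen so far. -/
theorem minRow_spec {ω : Tape} {s : State} {n u : ℕ} {D : ℕ → ℕ → ℝ}
    (hn : s.nat 0 0 0 = n) (hu : s.nat 4 0 0 = u) (hD : s.real 0 = D) (hun : u < n)
    (h1 : ∃ x < n, ∃ y < n, x ≠ y ∧ s.real 8 0 0 = D x y)
    (h2 : ∀ x < u, ∀ y < n, x ≠ y → s.real 8 0 0 ≤ D x y) :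
    (∃ x < n, ∃ y < n, x ≠ y ∧ (minRow.den ω s).real 8 0 0 = D x y) ∧
    (∀ x < u + 1, ∀ y < n, x ≠ y → (minRow.den ω s).real 8 0 0 ≤ D x y) := by
  have key := den_loop_induction (ω := ω) (c := 5) (b := 0) (P := minBody) hn
    (fun k s' => (∃ x < n, ∃ y < n, x ≠ y ∧ s'.real 8 0 0 = D x y) ∧
      (∀ x < u, ∀ y < n, x ≠ y → s'.real 8 0 0 ≤ D x y) ∧
      (∀ y < k, u ≠ y → s'.real 8 0 0 ≤ D u y)) ⟨by simpa using h1, by simpa using h2, by simp⟩ (by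
        rintro k hk s' hk' hfr ⟨hI1, hI2, hI3⟩
        have f4 := hfr.nat 4 rfl
        have g0 := hfr.real 0 rfl
        simp only [State.setNat_real]
        have hT : Test.holds s' minTest ↔ u ≠ k ∧ D u k ≤ s'.real 8 0 0 := by
          simp only [minTest, Test.holds, Test.natEq, NatExp.eval, NatExp.var, RealExp.eval,
            RealExp.var, f4, g0, hu, hk', hD, ← le_antisymm_iff, ne_eq]
        by_cases hc : Test.holds s' minTest
        · rw [minBody, den_when_pos hc]
          have hv : ((setReal 8 (.const 0) (.const 0) (.get 0 (.var 4) (.var 5))).den ω s').real 8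
              0 0 = D u k := by
            simp [den, State.setReal, NatExp.eval, NatExp.var, RealExp.eval, f4, g0, hu, hk', hD]
          rw [hT] at hc
          rw [hv]
          refine ⟨⟨u, hun, k, hk, hc.1, rfl⟩, fun x hx y hy hxy => hc.2.trans (hI2 x hx y hy hxy),
            fun y hy hxy => ?_⟩
          rcases Nat.lt_succ_iff_lt_or_eq.1 hy with hy | rfl
          · exact hc.2.trans (hI3 y hy hxy)
          · exact le_rfl
        · rw [minBody, den_when_neg hc]
          refine ⟨hI1, hI2, fun y hy hxy => ?_⟩
          rcases Nat.lt_succ_iff_lt_or_eq.1 hy with hy | rfl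
          · exact hI3 y hy hxy
          · rw [hT] at hc
            push Not at hc
            exact (hc hxy).le)
  refine ⟨key.1, fun x hx y hy hxy => ?_⟩
  rcases Nat.lt_succ_iff_lt_or_eq.1 hx with hx | rfl
  · exact key.2.1 x hx y hy hxy
  · exact key.2.2 y hy hxy

theorem prepareCmd_spec {ω : Tape} {s : State} {n : ℕ} (hn : s.nat 0 0 0 = n) (hn2 : 2 ≤ n) :
    (prepareCmd.den ω s).real 7 0 0 = min (s.real 1 0 1) 1 ∧
    (prepareCmd.den ω s).nat 6 0 0 = 1 ∧
    (∃ x < n, ∃ y < n, x ≠ y ∧ (prepareCmd.den ω s).real 8 0 0 = s.real 0 x y) ∧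
    (∀ x < n, ∀ y < n, x ≠ y → (prepareCmd.den ω s).real 8 0 0 ≤ s.real 0 x y) := by
  set s₁ := clampCmd.den ω s with hs₁
  have fr₁ := frame_den ω clampCmd s
  rw [← hs₁] at fr₁
  have h7 : s₁.real 7 0 0 = min (s.real 1 0 1) 1 := by
    simp only [hs₁, clampCmd, den, Test.holds, RealExp.eval, NatExp.eval, Nat.cast_one]
    split_ifs with hc
    · simp [State.setReal, hc]
    · simp [State.setReal, le_of_not_ge hc]
  set s₂ := (setReal 8 (.const 0) (.const 0) (.get 0 (.const 0) (.const 1))).den ω s₁ with hs₂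
  have f₂ : ∀ a, a ≠ 8 → s₂.real a = s₁.real a := fun a ha => State.setReal_real_of_ne s₁ ha
  have h8 : s₂.real 8 0 0 = s.real 0 0 1 := by
    simp [hs₂, den, State.setReal, NatExp.eval, RealExp.eval, fr₁.real 0 rfl]
  have hn' : s₂.nat 0 0 0 = n := (congrFun₂ (fr₁.nat 0 rfl) 0 0).trans hn
  set s₃ := (loop 4 0 minRow).den ω s₂ with hs₃
  have fr₃ := frame_den ω (loop 4 0 minRow) s₂
  rw [← hs₃] at fr₃
  have hden : prepareCmd.den ω s = (setNat 6 (.const 0) (.const 0) (.const 1)).den ω s₃ := rfl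
  have h0 : s₂.real 0 = s.real 0 := by rw [f₂ 0 (by decide), fr₁.real 0 rfl]
  have key := den_loop_induction (ω := ω) (c := 4) (b := 0) (P := minRow) hn'
    (fun k s' => (∃ x < n, ∃ y < n, x ≠ y ∧ s'.real 8 0 0 = s.real 0 x y) ∧
      (∀ x < k, ∀ y < n, x ≠ y → s'.real 8 0 0 ≤ s.real 0 x y))
    ⟨⟨0, by omega, 1, by omega, by omega, h8⟩, by simp⟩ (by
      intro k hk s' hk' hfr hI
      exact minRow_spec ((congrFun₂ (hfr.nat 0 rfl) 0 0).trans hn') hk'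
        ((hfr.real 0 rfl).trans h0) hk hI.1 hI.2)
  rw [hden]
  refine ⟨?_, ?_, key.1, key.2⟩
  · rw [← h7, ← f₂ 7 (by decide), ← fr₃.real 7 rfl]
    rfl
  · simp [den, State.setNat, NatExp.eval]

end Cmd

/-! ### The algorithm -/

/-- The loop that computes the number of levels and the powers of two. -/
def scaleWhile : Program :=
  .while (.realLE (.mul (.var 8) (.mul (.ofNat (.get 6 (.var 7) (.const 0)))
      (.ofNat (.get 6 (.var 7) (.const 0))))) (.mul (.var 7) (.var 1)))
    (.seq (.setNat 6 (.add (.var 7) (.const 1)) (.const 0)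
        (.add (.get 6 (.var 7) (.const 0)) (.get 6 (.var 7) (.const 0))))
      (.setNat 7 (.const 0) (.const 0) (.add (.var 7) (.const 1))))

theorem exec_scaleWhile {ω : Tape} {B : ℕ} (i : ℕ) (s : State)
    (hi : s.nat 7 0 0 + i = B) (hp : ∀ j ≤ s.nat 7 0 0, s.nat 6 j 0 = 2 ^ j)
    (hJ : ∀ j < s.nat 7 0 0, s.real 8 0 0 * (2 ^ j * 2 ^ j) ≤ s.real 7 0 0 * s.real 1 0 0)
    (hB : s.real 7 0 0 * s.real 1 0 0 < s.real 8 0 0 * (2 ^ B * 2 ^ B)) :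
    ∃ t ≤ 25 + 51 * i, ∃ s', Exec ω scaleWhile s t s' ∧
      (∀ j ≤ s'.nat 7 0 0, s'.nat 6 j 0 = 2 ^ j) ∧ s'.nat 7 0 0 ≤ B ∧
      (∀ j < s'.nat 7 0 0, s.real 8 0 0 * (2 ^ j * 2 ^ j) ≤ s.real 7 0 0 * s.real 1 0 0) ∧
      s.real 7 0 0 * s.real 1 0 0 < s.real 8 0 0 * (2 ^ s'.nat 7 0 0 * 2 ^ s'.nat 7 0 0) ∧
      s'.real = s.real ∧ (∀ a, a ≠ 6 → a ≠ 7 → s'.nat a = s.nat a) ∧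
      s'.uniformUsed = s.uniformUsed ∧ s'.laplaceUsed = s.laplaceUsed := by
  have hT : ∀ s : State, (∀ j ≤ s.nat 7 0 0, s.nat 6 j 0 = 2 ^ j) →
      (Test.holds s (.realLE (.mul (.var 8) (.mul (.ofNat (.get 6 (.var 7) (.const 0)))
      (.ofNat (.get 6 (.var 7) (.const 0))))) (.mul (.var 7) (.var 1))) ↔
      s.real 8 0 0 * (2 ^ s.nat 7 0 0 * 2 ^ s.nat 7 0 0) ≤ s.real 7 0 0 * s.real 1 0 0) := by
    intro s hp
    simp only [Test.holds, RealExp.eval, RealExp.var, NatExp.eval, NatExp.var, hp _ le_rfl]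
    norm_num
  have halt : ∀ s : State, (∀ j ≤ s.nat 7 0 0, s.nat 6 j 0 = 2 ^ j) →
      ¬ s.real 8 0 0 * (2 ^ s.nat 7 0 0 * 2 ^ s.nat 7 0 0) ≤ s.real 7 0 0 * s.real 1 0 0 →
      Exec ω scaleWhile s 25 s := fun s hp h => .whileFalse (fun h' => h ((hT s hp).1 h'))
  induction i generalizing s with
  | zero =>
    -- `B` is a level at which the loop test is known to fail, and `i` is the number of rounds left
    -- before it. A failing test costs 25 steps, a full round 25 + 18 + 8 = 51.
    obtain rfl : s.nat 7 0 0 = B := by omega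
    exact ⟨25, le_rfl, s, halt s hp (not_le.2 hB), hp, le_rfl, hJ, hB, rfl, fun _ _ _ => rfl,
      rfl, rfl⟩
  | succ i ih =>
    by_cases hc : s.real 8 0 0 * (2 ^ s.nat 7 0 0 * 2 ^ s.nat 7 0 0) ≤
        s.real 7 0 0 * s.real 1 0 0
    · have e1 := Exec.setNat (ω := ω) s 6 (.add (.var 7) (.const 1)) (.const 0)
        (.add (.get 6 (.var 7) (.const 0)) (.get 6 (.var 7) (.const 0)))
      have e2 := Exec.setNat (ω := ω) (s.setNat 6 (s.nat 7 0 0 + 1) 0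
        (s.nat 6 (s.nat 7 0 0) 0 + s.nat 6 (s.nat 7 0 0) 0)) 7 (.const 0) (.const 0)
        (.add (.var 7) (.const 1))
      set s₁ := s.setNat 6 (s.nat 7 0 0 + 1) 0
        (s.nat 6 (s.nat 7 0 0) 0 + s.nat 6 (s.nat 7 0 0) 0) with hs₁
      set s₂ := s₁.setNat 7 0 0 (s₁.nat 7 0 0 + 1) with hs₂
      have h17 : s₁.nat 7 0 0 = s.nat 7 0 0 := by simp [hs₁, State.setNat]
      have h27 : s₂.nat 7 0 0 = s.nat 7 0 0 + 1 := by simp [hs₂, State.setNat, h17]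
      have h26 : ∀ j ≤ s₂.nat 7 0 0, s₂.nat 6 j 0 = 2 ^ j := by
        intro j hj
        rw [h27] at hj
        rcases Nat.le_succ_iff.1 hj with hj | rfl
        · rw [← hp j hj]
          have : j ≠ s.nat 7 0 0 + 1 := by omega
          simp [hs₂, hs₁, State.setNat, this]
        · simp only [hs₂, State.setNat_nat_of_ne s₁ (show 6 ≠ 7 by decide)]
          simp [hs₁, State.setNat, hp, pow_succ, mul_two]
      obtain ⟨t, ht, s', hs', hr⟩ := ih s₂ (by omega) h26 (by
        intro j hj
        rw [h27] at hj
        rcases Nat.lt_succ_iff_lt_or_eq.1 hj with hj | rfl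
        · exact hJ j hj
        · exact hc) hB
      obtain ⟨q1, q2, q3, q4, q5, q6, q7, q8⟩ := hr
      refine ⟨25 + (18 + 8) + t, by omega, s', .whileTrue ((hT s hp).2 hc) (.seq e1 e2) hs',
        q1, q2, q3, q4, q5, fun a h6 h7 => ?_, q7, q8⟩
      rw [q6 a h6 h7, hs₂, State.setNat_nat_of_ne _ h7, hs₁, State.setNat_nat_of_ne _ h6]
    · exact ⟨25, by omega, s, halt s hp hc, hp, by omega, hJ, not_le.1 hc, rfl, fun _ _ _ => rfl,
        rfl, rfl⟩

/-- The number of levels: the radius `e * f / 4 ^ j` of the last one is less than all distances. -/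
def numLevels (D : ℕ → ℕ → ℝ) (e f : ℝ) (n : ℕ) : ℕ :=
  sInf {J : ℕ | ∀ x < n, ∀ y < n, x ≠ y → e * f < D x y * (2 ^ J * 2 ^ J)} + 1

/-- The labels of the clusters that are computed from the tape of uniform samples. -/
def clusterLabel (D : ℕ → ℕ → ℝ) (e f : ℝ) (n : ℕ) (ω : ℕ → unitInterval) (i x : ℕ) : ℕ :=
  if i ≤ numLevels D e f n ∧ x < n then
    label (center D (ω 0) e f (priority n ω) n (numLevels D e f n)) n i x
  else 0

/-- The noise that is added to the numbers of clients, up to scaling. -/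
def noise (n L : ℕ) (ω : ℕ → ℝ) (i x : ℕ) : ℝ :=
  if i < L ∧ x < n then ω (i * n + x) else 0

/-- The numbers of clients in the clusters. -/
def counts (lab : ℕ → ℕ → ℕ) (N : ℕ → ℕ) (n L i x : ℕ) : ℕ :=
  if i < L then clusterCount lab N n i x else 0

/-- The number of active levels at a point. -/
def depth (D : ℕ → ℕ → ℝ) (e f : ℝ) (n : ℕ) (N : ℕ → ℕ) (ω : Tape) : ℕ → ℕ :=
  let lab := clusterLabel D e f n ω.1
  let L := numLevels D e f n
  activeLevels lab (IsMarked (harmonic n) e (counts lab N n L) (noise n L ω.2)) L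

/-- The part of the algorithm after the number of levels is known. -/
def mainCmd : Cmd :=
  .seq (.seq (.seq (.seq (.seq (.seq .sampleCmd .centerCmd) .labelCmd) .distCmd) .countCmd)
    .activeCmd) .chooseCmd

/-- The private algorithm for uniform facility location. -/
def algorithm : Program :=
  .seq Cmd.prepareCmd.compile (.seq scaleWhile
    (.seq (.setNat 7 (.const 0) (.const 0) (.add (.var 7) (.const 1))) mainCmd.compile))

/-- A bound for the running time. -/
def timeBound : Polynomial ℕ :=
  Cmd.prepareCmd.time + (.C 33 + .C 51 * .X) + mainCmd.time.comp (.X + 1)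

/-! ### Correctness and running time of the whole program. -/

theorem mainCmd_spec {ω : Tape} {s : State} {n : ℕ} {D : ℕ → ℕ → ℝ} {e f : ℝ} {N : ℕ → ℕ}
    (hn : s.nat 0 0 0 = n) (hN : ∀ v, s.nat 1 v 0 = N v) (hD : s.real 0 = D)
    (hf : s.real 1 0 0 = f) (he : s.real 7 0 0 = e) (hL : s.nat 7 0 0 = numLevels D e f n)
    (hp : ∀ j < numLevels D e f n, s.nat 6 j 0 = 2 ^ j)
    (hnat : ∀ a, 8 ≤ a → s.nat a = 0) (hreal : ∀ a, 2 ≤ a → a ≤ 6 → s.real a = 0)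
    (hu : s.uniformUsed = 0) (hl : s.laplaceUsed = 0) :
    (∀ x < n, (mainCmd.den ω s).nat 2 x 0 ≠ 0 ↔
      IsChosen (clusterLabel D e f n ω.1) (depth D e f n N ω) n x) ∧
    (∀ x < n, ∀ y < n, (mainCmd.den ω s).real 2 x y =
      treeDist (clusterLabel D e f n ω.1) (numLevels D e f n) x y) := by
  set L := numLevels D e f n with hLdef
  let P₁ := Cmd.sampleCmd
  let P₂ := P₁.seq .centerCmd
  let P₃ := P₂.seq .labelCmd
  let P₄ := P₃.seq .distCmd
  let P₅ := P₄.seq .countCmd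
  let P₆ := P₅.seq .activeCmd
  let P₇ := P₆.seq .chooseCmd
  have F₁ := Cmd.frame_den ω P₁ s
  have F₂ := Cmd.frame_den ω P₂ s
  have F₃ := Cmd.frame_den ω P₃ s
  have F₄ := Cmd.frame_den ω P₄ s
  have F₅ := Cmd.frame_den ω P₅ s
  have F₆ := Cmd.frame_den ω P₆ s
  have n0 : ∀ s' : State, s'.nat 0 = s.nat 0 → s'.nat 0 0 0 = n := fun s' h => by rw [h, hn]
  have n7 : ∀ s' : State, s'.nat 7 = s.nat 7 → s'.nat 7 0 0 = L := fun s' h => by rw [h, hL]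
  have n6 : ∀ s' : State, s'.nat 6 = s.nat 6 → ∀ j < L, s'.nat 6 j 0 = 2 ^ j :=
    fun s' h => by rwa [h]
  obtain ⟨hU, hprio, hH⟩ := Cmd.sampleCmd_spec (ω := ω) hn hu
    (fun x => by rw [hreal 4 (by decide) (by decide)]; rfl)
    (by rw [hreal 6 (by decide) (by decide)]; rfl)
  obtain ⟨hc, hX⟩ := Cmd.centerCmd_spec (ω := ω) (s := P₁.den ω s) (D := D) (f := f) (e := e)
    (n0 _ (F₁.nat 0 rfl)) (n7 _ (F₁.nat 7 rfl))
    (by rw [F₁.real 0 rfl, hD]) hU (by rw [F₁.real 7 rfl, he]) (by rw [F₁.real 1 rfl, hf]) hprio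
    (n6 _ (F₁.nat 6 rfl)) ((Cmd.den_laplaceUsed ω P₁ rfl s).trans hl)
    (fun i x => by rw [F₁.nat 8 rfl, hnat 8 (by decide)]; rfl)
    (fun i x => by rw [F₁.real 5 rfl, hreal 5 (by decide) (by decide)]; rfl)
  have hlab : ((P₃.den ω s).nat 9) = clusterLabel D e f n ω.1 := by
    funext i x
    refine (Cmd.labelCmd_spec (ω := ω) (s := P₂.den ω s) (n0 _ (F₂.nat 0 rfl))
      (n7 _ (F₂.nat 7 rfl)) (funext₂ hc)
      (fun i x => by rw [F₂.nat 9 rfl, hnat 9 (by decide)]; rfl) i x).trans ?_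
    rw [clusterLabel]
  have hX3 : (P₃.den ω s).real 5 = noise n L ω.2 :=
    ((Cmd.frame_den ω .labelCmd (P₂.den ω s)).real 5 rfl).trans (funext₂ hX)
  have hH3 : (P₃.den ω s).real 6 0 0 = (harmonic n : ℝ) :=
    (congrFun₂ ((Cmd.frame_den ω (.seq .centerCmd .labelCmd) (P₁.den ω s)).real 6 rfl) 0 0).trans
      hH
  have hdist := Cmd.distCmd_spec (ω := ω) (s := P₃.den ω s) (n0 _ (F₃.nat 0 rfl))
      (n7 _ (F₃.nat 7 rfl)) hlab
      (fun i x => by rw [F₃.real 2 rfl, hreal 2 (by decide) (by decide)]; rfl)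
  have hlab4 : (P₄.den ω s).nat 9 = clusterLabel D e f n ω.1 :=
    ((Cmd.frame_den ω .distCmd (P₃.den ω s)).nat 9 rfl).trans hlab
  have hcnt : (P₅.den ω s).nat 10 = counts (clusterLabel D e f n ω.1) N n L := by
    funext i x
    exact Cmd.countCmd_spec (ω := ω) (s := P₄.den ω s) (n0 _ (F₄.nat 0 rfl))
      (n7 _ (F₄.nat 7 rfl)) hlab4 (fun v => by rw [F₄.nat 1 rfl, hN])
      (fun i x => by rw [F₄.nat 10 rfl, hnat 10 (by decide)]; rfl) i x
  have G₅ := Cmd.frame_den ω (.seq .distCmd .countCmd) (P₃.den ω s)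
  have G₆ := Cmd.frame_den ω (.seq (.seq .distCmd .countCmd) .activeCmd) (P₃.den ω s)
  have hK := Cmd.activeCmd_spec (ω := ω) (s := P₅.den ω s) (n0 _ (F₅.nat 0 rfl))
    (n7 _ (F₅.nat 7 rfl)) ((G₅.nat 9 rfl).trans hlab) hcnt ((G₅.real 5 rfl).trans hX3)
    ((congrFun₂ (G₅.real 6 rfl) 0 0).trans hH3) (by rw [F₅.real 7 rfl, he])
    (n6 _ (F₅.nat 6 rfl)) (fun x => by rw [F₅.nat 11 rfl, hnat 11 (by decide)]; rfl)
  refine ⟨Cmd.chooseCmd_spec (ω := ω) (s := P₆.den ω s) (n0 _ (F₆.nat 0 rfl))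
    ((G₆.nat 9 rfl).trans hlab) hK, fun x hx y hy => ?_⟩
  refine (congrFun₂ ((Cmd.frame_den ω (.seq (.seq .countCmd .activeCmd) .chooseCmd)
    (P₄.den ω s)).real 2 rfl) x y).trans (hdist x hx y hy)

/-- This is the only information about the input size, beyond n, that the time bound needs: it
limits the number of levels. -/
theorem le_mul_two_pow_inputSize {n : ℕ} {d : Fin n → Fin n → ℝ} {f : ℝ} (hf : 0 ≤ f)
    (u v : Fin n) (huv : 0 < d u v) : f ≤ d u v * 2 ^ inputSize d f := by
  rcases hf.eq_or_lt with rfl | hf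
  · positivity
  have h1 : ⌈Real.logb 2 (f / d u v)⌉₊ ≤ inputSize d f :=
    (Finset.le_sup (f := fun q : Fin n × Fin n => ⌈Real.logb 2 (f / d q.1 q.2)⌉₊)
      (Finset.mem_univ (u, v))).trans (Nat.le_add_left _ _)
  have h2 : Real.logb 2 (f / d u v) ≤ (inputSize d f : ℝ) :=
    (Nat.le_ceil _).trans (by exact_mod_cast h1)
  rw [Real.logb_le_iff_le_rpow (by norm_num) (by positivity), Real.rpow_natCast,
    div_le_iff₀ huv] at h2
  linarith

/-- A distance function on `Fin n` as a function on pairs of natural numbers. -/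
def extend {n : ℕ} (d : Fin n → Fin n → ℝ) (i j : ℕ) : ℝ :=
  if h : i < n ∧ j < n then d ⟨i, h.1⟩ ⟨j, h.2⟩ else 0

/-- A vector of numbers of clients as a function on the natural numbers. -/
def extendNat {n : ℕ} (N : Fin n → ℕ) (i : ℕ) : ℕ :=
  if h : i < n then N ⟨i, h⟩ else 0

theorem IsMetric.nonneg {n : ℕ} {d : Fin n → Fin n → ℝ} (hd : IsMetric d) (u v : Fin n) :
    0 ≤ d u v := by
  have h1 := hd.triangle u v u
  rw [(hd.eq_zero_iff u u).2 rfl, hd.symm v u] at h1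
  linarith

theorem IsMetric.pos {n : ℕ} {d : Fin n → Fin n → ℝ} (hd : IsMetric d) {u v : Fin n}
    (h : u ≠ v) : 0 < d u v :=
  (hd.nonneg u v).lt_of_ne' fun e => h ((hd.eq_zero_iff u v).1 e)

theorem exec_algorithm {n : ℕ} {d : Fin n → Fin n → ℝ} {f ε : ℝ} (hn : 2 ≤ n) (hd : IsMetric d)
    (hf : 0 ≤ f) (N : Fin n → ℕ) (ω : Tape) :
    ∃ (t : ℕ) (s : State), Exec ω algorithm (initialState n d f ε N) t s ∧
      t ≤ timeBound.eval (inputSize d f) ∧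
      (∀ x < n, s.nat 2 x 0 ≠ 0 ↔ IsChosen (clusterLabel (extend d) (min ε 1) f n ω.1)
        (depth (extend d) (min ε 1) f n (extendNat N) ω) n x) ∧
      (∀ x < n, ∀ y < n, s.real 2 x y =
        treeDist (clusterLabel (extend d) (min ε 1) f n ω.1)
          (numLevels (extend d) (min ε 1) f n) x y) := by
  set s₀ := initialState n d f ε N with hs₀
  set K := inputSize d f with hK
  have hnK : n ≤ K := by rw [hK, inputSize]; omega
  have h0n : s₀.nat 0 0 0 = n := by simp [hs₀, initialState]
  have h0D : s₀.real 0 = extend d := by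
    funext i j; simp [hs₀, initialState, extend]
  have h0N : ∀ v, s₀.nat 1 v 0 = extendNat N v := by
    intro v; simp [hs₀, initialState, extendNat]
  have h0f : s₀.real 1 0 0 = f := by simp [hs₀, initialState]
  have h0e : s₀.real 1 0 1 = ε := by simp [hs₀, initialState]
  have h0nat : ∀ a, 2 ≤ a → s₀.nat a = 0 := by
    intro a ha; funext i j
    simp [hs₀, initialState, show a ≠ 0 by omega, show a ≠ 1 by omega]
  have h0real : ∀ a, 2 ≤ a → s₀.real a = 0 := by
    intro a ha; funext i j
    simp [hs₀, initialState, show a ≠ 0 by omega, show a ≠ 1 by omega]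
  obtain ⟨t₁, ht₁, e₁⟩ := Cmd.exec_compile ω .prepareCmd rfl K s₀ (by omega)
    (by rw [h0nat 7 (by decide)]; exact Nat.zero_le _)
  obtain ⟨he, hp1, hδ1, hδ2⟩ := Cmd.prepareCmd_spec (ω := ω) h0n hn
  have F := Cmd.frame_den ω .prepareCmd s₀
  set s₁ := Cmd.prepareCmd.den ω s₀ with hs₁
  rw [h0e] at he
  rw [h0D] at hδ1 hδ2
  have hf1 : s₁.real 1 0 0 = f := by rw [F.real 1 rfl, h0f]
  have h17 : s₁.nat 7 0 0 = 0 := by rw [F.nat 7 rfl, h0nat 7 (by decide)]; rfl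
  have hdpos : ∀ x < n, ∀ y < n, x ≠ y → 0 < extend d x y := by
    intro x hx y hy hxy
    rw [extend, dif_pos ⟨hx, hy⟩]
    exact hd.pos (fun h => hxy (Fin.mk.inj_iff.1 h))
  have hδpos : 0 < s₁.real 8 0 0 := by
    obtain ⟨x, hx, y, hy, hxy, h⟩ := hδ1
    rw [h]; exact hdpos x hx y hy hxy
  have hmin : ∀ J : ℕ, min ε 1 * f < s₁.real 8 0 0 * (2 ^ J * 2 ^ J) ↔
      ∀ x < n, ∀ y < n, x ≠ y → min ε 1 * f < extend d x y * (2 ^ J * 2 ^ J) := by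
    intro J
    constructor
    · intro h x hx y hy hxy
      exact h.trans_le (mul_le_mul_of_nonneg_right (hδ2 x hx y hy hxy) (by positivity))
    · intro h
      obtain ⟨x, hx, y, hy, hxy, h'⟩ := hδ1
      rw [h']; exact h x hx y hy hxy
  -- Since e ≤ 1 and K ≥ n ≥ 2, the inequality e f ≤ f ≤ d 2 ^ K < d 4 ^ K holds for every nonzero
  -- distance d, so the while loop stops within K rounds.
  have hKbound : min ε 1 * f < s₁.real 8 0 0 * (2 ^ K * 2 ^ K) := by
    rw [hmin]
    intro x hx y hy hxy
    have h1 := le_mul_two_pow_inputSize hf ⟨x, hx⟩ ⟨y, hy⟩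
      (hd.pos (fun h => hxy (Fin.mk.inj_iff.1 h)))
    have h2 := hdpos x hx y hy hxy
    have h3 : extend d x y = d ⟨x, hx⟩ ⟨y, hy⟩ := by rw [extend, dif_pos ⟨hx, hy⟩]
    rw [← h3] at h1
    have h4 : (1 : ℝ) < 2 ^ K := one_lt_pow₀ (by norm_num) (by omega)
    calc min ε 1 * f ≤ 1 * f := mul_le_mul_of_nonneg_right (min_le_right _ _) hf
      _ ≤ extend d x y * 2 ^ K := by rw [one_mul]; exact h1
      _ < extend d x y * (2 ^ K * 2 ^ K) := by
        apply mul_lt_mul_of_pos_left _ h2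
        nlinarith
  obtain ⟨t₂, ht₂, s₂, e₂, q1, q2, q3, q4, q5, q6, q7, q8⟩ :=
    exec_scaleWhile (ω := ω) (B := K) K s₁ (by omega)
      (by rw [h17]; intro j hj; obtain rfl : j = 0 := by omega
          rw [hp1, pow_zero])
      (by rw [h17]; intro j hj; omega) (by rw [he, hf1]; exact hKbound)
  rw [he, hf1] at q3 q4
  -- The loop stops at the least J with e f < δ 4 ^ J for the smallest distance δ. The levels are 0,
  -- …, J, hence the increment by one.
  have hlev : s₂.nat 7 0 0 + 1 = numLevels (extend d) (min ε 1) f n := by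
    rw [numLevels, Nat.add_right_cancel_iff]
    refine le_antisymm ?_ (Nat.sInf_le ((hmin _).1 q4))
    by_contra hlt
    push Not at hlt
    have := Nat.sInf_mem (s := {J : ℕ | ∀ x < n, ∀ y < n, x ≠ y →
      min ε 1 * f < extend d x y * (2 ^ J * 2 ^ J)}) ⟨_, (hmin _).1 q4⟩
    exact absurd ((hmin _).2 this) (not_lt.2 (q3 _ hlt))
  set s₃ := s₂.setNat 7 0 0 (s₂.nat 7 0 0 + 1) with hs₃
  have e₃ : Exec ω (.setNat 7 (.const 0) (.const 0) (.add (.var 7) (.const 1))) s₂ 8 s₃ :=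
    .setNat s₂ 7 (.const 0) (.const 0) (.add (.var 7) (.const 1))
  have h3nat : ∀ a, Cmd.prepareCmd.writesNat a = false → a ≠ 6 → a ≠ 7 → s₃.nat a = s₀.nat a := by
    intro a h h6 h7
    rw [hs₃, State.setNat_nat_of_ne _ h7, q6 a h6 h7, F.nat a h]
  have h3real : ∀ a, Cmd.prepareCmd.writesReal a = false → s₃.real a = s₀.real a := by
    intro a h
    rw [hs₃, State.setNat_real, q5, F.real a h]
  have h37 : s₃.nat 7 0 0 = s₂.nat 7 0 0 + 1 := by simp [hs₃, State.setNat]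
  have h30 : s₃.nat 0 0 0 = n := by rw [h3nat 0 rfl (by decide) (by decide), h0n]
  -- The number of levels is at most K + 1, which is why `timeBound` composes with X + 1.
  obtain ⟨t₄, ht₄, e₄⟩ := Cmd.exec_compile ω mainCmd rfl (K + 1) s₃ (by omega) (by omega)
  have spec := mainCmd_spec (ω := ω) (s := s₃) (n := n) (D := extend d) (e := min ε 1) (f := f)
    (N := extendNat N) h30
    (fun v => by rw [h3nat 1 rfl (by decide) (by decide), h0N])
    (by rw [h3real 0 rfl, h0D]) (by rw [h3real 1 rfl, h0f])
    (by rw [hs₃, State.setNat_real, q5, he]) (by rw [h37, hlev])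
    (by
      rw [← hlev]
      intro j hj
      rw [hs₃, State.setNat_nat_of_ne _ (by decide)]
      exact q1 j (by omega))
    (by
      intro a ha
      rw [h3nat a _ (by omega) (by omega), h0nat a (by omega)]
      have h5 : 4 ≠ a := by omega
      have h6 : 5 ≠ a := by omega
      have h7 : 6 ≠ a := by omega
      simp [Cmd.prepareCmd, Cmd.clampCmd, Cmd.minRow, Cmd.minBody, Cmd.writesNat, h5, h6, h7])
    (by
      intro a ha ha'
      rw [h3real a _, h0real a ha]
      have h5 : 7 ≠ a := by omega
      have h6 : 8 ≠ a := by omega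
      simp [Cmd.prepareCmd, Cmd.clampCmd, Cmd.minRow, Cmd.minBody, Cmd.writesReal, h5, h6])
    ((q7.trans (Cmd.den_uniformUsed ω .prepareCmd rfl s₀)).trans rfl)
    ((q8.trans (Cmd.den_laplaceUsed ω .prepareCmd rfl s₀)).trans rfl)
  refine ⟨_, _, .seq e₁ (.seq e₂ (.seq e₃ e₄)), ?_, spec.1, spec.2⟩
  simp only [timeBound, Polynomial.eval_add, Polynomial.eval_mul, Polynomial.eval_C,
    Polynomial.eval_X, Polynomial.eval_comp, Polynomial.eval_one]
  omega

/-! ### Hierarchical clusterings -/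

/-- `lab i u` is the label of the cluster of `u` at level `i`: level `0` has a single cluster, each
level refines the one before, and the clusters of level `L` are singletons. -/
structure IsHierarchy {n : ℕ} (L : ℕ) (lab : ℕ → Fin n → ℕ) : Prop where
  root : ∀ u v, lab 0 u = lab 0 v
  refine_succ : ∀ j < L, ∀ u v, lab (j + 1) u = lab (j + 1) v → lab j u = lab j v
  injective : ∀ u v, lab L u = lab L v → u = v
  lt : ∀ i u, lab i u < n

/-- `K u` is the number of the levels at which the cluster of `u` and all larger clusters are
marked, where the clusters of level `1` count as marked. -/
structure IsDepth {n : ℕ} (L : ℕ) (lab : ℕ → Fin n → ℕ) (mark : ℕ → ℕ → Prop) (K : Fin n → ℕ) :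
    Prop where
  le : ∀ u, K u ≤ L
  le_iff : ∀ i ≤ L, ∀ u, i ≤ K u ↔ ∀ j < i, 1 ≤ j → mark j (lab (j + 1) u)

/-- `R` consists of the canonical points of the active clusters without active children. -/
def IsChosenSet {n : ℕ} (lab : ℕ → Fin n → ℕ) (K : Fin n → ℕ) (R : Finset (Fin n)) : Prop :=
  ∀ u, u ∈ R ↔ ∀ v, lab (K u) v = lab (K u) u → K v ≤ K u ∧ v ≤ u

section Hierarchy

variable {n L : ℕ} {lab : ℕ → Fin n → ℕ} {mark : ℕ → ℕ → Prop} {K : Fin n → ℕ}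
  {R : Finset (Fin n)}

theorem IsHierarchy.mono (h : IsHierarchy L lab) {i j : ℕ} (hij : i ≤ j) (hj : j ≤ L)
    {u v : Fin n} (huv : lab j u = lab j v) : lab i u = lab i v := by
  induction j, hij using Nat.le_induction with
  | base => exact huv
  | succ j hij ih => exact ih (by omega) (h.refine_succ j (by omega) u v huv)

/-- Whether the first i levels are active at a point depends only on its labels up to level i, and
these are shared within a cluster of level i. -/
theorem IsDepth.congr (h : IsHierarchy L lab) (hK : IsDepth L lab mark K) {i : ℕ} (hi : i ≤ L)
    {u v : Fin n} (huv : lab i u = lab i v) : i ≤ K u ↔ i ≤ K v := by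
  rw [hK.le_iff i hi, hK.le_iff i hi]
  refine forall₃_congr fun j hj _ => ?_
  rw [h.mono (show j + 1 ≤ i by omega) hi huv]

theorem IsDepth.one_le (hK : IsDepth L lab mark K) (hL : 1 ≤ L) (u : Fin n) : 1 ≤ K u :=
  (hK.le_iff 1 hL u).2 fun j hj h => by omega

/-- In the cluster of u at level K u take a point v of maximal depth, then the largest index in the
cluster of v at that depth. -/
theorem IsChosenSet.exists_mem (h : IsHierarchy L lab) (hK : IsDepth L lab mark K)
    (hR : IsChosenSet lab K R) (u : Fin n) : ∃ s ∈ R, lab (K u) s = lab (K u) u := by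
  classical
  obtain ⟨v, hv, hvmax⟩ := Finset.exists_max_image
    (Finset.univ.filter fun v => lab (K u) v = lab (K u) u) K ⟨u, by simp⟩
  obtain ⟨w, hw, hwmax⟩ := Finset.exists_max_image
    (Finset.univ.filter fun w => lab (K v) w = lab (K v) v) id ⟨v, by simp⟩
  simp only [Finset.mem_filter, Finset.mem_univ, true_and, id] at hv hw hvmax hwmax
  have hwu : lab (K u) w = lab (K u) u :=
    (h.mono (hvmax u rfl) (hK.le v) hw).trans hv
  have hKw : K w = K v := le_antisymm (hvmax w hwu) ((hK.congr h (hK.le v) hw).2 le_rfl)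
  refine ⟨w, (hR w).2 fun x hx => ?_, hwu⟩
  rw [hKw] at hx ⊢
  have hxv := hx.trans hw
  exact ⟨hvmax x ((h.mono (hvmax u rfl) (hK.le v) hxv).trans hv), hwmax x hxv⟩

/-- Clusters of chosen points, taken at their depths, are disjoint: a common point x has the depth
of both s and t, so the clusters coincide and each index bounds the other. All injectivity in the
cost bounds comes from here. -/
theorem IsChosenSet.eq_of_mem (h : IsHierarchy L lab) (hK : IsDepth L lab mark K)
    (hR : IsChosenSet lab K R) {s t x : Fin n} (hs : s ∈ R) (ht : t ∈ R)
    (hsx : lab (K s) x = lab (K s) s) (htx : lab (K t) x = lab (K t) t) : s = t := by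
  have h1 : K x = K s :=
    le_antisymm ((hR s).1 hs x hsx).1 ((hK.congr h (hK.le s) hsx).2 le_rfl)
  have h2 : K x = K t :=
    le_antisymm ((hR t).1 ht x htx).1 ((hK.congr h (hK.le t) htx).2 le_rfl)
  have h3 : K s = K t := h1.symm.trans h2
  rw [← h3] at htx
  have hst : lab (K s) s = lab (K s) t := hsx.symm.trans htx
  exact le_antisymm (((hR t).1 ht s (by rw [← h3]; exact hst)).2)
    ((hR s).1 hs t hst.symm).2

open Classical in
/-- The metric of a hierarchical clustering: the number of levels at which two points are
separated. -/
def levelDist (lab : ℕ → Fin n → ℕ) (L : ℕ) (u v : Fin n) : ℝ :=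
  ((∑ j ∈ Finset.range L, if lab (j + 1) u = lab (j + 1) v then 0 else 1 : ℕ) : ℝ)

theorem IsHierarchy.isMetric_levelDist (h : IsHierarchy L lab) (hL : 1 ≤ L) :
    IsMetric (levelDist lab L) where
  eq_zero_iff u v := by
    rw [levelDist, Nat.cast_eq_zero, Finset.sum_eq_zero_iff]
    constructor
    · intro h0
      have := h0 (L - 1) (by simp; omega)
      rw [Nat.sub_add_cancel hL] at this
      exact h.injective u v (by by_contra hne; simp [hne] at this)
    · rintro rfl j -
      simp
  symm u v := by simp only [levelDist, eq_comm]
  triangle u v w := by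
    simp only [levelDist]
    rw [← Nat.cast_add, Nat.cast_le, ← Finset.sum_add_distrib]
    refine Finset.sum_le_sum fun j _ => ?_
    split_ifs <;> omega

theorem IsHierarchy.levelDist_le (h : IsHierarchy L lab) {i : ℕ} (hi : i ≤ L) {u v : Fin n}
    (huv : lab i u = lab i v) : levelDist lab L u v ≤ ((L - i : ℕ) : ℝ) := by
  rw [levelDist, Nat.cast_le, ← Finset.card_range (L - i)]
  rw [← Finset.sum_range_add_sum_Ico _ hi, Finset.sum_eq_zero (s := Finset.range i), zero_add]
  · refine (Finset.sum_le_card_nsmul _ _ 1 fun j _ => ?_).trans ?_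
    · split_ifs <;> omega
    · simp
  · intro j hj
    rw [Finset.mem_range] at hj
    rw [if_pos (h.mono (by omega) hi huv)]

/-- Points apart at level i are apart at all the L - i + 1 levels from i to L. With `levelDist_le`
this puts a cluster strictly closer, under the published metric, than its complement. -/
theorem IsHierarchy.lt_levelDist (h : IsHierarchy L lab) {i : ℕ} (hi : i ≤ L) {u v : Fin n}
    (huv : lab i u ≠ lab i v) : ((L - i : ℕ) : ℝ) < levelDist lab L u v := by
  obtain ⟨i, rfl⟩ : ∃ i', i = i' + 1 :=
    Nat.exists_eq_succ_of_ne_zero (by rintro rfl; exact huv (h.root u v))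
  rw [levelDist, Nat.cast_lt]
  rw [← Finset.sum_range_add_sum_Ico _ (show i ≤ L by omega)]
  refine lt_of_lt_of_le ?_ (Nat.le_add_left _ _)
  rw [Finset.sum_congr rfl (g := fun _ => 1)]
  · simp; omega
  · intro j hj
    rw [Finset.mem_Ico] at hj
    rw [if_neg]
    exact fun e => huv (h.mono (by omega) (by omega) e)

theorem connect_spec (ρ : Fin n → Fin n → ℝ) (hR : R.Nonempty) (v : Fin n) :
    connect ρ R v ∈ R ∧ ∀ t ∈ R, ρ v (connect ρ R v) ≤ ρ v t := by
  classical
  obtain ⟨s, hs, hmin⟩ := Finset.exists_min_image R (ρ v) hR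
  have hne : (R.filter fun s => ∀ t ∈ R, ρ v s ≤ ρ v t).Nonempty :=
    ⟨s, Finset.mem_filter.2 ⟨hs, hmin⟩⟩
  have hmem : connect ρ R v ∈ R.filter fun s => ∀ t ∈ R, ρ v s ≤ ρ v t := by
    rw [connect, dif_pos hne]
    exact Finset.min'_mem _ hne
  exact Finset.mem_filter.1 hmem

/-- The last active cluster of u contains a chosen point, and every point outside it is strictly
farther under the published metric. Ties can occur only inside the cluster. -/
theorem IsChosenSet.connect_mem (h : IsHierarchy L lab) (hK : IsDepth L lab mark K)
    (hR : IsChosenSet lab K R) (u : Fin n) : connect (levelDist lab L) R u ∈ R ∧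
    lab (K u) (connect (levelDist lab L) R u) = lab (K u) u := by
  obtain ⟨s, hs, hsu⟩ := hR.exists_mem h hK u
  obtain ⟨h1, h2⟩ := connect_spec (levelDist lab L) ⟨s, hs⟩ u
  refine ⟨h1, ?_⟩
  by_contra hne
  have h3 := h.lt_levelDist (hK.le u) (Ne.symm hne)
  have h4 := h.levelDist_le (hK.le u) hsu.symm
  exact absurd ((h3.trans_le (h2 s hs)).trans_le h4) (lt_irrefl _)

/-! ### Deterministic cost bounds for a hierarchy. -/

open Classical in
/-- The number of clients in a cluster. -/
def clients (lab : ℕ → Fin n → ℕ) (N : Fin n → ℕ) (j x : ℕ) : ℕ :=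
  ∑ v, if lab (j + 1) v = x then N v else 0

variable {d : Fin n → Fin n → ℝ} {f e H : ℝ} {N : Fin n → ℕ} {Y : ℕ → ℕ → ℝ}
  {S : Finset (Fin n)} {T : Fin n → ℝ}

/-- The threshold is chosen so that a cluster holding that many clients, each paying the radius,
costs 4 H f at every level. -/
theorem radius_mul_threshold (he : 0 < e) (j : ℕ) :
    e * f / 4 ^ j * (4 * H * (2 ^ j * 2 ^ j) / e) = 4 * H * f := by
  rw [show (4 : ℝ) ^ j = 2 ^ j * 2 ^ j by rw [← mul_pow]; norm_num]
  have : (2 : ℝ) ^ j ≠ 0 := by positivity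
  field_simp

/-- Noise at level j costs f / 2 ^ j after multiplication by the radius, so all levels together cost
O(f). -/
theorem radius_mul_scale (he : 0 < e) (j : ℕ) (y : ℝ) :
    e * f / 4 ^ j * (2 ^ j / e * y) = f * ((1 / 2) ^ j * y) := by
  rw [show (4 : ℝ) ^ j = 2 ^ j * 2 ^ j by rw [← mul_pow]; norm_num, one_div, inv_pow]
  have : (2 : ℝ) ^ j ≠ 0 := by positivity
  field_simp

theorem clients_mul (lab : ℕ → Fin n → ℕ) (N : Fin n → ℕ) (j x : ℕ) (a : ℝ) :
    a * (clients lab N j x : ℝ) = ∑ v, if lab (j + 1) v = x then a * N v else 0 := by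
  rw [clients, Nat.cast_sum, Finset.mul_sum]
  refine Finset.sum_congr rfl fun v _ => ?_
  split_ifs <;> simp

/-- The connection cost in terms of the cost `T` of a solution `S` in the hierarchy. -/
theorem connection_le (h : IsHierarchy L lab) (hL : 1 ≤ L)
    (hK : IsDepth L lab (IsMarked H e (clients lab N) Y) K) (hR : IsChosenSet lab K R)
    (hd : ∀ u, d u u = 0) (he : 0 < e) (hf : 0 ≤ f) (hH : 0 ≤ H)
    (hdiam : ∀ j < L, ∀ u v, lab (j + 1) u = lab (j + 1) v → d u v ≤ 2 * (e * f / 4 ^ j))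
    (hT0 : ∀ v, 0 ≤ T v)
    (hT : ∀ v, ∀ j < L, (∀ s ∈ S, lab (j + 1) v ≠ lab (j + 1) s) → e * f / 4 ^ j ≤ T v) :
    ∑ v, (N v : ℝ) * d v (connect (levelDist lab L) R v) ≤ 8 * ∑ v, (N v : ℝ) * T v +
      8 * ∑ s ∈ S, (4 * H * f +
        f * ∑ j ∈ Finset.range L, (1 / 2) ^ j * |Y j (lab (j + 1) s)|) := by
  classical
  have hr : ∀ j, 0 ≤ e * f / 4 ^ j := fun j => by positivity
  have step : ∀ v, (N v : ℝ) * d v (connect (levelDist lab L) R v) ≤ 8 * ((N v : ℝ) * T v) +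
      ∑ s ∈ S, if K s < L ∧ lab (K s + 1) v = lab (K s + 1) s then
        8 * (e * f / 4 ^ K s) * N v else 0 := by
    intro v
    have hsum : 0 ≤ ∑ s ∈ S, if K s < L ∧ lab (K s + 1) v = lab (K s + 1) s then
        8 * (e * f / 4 ^ K s) * (N v : ℝ) else 0 := Finset.sum_nonneg fun s _ => by
      split_ifs
      · have := hr (K s); positivity
      · exact le_rfl
    have hNT : 0 ≤ (N v : ℝ) * T v := mul_nonneg (Nat.cast_nonneg _) (hT0 v)
    obtain ⟨-, h2⟩ := hR.connect_mem h hK v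
    -- If all levels are active at v, its last cluster is a singleton and v itself is open.
    rcases (hK.le v).eq_or_lt with hv | hv
    · rw [hv] at h2
      rw [h.injective _ _ h2, hd, mul_zero]
      positivity
    · obtain ⟨k, hk⟩ : ∃ k, K v = k + 1 :=
        Nat.exists_eq_succ_of_ne_zero (by have := hK.one_le hL v; omega)
      -- The cluster at label level k + 1 has diameter at most 2 r_k, which is 8 r_{k + 1} = 8 r_{K
      -- v}.
      have h3 : d v (connect (levelDist lab L) R v) ≤ 8 * (e * f / 4 ^ K v) := by
        refine (hdiam k (by omega) v _ ?_).trans (le_of_eq ?_)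
        · rw [← hk]; exact h2.symm
        · rw [hk, pow_succ]; field_simp; ring
      have h4 := mul_le_mul_of_nonneg_left h3 (Nat.cast_nonneg (α := ℝ) (N v))
      by_cases hS : ∀ s ∈ S, lab (K v + 1) v ≠ lab (K v + 1) s
      · have h5 := mul_le_mul_of_nonneg_left (hT v (K v) hv hS) (Nat.cast_nonneg (α := ℝ) (N v))
        linarith
      · push Not at hS
        obtain ⟨s, hs, hvs⟩ := hS
        -- The points s and v share the first inactive cluster, so they have the same depth. Each s
        -- is thus charged for a single level, K s.
        have hKs : K s = K v := by
          have h6 := hK.congr h (show K v + 1 ≤ L by omega) hvs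
          have h7 := hK.congr h (hK.le v) (h.refine_succ _ hv _ _ hvs)
          omega
        have h8 := Finset.single_le_sum (s := S) (f := fun s => if K s < L ∧
          lab (K s + 1) v = lab (K s + 1) s then 8 * (e * f / 4 ^ K s) * (N v : ℝ) else 0)
          (fun s _ => by
            split_ifs
            · have := hr (K s); positivity
            · exact le_rfl) hs
        simp only [hKs] at h8
        rw [if_pos ⟨hv, hvs⟩] at h8
        linarith
  refine (Finset.sum_le_sum fun v _ => step v).trans ?_
  rw [Finset.sum_add_distrib, ← Finset.mul_sum, Finset.sum_comm (s := Finset.univ) (t := S),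
    Finset.mul_sum S]
  refine add_le_add_right (Finset.sum_le_sum fun s _ => ?_) _
  have hY : 0 ≤ ∑ j ∈ Finset.range L, (1 / 2) ^ j * |Y j (lab (j + 1) s)| :=
    Finset.sum_nonneg fun j _ => by positivity
  by_cases hs : K s < L
  · simp only [hs, true_and]
    rw [← clients_mul]
    -- The depth of s stops at K s although everything above is marked, so the next cluster failed
    -- the test.
    have hm : ¬ IsMarked H e (clients lab N) Y (K s) (lab (K s + 1) s) := by
      intro hm
      have h1 := (hK.le_iff (K s + 1) hs s).2 fun j hj hj1 => by
        rcases Nat.lt_succ_iff_lt_or_eq.1 hj with hj | rfl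
        · exact (hK.le_iff (K s) hs.le s).1 le_rfl j hj hj1
        · exact hm
      omega
    rw [IsMarked, not_le] at hm
    have h1 : (clients lab N (K s) (lab (K s + 1) s) : ℝ) ≤
        4 * H * (2 ^ K s * 2 ^ K s) / e + 2 ^ K s / e * |Y (K s) (lab (K s + 1) s)| := by
      have h2 : 2 ^ K s / e * -Y (K s) (lab (K s + 1) s) ≤
          2 ^ K s / e * |Y (K s) (lab (K s + 1) s)| :=
        mul_le_mul_of_nonneg_left (neg_le_abs _) (by positivity)
      linarith
    have h3 := mul_le_mul_of_nonneg_left h1 (hr (K s))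
    rw [mul_add, radius_mul_threshold he, radius_mul_scale he] at h3
    -- The level K s depends on the noise. Bounding its noise term by the sum over all levels
    -- removes this dependence before expectations are taken.
    have h4 := Finset.single_le_sum (s := Finset.range L)
      (f := fun j => (1 / 2 : ℝ) ^ j * |Y j (lab (j + 1) s)|)
      (fun j _ => by positivity) (Finset.mem_range.2 hs)
    have h5 := mul_le_mul_of_nonneg_left h4 hf
    linarith
  · simp only [hs, false_and, if_false, Finset.sum_const_zero]
    positivity

/-- The marks that are due to the noise only. -/
def falseMarks (n L : ℕ) (H : ℝ) (Y : ℕ → ℕ → ℝ) : Finset (ℕ × ℕ) :=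
  open Classical in
  (Finset.range L ×ˢ Finset.range n).filter fun q => 1 ≤ q.1 ∧ 2 * H * 2 ^ q.1 ≤ Y q.1 q.2

/-- The number of opened facilities in terms of the cost `T` of a solution `S` in the hierarchy. -/
theorem facilities_le (h : IsHierarchy L lab) (hL : 1 ≤ L)
    (hK : IsDepth L lab (IsMarked H e (clients lab N) Y) K) (hR : IsChosenSet lab K R)
    (he : 0 < e) (he1 : e ≤ 1) (hf : 0 ≤ f) (hH : 1 ≤ H) (hT0 : ∀ v, 0 ≤ T v)
    (hT : ∀ v, ∀ j < L, (∀ s ∈ S, lab (j + 1) v ≠ lab (j + 1) s) → e * f / 4 ^ j ≤ T v) :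
    ((opened (levelDist lab L) R N).card : ℝ) * f ≤ S.card * f +
      e⁻¹ * ∑ v, (N v : ℝ) * T v + (falseMarks n L H Y).card * f := by
  classical
  set O := opened (levelDist lab L) R N with hO
  have hOR : ∀ s ∈ O, s ∈ R ∧ ∃ v, 1 ≤ N v ∧ lab (K v) s = lab (K v) v := by
    intro s hs
    simp only [hO, opened, Finset.mem_image, Finset.mem_filter, Finset.mem_univ, true_and] at hs
    obtain ⟨v, hv, rfl⟩ := hs
    have := hR.connect_mem h hK v
    exact ⟨this.1, v, hv, this.2⟩
  set A := O.filter fun s => ∃ x ∈ S, lab (K s) x = lab (K s) s with hA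
  set B := O.filter fun s => ¬ ∃ x ∈ S, lab (K s) x = lab (K s) s with hB
  -- `A` collects the facilities whose cluster meets S, `B` the others. Disjointness of the clusters
  -- injects `A` into S.
  have hcard : O.card = A.card + B.card := (Finset.card_filter_add_card_filter_not _).symm
  have hAS : A.card ≤ S.card := by
    have hex : ∀ s : Fin n, ∃ x, s ∈ A → x ∈ S ∧ lab (K s) x = lab (K s) s := by
      intro s
      by_cases hs : s ∈ A
      · obtain ⟨x, hx⟩ := (Finset.mem_filter.1 hs).2
        exact ⟨x, fun _ => hx⟩
      · exact ⟨s, fun h => absurd h hs⟩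
    choose φ hφ using hex
    refine Finset.card_le_card_of_injOn φ (fun s hs => (hφ s hs).1) ?_
    intro s hs t ht hst
    have h1 := (hφ s hs).2
    have h2 := (hφ t ht).2
    rw [← hst] at h2
    exact hR.eq_of_mem h hK (hOR s (Finset.mem_filter.1 hs).1).1
      (hOR t (Finset.mem_filter.1 ht).1).1 h1 h2
  have ha : ∀ v, 0 ≤ e⁻¹ * ((N v : ℝ) * T v) := fun v =>
    mul_nonneg (inv_nonneg.2 he.le) (mul_nonneg (Nat.cast_nonneg _) (hT0 v))
  have hB1 : ∀ s ∈ B, f ≤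
      (∑ v, if lab (K s) v = lab (K s) s then e⁻¹ * ((N v : ℝ) * T v) else 0) +
      if (K s - 1, lab (K s) s) ∈ falseMarks n L H Y then f else 0 := by
    intro s hs
    obtain ⟨hsO, hsS⟩ := Finset.mem_filter.1 hs
    push Not at hsS
    obtain ⟨hsR, v, hNv, hvs⟩ := hOR s hsO
    obtain ⟨j, hj⟩ : ∃ j, K s = j + 1 :=
      Nat.exists_eq_succ_of_ne_zero (by have := hK.one_le hL s; omega)
    have hjL : j < L := by have := hK.le s; omega
    have hTs : ∀ w, lab (j + 1) w = lab (j + 1) s → e * f / 4 ^ j ≤ T w := by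
      intro w hw
      refine hT w j hjL fun x hx e' => hsS x hx ?_
      rw [hj, ← e', hw]
    have hsum0 : 0 ≤ ∑ v, if lab (j + 1) v = lab (j + 1) s then e⁻¹ * ((N v : ℝ) * T v) else 0 :=
      Finset.sum_nonneg fun v _ => by
        split_ifs
        · exact ha v
        · exact le_rfl
    rw [hj, Nat.add_sub_cancel]
    -- At j = 0 no test was made, but an opened facility has a client v connected to it; v lies in
    -- the same cluster and T v ≥ e f. Dividing by e is the one place where 1 / e is needed.
    rcases Nat.eq_zero_or_pos j with rfl | hj1
    · have hv1 : lab (0 + 1) v = lab (0 + 1) s :=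
        (h.mono (hK.one_le hL v) (hK.le v) hvs).symm
      have h1 := hTs v hv1
      rw [pow_zero, div_one] at h1
      have h2 := Finset.single_le_sum (s := Finset.univ)
        (f := fun v => if lab (0 + 1) v = lab (0 + 1) s then e⁻¹ * ((N v : ℝ) * T v) else 0)
        (fun v _ => by
          split_ifs
          · exact ha v
          · exact le_rfl) (Finset.mem_univ v)
      simp only [hv1, if_true] at h2
      have h3 : f ≤ e⁻¹ * ((N v : ℝ) * T v) := by
        have h4 : (1 : ℝ) ≤ N v := by exact_mod_cast hNv
        have h5 : e * f ≤ (N v : ℝ) * T v :=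
          h1.trans (le_mul_of_one_le_left (hT0 v) h4)
        rw [inv_mul_eq_div, le_div_iff₀ he]
        linarith
      have h6 : (0 : ℝ) ≤ if (0, lab (0 + 1) s) ∈ falseMarks n L H Y then f else 0 := by
        split_ifs
        · exact hf
        · exact le_rfl
      linarith
    · have hm : IsMarked H e (clients lab N) Y j (lab (j + 1) s) :=
        (hK.le_iff (K s) (hK.le s) s).1 le_rfl j (by omega) hj1
      split_ifs with hF
      · linarith
      -- Without a false mark the noise contributes less than half of the threshold, so the cluster
      -- has at least half of the threshold in clients; each has T at least the radius, which gives
      -- 2 H f ≥ f.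
      · have hY : Y j (lab (j + 1) s) < 2 * H * 2 ^ j := by
          by_contra hY
          apply hF
          simp only [falseMarks, Finset.mem_filter, Finset.mem_product, Finset.mem_range]
          exact ⟨⟨hjL, h.lt _ _⟩, hj1, not_lt.1 hY⟩
        rw [IsMarked] at hm
        have h1 : 2 ^ j / e * Y j (lab (j + 1) s) ≤ 2 ^ j / e * (2 * H * 2 ^ j) :=
          mul_le_mul_of_nonneg_left hY.le (by positivity)
        have h2 : 2 ^ j / e * (2 * H * 2 ^ j) = 1 / 2 * (4 * H * (2 ^ j * 2 ^ j) / e) := by ring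
        have h3 : 1 / 2 * (4 * H * (2 ^ j * 2 ^ j) / e) ≤
            (clients lab N j (lab (j + 1) s) : ℝ) := by linarith
        have h4 := mul_le_mul_of_nonneg_left h3 (show 0 ≤ e * f / 4 ^ j by positivity)
        rw [mul_left_comm, radius_mul_threshold he, clients_mul] at h4
        have h5 : (∑ v, if lab (j + 1) v = lab (j + 1) s then e * f / 4 ^ j * (N v : ℝ) else 0) ≤
            ∑ v, if lab (j + 1) v = lab (j + 1) s then e⁻¹ * ((N v : ℝ) * T v) else 0 := by
          refine Finset.sum_le_sum fun v _ => ?_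
          split_ifs with hv
          · have h6 := mul_le_mul_of_nonneg_right (hTs v hv) (Nat.cast_nonneg (α := ℝ) (N v))
            have h7 : (N v : ℝ) * T v ≤ e⁻¹ * ((N v : ℝ) * T v) :=
              le_mul_of_one_le_left (mul_nonneg (Nat.cast_nonneg _) (hT0 v))
                ((one_le_inv₀ he).2 he1)
            linarith
          · exact le_rfl
        have h8 : f ≤ H * f := le_mul_of_one_le_left hf hH
        linarith
  have hB2 : (B.card : ℝ) * f ≤ e⁻¹ * ∑ v, (N v : ℝ) * T v + (falseMarks n L H Y).card * f := by
    rw [← nsmul_eq_mul, ← Finset.sum_const]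
    refine (Finset.sum_le_sum hB1).trans ?_
    rw [Finset.sum_add_distrib]
    refine add_le_add ?_ ?_
    · rw [Finset.sum_comm, Finset.mul_sum]
      refine Finset.sum_le_sum fun v _ => ?_
      rw [← Finset.sum_filter, Finset.sum_const, nsmul_eq_mul]
      refine mul_le_of_le_one_left (ha v) ?_
      -- A client pays for at most one facility of `B`, as the clusters are disjoint.
      rw [Nat.cast_le_one, Finset.card_le_one]
      intro s hs t ht
      simp only [Finset.mem_filter] at hs ht
      exact hR.eq_of_mem h hK (hOR s (Finset.mem_filter.1 hs.1).1).1
        (hOR t (Finset.mem_filter.1 ht.1).1).1 hs.2 ht.2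
    · rw [← Finset.sum_filter, Finset.sum_const, nsmul_eq_mul]
      refine mul_le_mul_of_nonneg_right ?_ hf
      rw [Nat.cast_le]
      refine Finset.card_le_card_of_injOn (fun s => (K s - 1, lab (K s) s))
        (fun s hs => (Finset.mem_filter.1 hs).2) ?_
      intro s hs t ht hst
      simp only [Prod.mk.injEq] at hst
      have h1 := hK.one_le hL s
      have h2 := hK.one_le hL t
      have h3 : K s = K t := by omega
      refine hR.eq_of_mem h hK (hOR s (Finset.mem_filter.1 (Finset.mem_filter.1 hs).1).1).1
        (hOR t (Finset.mem_filter.1 (Finset.mem_filter.1 ht).1).1).1 (x := s) rfl ?_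
      rw [← h3, hst.2, h3]
  have h9 : (A.card : ℝ) * f ≤ S.card * f :=
    mul_le_mul_of_nonneg_right (by exact_mod_cast hAS) hf
  rw [hcard]
  push_cast
  linarith

end Hierarchy

/-! ### The clustering that is computed by the algorithm -/

theorem lastSat_le (P : ℕ → Prop) (k : ℕ) : lastSat P (k + 1) ≤ k := by
  induction k with
  | zero => rw [lastSat]; split_ifs <;> simp [lastSat]
  | succ k ih => rw [lastSat]; split_ifs <;> omega

theorem lastSat_spec {P : ℕ → Prop} {k u : ℕ} (hu : u < k) (hP : P u) : P (lastSat P k) := by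
  induction k with
  | zero => omega
  | succ k ih =>
    rw [lastSat]
    split_ifs with h
    · exact h
    · rcases Nat.lt_succ_iff_lt_or_eq.1 hu with hu | rfl
      · exact ih hu
      · exact absurd hP h

/-- The last clause records the tie-break. It makes the minimizer unique, so two balls that contain
each other's centers have the same center, even on tapes with equal priorities. -/
theorem lastArgmin_spec {E : ℕ → Prop} {p : ℕ → ℝ} {top k u : ℕ}
    (htop : ∀ w < k, p w ≤ p top) (hu : u < k) (hE : E u) :
    lastArgmin E p top k < k ∧ E (lastArgmin E p top k) ∧
      ∀ w < k, E w → p (lastArgmin E p top k) ≤ p w ∧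
        (p w ≤ p (lastArgmin E p top k) → w ≤ lastArgmin E p top k) := by
  induction k generalizing u with
  | zero => omega
  | succ k ih =>
    by_cases hex : ∃ u < k, E u
    · obtain ⟨v, hv, hEv⟩ := hex
      obtain ⟨h1, h2, h3⟩ := ih (fun w hw => htop w (by omega)) hv hEv
      rw [lastArgmin]
      split_ifs with h
      · refine ⟨by omega, h.1, fun w hw hEw => ?_⟩
        rcases Nat.lt_succ_iff_lt_or_eq.1 hw with hw | rfl
        · exact ⟨h.2.trans (h3 w hw hEw).1, fun _ => by omega⟩
        · exact ⟨le_rfl, fun _ => le_rfl⟩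
      · refine ⟨by omega, h2, fun w hw hEw => ?_⟩
        rcases Nat.lt_succ_iff_lt_or_eq.1 hw with hw | rfl
        · exact h3 w hw hEw
        · have h4 : ¬ p w ≤ p (lastArgmin E p top w) := fun h' => h ⟨hEw, h'⟩
          exact ⟨(not_le.1 h4).le, fun h' => absurd h' h4⟩
    · push Not at hex
      obtain rfl : u = k := by
        rcases Nat.lt_succ_iff_lt_or_eq.1 hu with hu | h
        · exact absurd hE (hex u hu)
        · exact h
      have h0 : ∀ m ≤ u, lastArgmin E p top m = top := by
        intro m hm
        induction m with
        | zero => rfl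
        | succ m ihm =>
          rw [lastArgmin, if_neg (fun h => hex m (by omega) h.1), ihm (by omega)]
      rw [lastArgmin, h0 u le_rfl, if_pos ⟨hE, htop u (by omega)⟩]
      refine ⟨by omega, hE, fun w hw hEw => ?_⟩
      rcases Nat.lt_succ_iff_lt_or_eq.1 hw with hw | rfl
      · exact absurd hEw (hex w hw)
      · exact ⟨le_rfl, fun _ => le_rfl⟩

theorem label_lt (c : ℕ → ℕ → ℕ) {n : ℕ} (hn : 0 < n) (i u : ℕ) : label c n i u < n := by
  obtain ⟨n, rfl⟩ := Nat.exists_eq_succ_of_ne_zero hn.ne'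
  cases i with
  | zero => exact hn
  | succ i =>
    rw [label]
    exact Nat.lt_succ_of_le (lastSat_le _ n)

theorem label_succ_eq_iff (c : ℕ → ℕ → ℕ) {n u v : ℕ} (hu : u < n) (hv : v < n) (j : ℕ) :
    label c n (j + 1) u = label c n (j + 1) v ↔
      label c n j u = label c n j v ∧ c j u = c j v := by
  constructor
  · intro h
    have h1 := lastSat_spec (P := fun v => label c n j u = label c n j v ∧ c j u = c j v) hu
      ⟨rfl, rfl⟩
    have h2 := lastSat_spec (P := fun w => label c n j v = label c n j w ∧ c j v = c j w) hv
      ⟨rfl, rfl⟩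
    rw [label, label] at h
    rw [← h] at h2
    exact ⟨h1.1.trans h2.1.symm, h1.2.trans h2.2.symm⟩
  · rintro ⟨h1, h2⟩
    rw [label, label, h1, h2]

theorem exists_center_ne {n i u v : ℕ} (c : ℕ → ℕ → ℕ) (hu : u < n) (hv : v < n)
    (h : label c n i u ≠ label c n i v) : ∃ j < i, c j u ≠ c j v := by
  induction i with
  | zero => exact absurd rfl h
  | succ i ih =>
    rw [ne_eq, label_succ_eq_iff c hu hv, not_and_or] at h
    rcases h with h | h
    · obtain ⟨j, hj, hc⟩ := ih h
      exact ⟨j, by omega, hc⟩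
    · exact ⟨i, by omega, h⟩

/-- The recursion extends the depth only while no level has been missed, so its value is the length
of the initial run of marked levels. -/
theorem activeLevels_spec (lab : ℕ → ℕ → ℕ) (mark : ℕ → ℕ → Prop) (i u : ℕ) :
    activeLevels lab mark i u ≤ i ∧ ∀ k ≤ i, (k ≤ activeLevels lab mark i u ↔
      ∀ j < k, 1 ≤ j → mark j (lab (j + 1) u)) := by
  induction i with
  | zero =>
    refine ⟨le_rfl, fun k hk => ?_⟩
    obtain rfl : k = 0 := by omega
    simp
  | succ i ih =>
    rw [activeLevels]
    split_ifs with h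
    · refine ⟨le_rfl, fun k hk => iff_of_true hk fun j hj hj1 => ?_⟩
      rcases Nat.lt_or_ge j i with hji | hji
      · exact (ih.2 i le_rfl).1 h.1.ge j hji hj1
      · obtain rfl : j = i := by omega
        exact h.2 hj1
    · refine ⟨ih.1.trans (Nat.le_succ i), fun k hk => ?_⟩
      rcases Nat.le_succ_iff.1 hk with hk | rfl
      · exact ih.2 k hk
      · refine iff_of_false (by have := ih.1; omega) fun h' => h ⟨?_, h' i (by omega)⟩
        exact le_antisymm ih.1 ((ih.2 i le_rfl).2 fun j hj => h' j (by omega))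

theorem priority_le (n : ℕ) (ω : ℕ → unitInterval) {w : ℕ} (hw : w < n) :
    priority n ω w ≤ priority n ω n := by
  rw [priority, priority, if_pos hw, if_neg (lt_irrefl n), if_pos rfl]
  exact (ω (w + 1)).2.2.trans (by norm_num)

/-- If two points have different centers then one of the balls around them contains a point of
minimal priority in the union of the balls that is not in the other ball. -/
theorem exists_cut {D : ℕ → ℕ → ℝ} {U e f : ℝ} {n L j u v : ℕ} {ω : ℕ → unitInterval}
    (hj : j < L) (hu : u < n) (hv : v < n) (hEu : InBall D U e f j u u)
    (hEv : InBall D U e f j v v)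
    (h : center D U e f (priority n ω) n L j u ≠ center D U e f (priority n ω) n L j v) :
    ∃ w < n, ((InBall D U e f j u w ∧ ¬ InBall D U e f j v w) ∨
        (InBall D U e f j v w ∧ ¬ InBall D U e f j u w)) ∧
      ∀ x < n, InBall D U e f j u x ∨ InBall D U e f j v x →
        priority n ω w ≤ priority n ω x := by
  have hca : center D U e f (priority n ω) n L j u =
      lastArgmin (InBall D U e f j u) (priority n ω) n n := by rw [center, if_pos ⟨hj, hu⟩]
  have hcb : center D U e f (priority n ω) n L j v =
      lastArgmin (InBall D U e f j v) (priority n ω) n n := by rw [center, if_pos ⟨hj, hv⟩]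
  obtain ⟨a1, a2, a3⟩ := lastArgmin_spec (p := priority n ω) (fun w hw => priority_le n ω hw) hu hEu
  obtain ⟨b1, b2, b3⟩ := lastArgmin_spec (p := priority n ω) (fun w hw => priority_le n ω hw) hv hEv
  rw [hca, hcb] at h
  set a := lastArgmin (InBall D U e f j u) (priority n ω) n n
  set b := lastArgmin (InBall D U e f j v) (priority n ω) n n
  -- Unless each center lies in both balls, which forces them to be equal, a center of smaller
  -- priority lies in only one ball; it minimizes over the union.
  by_cases ha : InBall D U e f j v a
  · by_cases hb : InBall D U e f j u b
    · have h1 := b3 a a1 ha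
      have h2 := a3 b b1 hb
      exact absurd (le_antisymm (h1.2 h2.1) (h2.2 h1.1)) h
    · refine ⟨b, b1, .inr ⟨b2, hb⟩, fun x hx hE => ?_⟩
      rcases hE with hE | hE
      · exact (b3 a a1 ha).1.trans (a3 x hx hE).1
      · exact (b3 x hx hE).1
  · by_cases hb : InBall D U e f j u b
    · refine ⟨a, a1, .inl ⟨a2, ha⟩, fun x hx hE => ?_⟩
      rcases hE with hE | hE
      · exact (a3 x hx hE).1
      · exact (a3 b b1 hb).1.trans (b3 x hx hE).1
    · rcases le_total (priority n ω a) (priority n ω b) with hab | hab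
      · refine ⟨a, a1, .inl ⟨a2, ha⟩, fun x hx hE => ?_⟩
        rcases hE with hE | hE
        · exact (a3 x hx hE).1
        · exact hab.trans (b3 x hx hE).1
      · refine ⟨b, b1, .inr ⟨b2, hb⟩, fun x hx hE => ?_⟩
        rcases hE with hE | hE
        · exact hab.trans (a3 x hx hE).1
        · exact (b3 x hx hE).1

theorem inBall_iff {D : ℕ → ℕ → ℝ} {U e f : ℝ} {j u w : ℕ} :
    InBall D U e f j u w ↔ D u w ≤ (1 + U) / 2 * (e * f / 4 ^ j) := by
  rw [InBall, show (4 : ℝ) ^ j = 2 ^ j * 2 ^ j by rw [← mul_pow]; norm_num]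
  have h : (0 : ℝ) < 2 ^ j * 2 ^ j := by positivity
  rw [show (1 + U) / 2 * (e * f / (2 ^ j * 2 ^ j)) = (1 + U) * (e * f) / 2 / (2 ^ j * 2 ^ j) by
    ring, le_div_iff₀ h]
  constructor <;> intro h <;> linarith

section Clustering

variable {n : ℕ} {d : Fin n → Fin n → ℝ} {e f : ℝ}

theorem extend_coe (d : Fin n → Fin n → ℝ) (u v : Fin n) : extend d u v = d u v := by
  rw [extend, dif_pos ⟨u.2, v.2⟩]

theorem extendNat_coe (N : Fin n → ℕ) (v : Fin n) : extendNat N v = N v := by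
  rw [extendNat, dif_pos v.2]

theorem numLevels_spec (hd : IsMetric d) (hef : 0 ≤ e * f) {x y : Fin n} (hxy : x ≠ y) :
    e * f / 4 ^ (numLevels (extend d) e f n - 1) < d x y := by
  have hne : {J : ℕ | ∀ x < n, ∀ y < n, x ≠ y →
      e * f < extend d x y * (2 ^ J * 2 ^ J)}.Nonempty := by
    -- Any level with a small enough radius serves here; it only shows that the infimum is over a
    -- nonempty set.
    refine ⟨inputSize d (e * f) + 1, fun x hx y hy hxy => ?_⟩
    have hpos : 0 < d ⟨x, hx⟩ ⟨y, hy⟩ := hd.pos (fun h => hxy (Fin.mk.inj_iff.1 h))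
    have h1 := le_mul_two_pow_inputSize hef _ _ hpos
    rw [show extend d x y = d ⟨x, hx⟩ ⟨y, hy⟩ from extend_coe d ⟨x, hx⟩ ⟨y, hy⟩]
    refine h1.trans_lt (mul_lt_mul_of_pos_left ?_ hpos)
    have h2 : (1 : ℝ) ≤ 2 ^ inputSize d (e * f) := one_le_pow₀ (by norm_num)
    rw [pow_succ]
    nlinarith
  have h := Nat.sInf_mem hne x x.2 y y.2 (fun h => hxy (Fin.ext h))
  rw [extend_coe] at h
  rw [numLevels, Nat.add_sub_cancel, div_lt_iff₀ (by positivity),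
    show (4 : ℝ) = 2 * 2 by norm_num, mul_pow]
  exact h

/-- The clustering as a function on `Fin n`. -/
def finLabel (d : Fin n → Fin n → ℝ) (e f : ℝ) (ω : ℕ → unitInterval) (i : ℕ) (u : Fin n) : ℕ :=
  clusterLabel (extend d) e f n ω i u

/-- The centers as a function on `Fin n`. -/
def finCenter (d : Fin n → Fin n → ℝ) (e f : ℝ) (ω : ℕ → unitInterval) (j : ℕ) (u : Fin n) : ℕ :=
  center (extend d) (ω 0) e f (priority n ω) n (numLevels (extend d) e f n) j u

theorem finLabel_eq (ω : ℕ → unitInterval) {i : ℕ} (hi : i ≤ numLevels (extend d) e f n)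
    (u : Fin n) : finLabel d e f ω i u = label (center (extend d) (ω 0) e f (priority n ω) n
      (numLevels (extend d) e f n)) n i u := by
  rw [finLabel, clusterLabel, if_pos ⟨hi, u.2⟩]

theorem inBall_self (hd : IsMetric d) (hef : 0 ≤ e * f) (U : unitInterval) (j : ℕ) (u : Fin n) :
    InBall (extend d) U e f j u u := by
  rw [inBall_iff, extend_coe, (hd.eq_zero_iff u u).2 rfl]
  have := U.2.1
  positivity

theorem finCenter_spec (hd : IsMetric d) (hef : 0 ≤ e * f) (ω : ℕ → unitInterval) {j : ℕ}
    (hj : j < numLevels (extend d) e f n) (u : Fin n) :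
    ∃ w : Fin n, finCenter d e f ω j u = w ∧ d u w ≤ e * f / 4 ^ j := by
  have hc : finCenter d e f ω j u =
      lastArgmin (InBall (extend d) (ω 0) e f j u) (priority n ω) n n := by
    rw [finCenter, center, if_pos ⟨hj, u.2⟩]
  obtain ⟨a1, a2, -⟩ := lastArgmin_spec (p := priority n ω) (fun w hw => priority_le n ω hw) u.2
    (inBall_self hd hef (ω 0) j u)
  refine ⟨⟨_, a1⟩, hc, ?_⟩
  have h1 := inBall_iff.1 a2
  rw [show extend d u _ = d u ⟨_, a1⟩ from extend_coe d u ⟨_, a1⟩] at h1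
  refine h1.trans (mul_le_of_le_one_left (by positivity) ?_)
  linarith [(ω 0).2.2]

theorem finCenter_eq_of_finLabel_eq (ω : ℕ → unitInterval) {j : ℕ}
    (hj : j < numLevels (extend d) e f n) {u v : Fin n}
    (h : finLabel d e f ω (j + 1) u = finLabel d e f ω (j + 1) v) :
    finCenter d e f ω j u = finCenter d e f ω j v := by
  rw [finLabel_eq ω hj, finLabel_eq ω hj, label_succ_eq_iff _ u.2 v.2] at h
  exact h.2

theorem exists_finCenter_ne (ω : ℕ → unitInterval) {i : ℕ}
    (hi : i ≤ numLevels (extend d) e f n) {u v : Fin n}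
    (h : finLabel d e f ω i u ≠ finLabel d e f ω i v) :
    ∃ j < i, finCenter d e f ω j u ≠ finCenter d e f ω j v := by
  rw [finLabel_eq ω hi, finLabel_eq ω hi] at h
  exact exists_center_ne _ u.2 v.2 h

theorem diam_finLabel (hd : IsMetric d) (hef : 0 ≤ e * f) (ω : ℕ → unitInterval) {j : ℕ}
    (hj : j < numLevels (extend d) e f n) {u v : Fin n}
    (h : finLabel d e f ω (j + 1) u = finLabel d e f ω (j + 1) v) :
    d u v ≤ 2 * (e * f / 4 ^ j) := by
  obtain ⟨w, hw, h1⟩ := finCenter_spec hd hef ω hj u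
  obtain ⟨w', hw', h2⟩ := finCenter_spec hd hef ω hj v
  rw [finCenter_eq_of_finLabel_eq ω hj h, hw'] at hw
  obtain rfl : w' = w := Fin.ext hw
  have := hd.triangle u w' v
  rw [hd.symm w' v] at this
  linarith

theorem isHierarchy_finLabel (hd : IsMetric d) (hef : 0 ≤ e * f) (ω : ℕ → unitInterval) :
    IsHierarchy (numLevels (extend d) e f n) (finLabel d e f ω) where
  root u v := by rw [finLabel_eq ω (Nat.zero_le _), finLabel_eq ω (Nat.zero_le _), label, label]
  refine_succ j hj u v h := by
    rw [finLabel_eq ω hj, finLabel_eq ω hj, label_succ_eq_iff _ u.2 v.2] at h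
    rw [finLabel_eq ω hj.le, finLabel_eq ω hj.le]
    exact h.1
  injective u v h := by
    have hL : numLevels (extend d) e f n = numLevels (extend d) e f n - 1 + 1 := by
      rw [numLevels]; omega
    rw [hL] at h
    -- The last radius is below all distances between distinct points, so the last ball around x is
    -- {x} and x is its own center.
    have hself : ∀ x : Fin n, finCenter d e f ω (numLevels (extend d) e f n - 1) x = x := by
      intro x
      obtain ⟨w, hw, h1⟩ := finCenter_spec hd hef ω (show numLevels (extend d) e f n - 1 <
        numLevels (extend d) e f n by omega) x
      rw [hw]
      by_contra hne
      have h2 := numLevels_spec (e := e) (f := f) hd hef (x := x) (y := w)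
        (fun h => hne (by rw [h]))
      linarith
    have h1 := finCenter_eq_of_finLabel_eq ω (by omega) h
    rw [hself, hself] at h1
    exact Fin.ext h1
  lt i u := by
    rw [finLabel, clusterLabel]
    split_ifs
    · exact label_lt _ u.pos _ _
    · exact u.pos

theorem clusterCount_eq_clients (ω : ℕ → unitInterval) (N : Fin n → ℕ) {j : ℕ} (x : ℕ) :
    clusterCount (clusterLabel (extend d) e f n ω) (extendNat N) n j x =
      clients (finLabel d e f ω) N j x := by
  classical
  rw [clusterCount, clients, Finset.sum_range]
  refine Finset.sum_congr rfl fun v _ => ?_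
  rw [extendNat_coe]
  rfl

/-- The number of active levels as a function on `Fin n`. -/
def finDepth (d : Fin n → Fin n → ℝ) (e f : ℝ) (N : Fin n → ℕ) (ω : Tape) (u : Fin n) : ℕ :=
  depth (extend d) e f n (extendNat N) ω u

theorem isDepth_finDepth (N : Fin n → ℕ) (ω : Tape) :
    IsDepth (numLevels (extend d) e f n) (finLabel d e f ω.1)
      (IsMarked (harmonic n) e (clients (finLabel d e f ω.1) N)
        (noise n (numLevels (extend d) e f n) ω.2)) (finDepth d e f N ω) where
  le u := (activeLevels_spec _ _ _ _).1
  le_iff i hi u := by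
    refine ((activeLevels_spec _ _ _ _).2 i hi).trans ?_
    refine forall₃_congr fun j hj _ => ?_
    rw [IsMarked, IsMarked, counts, if_pos (by omega), clusterCount_eq_clients]
    rfl

/-- The published set. -/
def finChosen (d : Fin n → Fin n → ℝ) (e f : ℝ) (N : Fin n → ℕ) (ω : Tape) : Finset (Fin n) :=
  open Classical in
  Finset.univ.filter fun u : Fin n => IsChosen (clusterLabel (extend d) e f n ω.1)
    (depth (extend d) e f n (extendNat N) ω) n u

theorem mem_finChosen (N : Fin n → ℕ) (ω : Tape) (u : Fin n) : u ∈ finChosen d e f N ω ↔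
    ∀ v, finLabel d e f ω.1 (finDepth d e f N ω u) v = finLabel d e f ω.1 (finDepth d e f N ω u) u →
      finDepth d e f N ω v ≤ finDepth d e f N ω u ∧ v ≤ u := by
  classical
  rw [finChosen, Finset.mem_filter]
  simp only [Finset.mem_univ, true_and, IsChosen]
  exact ⟨fun h v => h v v.2, fun h v hv => h ⟨v, hv⟩⟩

theorem treeDist_eq_levelDist (ω : ℕ → unitInterval) (u v : Fin n) :
    (treeDist (clusterLabel (extend d) e f n ω) (numLevels (extend d) e f n) u v : ℝ) =
      levelDist (finLabel d e f ω) (numLevels (extend d) e f n) u v := rfl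

/-- The outcome of a run of the algorithm. -/
theorem exists_run {ε : ℝ} (hn : 2 ≤ n) (hd : IsMetric d) (hf : 0 ≤ f) (N : Fin n → ℕ)
    (ω : Tape) :
    ∃ (t : ℕ) (s : State), Exec ω algorithm (initialState n d f ε N) t s ∧
      t ≤ timeBound.eval (inputSize d f) ∧
      outputSet n s = finChosen d (min ε 1) f N ω ∧
      outputMetric n s = levelDist (finLabel d (min ε 1) f ω.1)
        (numLevels (extend d) (min ε 1) f n) := by
  obtain ⟨t, s, h1, h2, h3, h4⟩ := exec_algorithm (ε := ε) hn hd hf N ω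
  classical
  refine ⟨t, s, h1, h2, ?_, ?_⟩
  · ext u
    rw [outputSet, finChosen, Finset.mem_filter, Finset.mem_filter, h3 u u.2]
  · funext u v
    rw [outputMetric, h4 u u.2 v v.2, treeDist_eq_levelDist]

end Clustering

/-! ### Resampling one coordinate of an infinite product -/

section Resampling

variable {X : Type*} [MeasurableSpace X] (μ : Measure X) [IsProbabilityMeasure μ]

theorem measurable_update_pair (i : ℕ) :
    Measurable fun q : (ℕ → X) × X => Function.update q.1 i q.2 := by
  refine measurable_pi_lambda _ fun k => ?_
  by_cases hk : k = i
  · subst hk; simpa using measurable_snd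
  · simpa [Function.update_of_ne hk] using measurable_fst.eval (a := k)

/-- Checked on cylinders, which determine the product measure: the fresh sample replaces the factor
of the coordinate i. -/
theorem map_update_infinitePi (i : ℕ) :
    ((Measure.infinitePi fun _ : ℕ => μ).prod μ).map (fun q => Function.update q.1 i q.2) =
      Measure.infinitePi fun _ : ℕ => μ := by
  refine Measure.eq_infinitePi _ fun s t ht => ?_
  rw [Measure.map_apply (measurable_update_pair i)
    (MeasurableSet.pi s.countable_toSet fun k _ => ht k)]
  have hpre : (fun q : (ℕ → X) × X => Function.update q.1 i q.2) ⁻¹' Set.pi (s : Set ℕ) t =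
      Set.pi ((s.erase i : Finset ℕ) : Set ℕ) t ×ˢ (if i ∈ s then t i else Set.univ) := by
    ext ⟨ω, x⟩
    simp only [Set.mem_preimage, Set.mem_pi, Finset.mem_coe, Set.mem_prod, Finset.mem_erase]
    constructor
    · intro h
      refine ⟨fun k hk => ?_, ?_⟩
      · simpa [Function.update_of_ne hk.1] using h k hk.2
      · split_ifs with hi
        · simpa using h i hi
        · trivial
    · rintro ⟨h1, h2⟩ k hk
      by_cases hki : k = i
      · subst hki
        rw [if_pos hk] at h2
        simpa using h2
      · rw [Function.update_of_ne hki]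
        exact h1 k ⟨hki, hk⟩
  rw [hpre, Measure.prod_prod, Measure.infinitePi_pi _ fun k _ => ht k]
  split_ifs with hi
  · rw [mul_comm, Finset.mul_prod_erase s (fun k => μ (t k)) hi]
  · rw [measure_univ, mul_one, Finset.erase_eq_of_notMem hi]

theorem lintegral_infinitePi_update (i : ℕ) {F : (ℕ → X) → ℝ≥0∞} (hF : Measurable F) :
    ∫⁻ ω, F ω ∂(Measure.infinitePi fun _ : ℕ => μ) =
      ∫⁻ ω, ∫⁻ x, F (Function.update ω i x) ∂μ ∂(Measure.infinitePi fun _ : ℕ => μ) := by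
  conv_lhs => rw [← map_update_infinitePi μ i]
  rw [lintegral_map hF (measurable_update_pair i),
    lintegral_prod (fun q : (ℕ → X) × X => F (Function.update q.1 i q.2))
      (hF.comp (measurable_update_pair i)).aemeasurable]

theorem infinitePi_apply_update (i : ℕ) {B : Set (ℕ → X)} (hB : MeasurableSet B) :
    (Measure.infinitePi fun _ : ℕ => μ) B =
      ∫⁻ ω, μ {x | Function.update ω i x ∈ B} ∂(Measure.infinitePi fun _ : ℕ => μ) := by
  rw [← lintegral_indicator_one hB, lintegral_infinitePi_update μ i (measurable_one.indicator hB)]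
  refine lintegral_congr fun ω => ?_
  rw [← lintegral_indicator_one]
  · rfl
  · exact (measurable_update_pair i).comp measurable_prodMk_left hB

/-- A coordinate is independent of every event that does not depend on it. -/
theorem infinitePi_inter_eq_mul (i : ℕ) {I : Set X} (hI : MeasurableSet I) {B : Set (ℕ → X)}
    (hB : MeasurableSet B) (hBi : ∀ ω x, Function.update ω i x ∈ B ↔ ω ∈ B) :
    (Measure.infinitePi fun _ : ℕ => μ) ({ω | ω i ∈ I} ∩ B) =
      μ I * (Measure.infinitePi fun _ : ℕ => μ) B := by
  have hm : MeasurableSet ({ω : ℕ → X | ω i ∈ I} ∩ B) := (measurable_pi_apply i hI).inter hB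
  rw [infinitePi_apply_update μ i hm]
  rw [← lintegral_indicator_one hB, ← lintegral_const_mul _ (measurable_one.indicator hB)]
  refine lintegral_congr fun ω => ?_
  by_cases hω : ω ∈ B
  · simp [hBi, hω]
  · simp [hBi, hω]

end Resampling

/-! ### The least of finitely many uniform samples. -/

theorem lintegral_one_sub_pow (k : ℕ) :
    ∫⁻ t : unitInterval, ENNReal.ofReal (1 - t) ^ k = ((k + 1 : ℕ) : ℝ≥0∞)⁻¹ := by
  have h1 : ∀ t : unitInterval, ENNReal.ofReal (1 - t) ^ k = ENNReal.ofReal ((1 - (t : ℝ)) ^ k) :=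
    fun t => (ENNReal.ofReal_pow (by linarith [t.2.2]) k).symm
  simp_rw [h1]
  rw [unitInterval.volume_def, lintegral_subtype_comap (s := Set.Icc (0 : ℝ) 1) measurableSet_Icc
    (fun t : ℝ => ENNReal.ofReal ((1 - t) ^ k))]
  rw [← ofReal_integral_eq_lintegral_ofReal]
  · rw [integral_Icc_eq_integral_Ioc, ← intervalIntegral.integral_of_le zero_le_one,
      intervalIntegral.integral_comp_sub_left (fun x => x ^ k) 1]
    rw [integral_pow]
    simp only [sub_self, sub_zero, one_pow, ne_eq, Nat.add_eq_zero_iff, one_ne_zero, and_false,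
      not_false_eq_true, zero_pow]
    rw [one_div, ENNReal.ofReal_inv_of_pos (by positivity)]
    congr 1
    rw [← Nat.cast_add_one, ENNReal.ofReal_natCast]
  · exact (Continuous.continuousOn (by fun_prop)).integrableOn_Icc
  · filter_upwards [ae_restrict_mem measurableSet_Icc] with t ht
    exact pow_nonneg (by linarith [ht.2]) k

/-- Among independent uniform samples each one is the smallest with the same probability. -/
theorem infinitePi_min_eq {A : Finset ℕ} {i : ℕ} (hi : i ∈ A) :
    (Measure.infinitePi fun _ : ℕ => (volume : Measure unitInterval))
      {ω | ∀ k ∈ A, ω i ≤ ω k} = (A.card : ℝ≥0∞)⁻¹ := by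
  have hB : MeasurableSet {ω : ℕ → unitInterval | ∀ k ∈ A, ω i ≤ ω k} := by
    have : {ω : ℕ → unitInterval | ∀ k ∈ A, ω i ≤ ω k} = ⋂ k ∈ A, {ω | ω i ≤ ω k} := by
      ext; simp
    rw [this]
    exact Finset.measurableSet_biInter A fun k _ =>
      measurableSet_le (measurable_pi_apply i) (measurable_pi_apply k)
  have hupd : ∀ (ω : ℕ → unitInterval) (t : unitInterval),
      Function.update ω i t ∈ {ω : ℕ → unitInterval | ∀ k ∈ A, ω i ≤ ω k} ↔
        ω ∈ Set.pi ((A.erase i : Finset ℕ) : Set ℕ) fun _ => Set.Ici t := by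
    intro ω t
    simp only [Set.mem_ofPred_eq, Set.mem_pi, Finset.mem_coe, Finset.mem_erase,
      Function.update_self, Set.mem_Ici]
    constructor
    · intro h k hk
      simpa [Function.update_of_ne hk.1] using h k hk.2
    · intro h k hk
      by_cases hki : k = i
      · subst hki; simp
      · rw [Function.update_of_ne hki]
        exact h k ⟨hki, hk⟩
  have hF : Measurable (Function.uncurry fun (ω : ℕ → unitInterval) (t : unitInterval) =>
      ({ω : ℕ → unitInterval | ∀ k ∈ A, ω i ≤ ω k}.indicator
        (1 : (ℕ → unitInterval) → ℝ≥0∞)) (Function.update ω i t)) :=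
    (measurable_one.indicator hB).comp (measurable_update_pair i)
  rw [← lintegral_indicator_one hB, lintegral_infinitePi_update _ i (measurable_one.indicator hB),
    -- With the sample at i fixed to t, the other samples of A are all at least t with probability
    -- (1 - t) ^ (|A| - 1). The integral over t gives 1 / |A|, and ties need no separate treatment.
    lintegral_lintegral_swap hF.aemeasurable]
  have hin : ∀ t : unitInterval, ∫⁻ ω, ({ω : ℕ → unitInterval | ∀ k ∈ A, ω i ≤ ω k}.indicator
      (1 : (ℕ → unitInterval) → ℝ≥0∞)) (Function.update ω i t)
        ∂(Measure.infinitePi fun _ : ℕ => (volume : Measure unitInterval)) =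
      ENNReal.ofReal (1 - t) ^ (A.erase i).card := by
    intro t
    have hms : MeasurableSet (Set.pi ((A.erase i : Finset ℕ) : Set ℕ)
        fun _ => Set.Ici t) := MeasurableSet.pi (Finset.countable_toSet _)
          fun _ _ => measurableSet_Ici
    have : ∀ ω : ℕ → unitInterval, ({ω : ℕ → unitInterval | ∀ k ∈ A, ω i ≤ ω k}.indicator
        (1 : (ℕ → unitInterval) → ℝ≥0∞)) (Function.update ω i t) =
        (Set.pi ((A.erase i : Finset ℕ) : Set ℕ) fun _ => Set.Ici t).indicator 1 ω := by
      intro ω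
      by_cases h : ω ∈ Set.pi ((A.erase i : Finset ℕ) : Set ℕ) fun _ => Set.Ici t
      · rw [Set.indicator_of_mem ((hupd ω t).2 h), Set.indicator_of_mem h]
        rfl
      · rw [Set.indicator_of_notMem (fun h' => h ((hupd ω t).1 h')), Set.indicator_of_notMem h]
    simp_rw [this]
    rw [lintegral_indicator_one hms, Measure.infinitePi_pi _ fun _ _ => measurableSet_Ici]
    simp
  simp_rw [hin]
  rw [lintegral_one_sub_pow, Finset.card_erase_of_mem hi,
    Nat.sub_add_cancel (Finset.card_pos.2 ⟨i, hi⟩)]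

/-! ### The Laplace distribution -/

theorem laplace_Ici_le {t : ℝ} (ht : 0 ≤ t) :
    laplace (Set.Ici t) ≤ ENNReal.ofReal (Real.exp (-t)) := by
  rw [laplace, withDensity_apply _ measurableSet_Ici, setLIntegral_congr Ioi_ae_eq_Ici.symm]
  have h : ∫⁻ x in Set.Ioi t, ENNReal.ofReal (Real.exp (-x)) = ENNReal.ofReal (Real.exp (-t)) := by
    rw [← integral_exp_neg_Ioi, ofReal_integral_eq_lintegral_ofReal]
    · exact (integrableOn_exp_neg_Ioi t)
    · exact Filter.Eventually.of_forall fun x => (Real.exp_pos _).le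
  rw [← h]
  refine setLIntegral_mono' measurableSet_Ioi fun x hx => ENNReal.ofReal_le_ofReal ?_
  rw [abs_of_pos (ht.trans_lt hx)]
  linarith [Real.exp_pos (-x)]

theorem lintegral_abs_laplace : ∫⁻ x, ENNReal.ofReal |x| ∂laplace = 1 := by
  have h1 : ∫ x : ℝ, Real.exp (-|x|) / 2 * |x| = 1 := by
    rw [integral_comp_abs (f := fun x => Real.exp (-x) / 2 * x)]
    have h2 := Real.Gamma_eq_integral (s := 2) (by norm_num)
    rw [Real.Gamma_two] at h2
    rw [← integral_const_mul, h2]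
    refine setIntegral_congr_fun measurableSet_Ioi fun x hx => ?_
    norm_num
    ring
  have h2 : Integrable fun x : ℝ => Real.exp (-|x|) / 2 * |x| := by
    by_contra h
    rw [integral_undef h] at h1
    norm_num at h1
  rw [laplace, lintegral_withDensity_eq_lintegral_mul _ (by fun_prop) (by fun_prop)]
  have h3 : ∀ x : ℝ, ((fun x => ENNReal.ofReal (Real.exp (-|x|) / 2)) *
      fun x => ENNReal.ofReal |x|) x = ENNReal.ofReal (Real.exp (-|x|) / 2 * |x|) := fun x => by
    rw [Pi.mul_apply, ENNReal.ofReal_mul (by positivity)]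
  simp_rw [h3]
  rw [← ofReal_integral_eq_lintegral_ofReal h2 (Filter.Eventually.of_forall fun x => by positivity),
    h1, ENNReal.ofReal_one]

/-- A shift by a changes |x| by at most |a|, hence the density by a factor of at most exp |a|. -/
theorem laplace_shift_le (a : ℝ) {B : Set ℝ} (hB : MeasurableSet B) :
    laplace {x | x + a ∈ B} ≤ ENNReal.ofReal (Real.exp |a|) * laplace B := by
  have hB' : MeasurableSet {x : ℝ | x + a ∈ B} := measurable_add_const a hB
  rw [laplace, withDensity_apply _ hB', withDensity_apply _ hB, ← lintegral_indicator hB',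
    ← lintegral_indicator hB, ← lintegral_const_mul' _ _ ENNReal.ofReal_ne_top]
  refine (lintegral_mono fun x => ?_).trans_eq (lintegral_add_right_eq_self (fun x =>
    ENNReal.ofReal (Real.exp |a|) * B.indicator
      (fun x => ENNReal.ofReal (Real.exp (-|x|) / 2)) x) a)
  by_cases hx : x + a ∈ B
  · rw [Set.indicator_of_mem (by exact hx), Set.indicator_of_mem hx,
      ← ENNReal.ofReal_mul (Real.exp_pos _).le]
    refine ENNReal.ofReal_le_ofReal ?_
    rw [← mul_div_assoc, ← Real.exp_add]
    gcongr
    have := abs_add_le x a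
    linarith
  · rw [Set.indicator_of_notMem (by exact hx)]
    exact zero_le

/-- Adding a constant to one sample. -/
theorem infinitePi_laplace_update_le (i : ℕ) (a : ℝ) {B : Set (ℕ → ℝ)} (hB : MeasurableSet B) :
    (Measure.infinitePi fun _ : ℕ => laplace) {ω | Function.update ω i (ω i + a) ∈ B} ≤
      ENNReal.ofReal (Real.exp |a|) * (Measure.infinitePi fun _ : ℕ => laplace) B := by
  have hm : Measurable fun ω : ℕ → ℝ => Function.update ω i (ω i + a) :=
    (measurable_update_pair i).comp
      (measurable_id.prodMk (show Measurable fun ω : ℕ → ℝ => ω i + a by fun_prop))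
  have hms : MeasurableSet {ω : ℕ → ℝ | Function.update ω i (ω i + a) ∈ B} := hm hB
  rw [infinitePi_apply_update laplace i hms, infinitePi_apply_update laplace i hB,
    ← lintegral_const_mul']
  · refine lintegral_mono fun ω => ?_
    have := laplace_shift_le a (B := {x | Function.update ω i x ∈ B})
      ((measurable_update_pair i).comp measurable_prodMk_left hB)
    refine le_trans (le_of_eq ?_) this
    congr 1
    ext x
    simp
  · exact ENNReal.ofReal_ne_top

/-- Adding constants to finitely many samples. -/
theorem infinitePi_laplace_shift_le (A : Finset ℕ) (a : ℕ → ℝ) {B : Set (ℕ → ℝ)}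
    (hB : MeasurableSet B) :
    (Measure.infinitePi fun _ : ℕ => laplace) {ω | (fun k => if k ∈ A then ω k + a k else ω k) ∈ B}
      ≤ ENNReal.ofReal (Real.exp (∑ k ∈ A, |a k|)) *
        (Measure.infinitePi fun _ : ℕ => laplace) B := by
  induction A using Finset.induction_on with
  | empty => simp only [Finset.notMem_empty, if_false, Finset.sum_empty, Real.exp_zero,
      ENNReal.ofReal_one, one_mul]; exact le_rfl
  | insert i A hi ih =>
    have hm : Measurable fun ω : ℕ → ℝ => fun k => if k ∈ A then ω k + a k else ω k := by
      refine measurable_pi_lambda _ fun k => ?_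
      split_ifs
      · exact (measurable_pi_apply k).add_const _
      · exact measurable_pi_apply k
    have h1 : {ω : ℕ → ℝ | (fun k => if k ∈ insert i A then ω k + a k else ω k) ∈ B} =
        {ω | Function.update ω i (ω i + a i) ∈
          {ω : ℕ → ℝ | (fun k => if k ∈ A then ω k + a k else ω k) ∈ B}} := by
      ext ω
      simp only [Set.mem_ofPred_eq]
      refine iff_of_eq (congrArg (· ∈ B) (funext fun k => ?_))
      by_cases hk : k = i
      · subst hk; simp [hi]
      · simp [hk]
    rw [h1, Finset.sum_insert hi, Real.exp_add, ENNReal.ofReal_mul (Real.exp_pos _).le, mul_assoc]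
    exact (infinitePi_laplace_update_le i (a i) (hm hB)).trans (mul_le_mul_right ih _)

/-! ### Measurability of the output -/

section Measurability

variable {Ω : Type*} [MeasurableSpace Ω]

/-- Labels are used as random indices. A countable index type makes evaluation at a random index
measurable. -/
theorem measurable_apply_nat {β : Type*} [MeasurableSpace β] {g : Ω → ℕ → β}
    (hg : ∀ k, Measurable fun ω => g ω k) {h : Ω → ℕ} (hh : Measurable h) :
    Measurable fun ω => g ω (h ω) :=
  (measurable_from_prod_countable_left (f := fun q : Ω × ℕ => g q.1 q.2) hg).comp
    (measurable_id.prodMk hh)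

theorem measurable_eq_nat {g h : Ω → ℕ} (hg : Measurable g) (hh : Measurable h) :
    Measurable fun ω => g ω = h ω :=
  measurableSet_setOfPred.1 (measurableSet_eq_fun hg hh)

theorem measurable_lastSat {P : Ω → ℕ → Prop} (hP : ∀ k, Measurable fun ω => P ω k) (k : ℕ) :
    Measurable fun ω => lastSat (P ω) k := by
  induction k with
  | zero => exact measurable_const
  | succ k ih =>
    simp only [lastSat]
    exact Measurable.ite (measurableSet_setOfPred.2 (hP k)) measurable_const ih

theorem measurable_lastArgmin {E : Ω → ℕ → Prop} {p : Ω → ℕ → ℝ}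
    (hE : ∀ k, Measurable fun ω => E ω k) (hp : ∀ k, Measurable fun ω => p ω k) (top k : ℕ) :
    Measurable fun ω => lastArgmin (E ω) (p ω) top k := by
  induction k with
  | zero => exact measurable_const
  | succ k ih =>
    simp only [lastArgmin]
    refine Measurable.ite (measurableSet_setOfPred.2 ((hE k).and ?_)) measurable_const ih
    exact measurableSet_setOfPred.1 (measurableSet_le (hp k) (measurable_apply_nat hp ih))

theorem measurable_label {c : Ω → ℕ → ℕ → ℕ} (hc : ∀ j u, Measurable fun ω => c ω j u)
    (n j u : ℕ) : Measurable fun ω => label (c ω) n j u := by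
  induction j generalizing u with
  | zero => exact measurable_const
  | succ j ih =>
    simp only [label]
    exact measurable_lastSat (fun v => (measurable_eq_nat (ih u) (ih v)).and
      (measurable_eq_nat (hc j u) (hc j v))) n

theorem measurable_activeLevels {lab : Ω → ℕ → ℕ → ℕ} {mark : Ω → ℕ → ℕ → Prop}
    (hl : ∀ i u, Measurable fun ω => lab ω i u) (hm : ∀ j x, Measurable fun ω => mark ω j x)
    (j u : ℕ) : Measurable fun ω => activeLevels (lab ω) (mark ω) j u := by
  induction j with
  | zero => exact measurable_const
  | succ j ih =>
    simp only [activeLevels]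
    refine Measurable.ite (measurableSet_setOfPred.2 ((measurable_eq_nat ih
      measurable_const).and (Measurable.imp measurable_const ?_))) measurable_const ih
    exact measurable_apply_nat (hm j) (hl (j + 1) u)

end Measurability

theorem measurable_priority (n w : ℕ) :
    Measurable fun ω : ℕ → unitInterval => priority n ω w := by
  unfold priority
  split_ifs
  · exact measurable_subtype_coe.comp (measurable_pi_apply (w + 1))
  · exact measurable_const
  · exact measurable_const

theorem measurable_center (D : ℕ → ℕ → ℝ) (e f : ℝ) (n L j u : ℕ) :
    Measurable fun ω : ℕ → unitInterval => center D (ω 0) e f (priority n ω) n L j u := by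
  unfold center
  split_ifs
  · refine measurable_lastArgmin (fun k => ?_) (measurable_priority n) n n
    refine measurableSet_setOfPred.1 (measurableSet_le measurable_const ?_)
    exact ((measurable_subtype_coe.comp (measurable_pi_apply 0)).const_add 1).mul_const _
  · exact measurable_const

theorem measurable_clusterLabel (D : ℕ → ℕ → ℝ) (e f : ℝ) (n i u : ℕ) :
    Measurable fun ω : ℕ → unitInterval => clusterLabel D e f n ω i u := by
  unfold clusterLabel
  split_ifs
  · exact measurable_label (measurable_center D e f n _) n i u
  · exact measurable_const

theorem measurable_depth (D : ℕ → ℕ → ℝ) (e f : ℝ) (n : ℕ) (N : ℕ → ℕ) (u : ℕ) :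
    Measurable fun ω : Tape => depth D e f n N ω u := by
  have hl : ∀ i x, Measurable fun ω : Tape => clusterLabel D e f n ω.1 i x := fun i x =>
    (measurable_clusterLabel D e f n i x).comp measurable_fst
  refine measurable_activeLevels hl (fun j x => ?_) _ u
  refine measurableSet_setOfPred.1 (measurableSet_le measurable_const ?_)
  refine Measurable.add ?_ (Measurable.const_mul ?_ _)
  · refine (measurable_from_top (f := fun k : ℕ => (k : ℝ))).comp ?_
    unfold counts clusterCount
    split_ifs
    · refine Finset.measurable_sum _ fun v _ => ?_
      exact Measurable.ite (measurableSet_setOfPred.2 (measurable_eq_nat (hl _ _)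
        measurable_const)) measurable_const measurable_const
    · exact measurable_const
  · unfold noise
    split_ifs
    · exact (measurable_pi_apply _).comp measurable_snd
    · exact measurable_const

section Output

variable {n : ℕ} (d : Fin n → Fin n → ℝ) (e f : ℝ)

theorem measurable_finLabel (i : ℕ) (u : Fin n) :
    Measurable fun ω : ℕ → unitInterval => finLabel d e f ω i u :=
  measurable_clusterLabel _ e f n i u

theorem measurable_finCenter (j : ℕ) (u : Fin n) :
    Measurable fun ω : ℕ → unitInterval => finCenter d e f ω j u :=
  measurable_center _ e f n _ j u

theorem measurable_levelDist (L : ℕ) :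
    Measurable fun ω : ℕ → unitInterval => levelDist (finLabel d e f ω) L := by
  refine measurable_pi_lambda _ fun u => measurable_pi_lambda _ fun v => ?_
  refine (measurable_from_top (f := fun k : ℕ => (k : ℝ))).comp ?_
  refine Finset.measurable_sum _ fun j _ => ?_
  exact Measurable.ite (measurableSet_setOfPred.2 (measurable_eq_nat
    (measurable_finLabel d e f _ _) (measurable_finLabel d e f _ _)))
    measurable_const measurable_const

theorem measurable_finChosen (N : Fin n → ℕ) :
    Measurable fun ω : Tape => finChosen d e f N ω := by
  refine measurable_finset_iff.2 fun u => ?_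
  simp only [mem_finChosen]
  have hK : ∀ v : Fin n, Measurable fun ω : Tape => finDepth d e f N ω v := fun v =>
    measurable_depth _ e f n _ v
  have hl : ∀ v : Fin n, Measurable fun ω : Tape =>
      finLabel d e f ω.1 (finDepth d e f N ω u) v := fun v =>
    measurable_apply_nat (g := fun ω : Tape => fun i => finLabel d e f ω.1 i v)
      (fun i => (measurable_finLabel d e f i v).comp measurable_fst) (hK u)
  refine Measurable.forall fun v => Measurable.imp (measurable_eq_nat (hl v) (hl u)) ?_
  exact (measurableSet_setOfPred.1 (measurableSet_le (hK v) (hK u))).and measurable_const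

theorem measurable_output (L : ℕ) (N : Fin n → ℕ) : Measurable fun ω : Tape =>
    (finChosen d e f N ω, levelDist (finLabel d e f ω.1) L) :=
  (measurable_finChosen d e f N).prodMk ((measurable_levelDist d e f L).comp measurable_fst)

end Output

/-! ### Privacy -/

theorem activeLevels_congr {lab : ℕ → ℕ → ℕ} {mark mark' : ℕ → ℕ → Prop} {n L : ℕ}
    (hl : ∀ i u, lab i u < n)
    (h : ∀ j, 1 ≤ j → j < L → ∀ x < n, mark j x ↔ mark' j x) {i : ℕ} (hi : i ≤ L) (u : ℕ) :
    activeLevels lab mark i u = activeLevels lab mark' i u := by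
  induction i with
  | zero => rfl
  | succ i ih =>
    rw [activeLevels, activeLevels, ih (by omega)]
    congr 1
    simp only [eq_iff_iff]
    refine and_congr_right fun _ => imp_congr_right fun hi1 => ?_
    exact h i hi1 (by omega) _ (hl _ _)

/-- The shift of the noise that compensates a change of the numbers of clients. -/
def noiseShift (n : ℕ) (e : ℝ) (c c' : ℕ → ℕ → ℕ) (k : ℕ) : ℝ :=
  if 1 ≤ k / n then ((c (k / n) (k % n) : ℝ) - c' (k / n) (k % n)) / (2 ^ (k / n) / e) else 0

/-- The shift is the difference of the counts in units of the noise scale, so count plus scaled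
noise is unchanged. -/
theorem isMarked_shift {n L : ℕ} {H e : ℝ} (he : 0 < e) (c c' : ℕ → ℕ → ℕ) (ω : ℕ → ℝ)
    {A : Finset ℕ} (hA : ∀ j < L, ∀ x < n, j * n + x ∈ A) {j x : ℕ} (hj1 : 1 ≤ j) (hj : j < L)
    (hx : x < n) : IsMarked H e c (noise n L ω) j x ↔ IsMarked H e c'
      (noise n L fun k => if k ∈ A then ω k + noiseShift n e c c' k else ω k) j x := by
  have hn : 0 < n := by omega
  have h1 : (j * n + x) / n = j := by
    rw [mul_comm, Nat.mul_add_div hn, Nat.div_eq_of_lt hx, add_zero]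
  have h2 : (j * n + x) % n = x := by rw [Nat.mul_add_mod_self_right, Nat.mod_eq_of_lt hx]
  rw [IsMarked, IsMarked, noise, noise, if_pos ⟨hj, hx⟩, if_pos ⟨hj, hx⟩, if_pos (hA j hj x hx),
    noiseShift, h1, h2, if_pos hj1]
  have h3 : (2 : ℝ) ^ j / e ≠ 0 := by positivity
  rw [mul_add, mul_div_cancel₀ _ h3]
  constructor <;> intro h <;> linarith

/-- Each point lies in one cluster per level, so passing to cluster counts does not increase the
ℓ₁-distance. -/
theorem sum_abs_counts_le {lab : ℕ → ℕ → ℕ} {N N' : ℕ → ℕ} {n L j : ℕ} :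
    ∑ x ∈ Finset.range n, |(counts lab N n L j x : ℝ) - counts lab N' n L j x| ≤
      ∑ v ∈ Finset.range n, |(N v : ℝ) - N' v| := by
  classical
  have h1 : ∀ x, |(counts lab N n L j x : ℝ) - counts lab N' n L j x| ≤
      ∑ v ∈ Finset.range n, if lab (j + 1) v = x then |(N v : ℝ) - N' v| else 0 := by
    intro x
    rw [counts, counts]
    split_ifs
    · rw [clusterCount, clusterCount, Nat.cast_sum, Nat.cast_sum, ← Finset.sum_sub_distrib]
      refine (Finset.abs_sum_le_sum_abs _ _).trans (Finset.sum_le_sum fun v _ => ?_)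
      split_ifs <;> simp
    · rw [sub_self, abs_zero]
      exact Finset.sum_nonneg fun v _ => by split_ifs <;> positivity
  refine (Finset.sum_le_sum fun x _ => h1 x).trans ?_
  rw [Finset.sum_comm]
  refine Finset.sum_le_sum fun v _ => ?_
  rw [Finset.sum_ite_eq]
  split_ifs
  · exact le_rfl
  · positivity

/-- At level j ≥ 1 the shifts sum to at most e / 2 ^ j, and level 0 is never tested. The finite
geometric sum stays below e for every number of levels. -/
theorem sum_noiseShift_le {n L : ℕ} {e : ℝ} (he : 0 < e) {c c' : ℕ → ℕ → ℕ}
    (h : ∀ j, ∑ x ∈ Finset.range n, |(c j x : ℝ) - c' j x| ≤ 1) :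
    ∑ k ∈ (Finset.range L ×ˢ Finset.range n).image fun q => q.1 * n + q.2,
      |noiseShift n e c c' k| ≤ e := by
  have hdm : ∀ j x, x < n → (j * n + x) / n = j ∧ (j * n + x) % n = x := by
    intro j x hx
    refine ⟨?_, ?_⟩
    · rw [mul_comm, Nat.mul_add_div (by omega), Nat.div_eq_of_lt hx, add_zero]
    · rw [Nat.mul_add_mod_self_right, Nat.mod_eq_of_lt hx]
  rw [Finset.sum_image, Finset.sum_product]
  · have h1 : ∀ j ∈ Finset.range L, ∑ x ∈ Finset.range n, |noiseShift n e c c' (j * n + x)| ≤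
        if 1 ≤ j then e * (1 / 2) ^ j else 0 := by
      intro j _
      split_ifs with hj
      · calc ∑ x ∈ Finset.range n, |noiseShift n e c c' (j * n + x)|
            = ∑ x ∈ Finset.range n, |(c j x : ℝ) - c' j x| * (e * (1 / 2) ^ j) := by
              refine Finset.sum_congr rfl fun x hx => ?_
              obtain ⟨h1, h2⟩ := hdm j x (Finset.mem_range.1 hx)
              rw [noiseShift, h1, h2, if_pos hj, abs_div, abs_of_pos (a := (2 : ℝ) ^ j / e)
                (by positivity), one_div, inv_pow]
              have : (2 : ℝ) ^ j ≠ 0 := by positivity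
              field_simp
          _ ≤ 1 * (e * (1 / 2) ^ j) := by
              rw [← Finset.sum_mul]
              exact mul_le_mul_of_nonneg_right (h j) (by positivity)
          _ = e * (1 / 2) ^ j := one_mul _
      · refine (Finset.sum_eq_zero fun x hx => ?_).le
        obtain ⟨h1, h2⟩ := hdm j x (Finset.mem_range.1 hx)
        rw [noiseShift, h1, if_neg hj, abs_zero]
    refine (Finset.sum_le_sum h1).trans ?_
    have h2 : ∀ L : ℕ, ∑ j ∈ Finset.range (L + 1), (if 1 ≤ j then e * (1 / 2 : ℝ) ^ j else 0) =
        e - e * (1 / 2) ^ L := by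
      intro L
      induction L with
      | zero => simp
      | succ L ih =>
        rw [Finset.sum_range_succ, ih, if_pos (by omega), pow_succ]
        ring
    cases L with
    | zero => simpa using he.le
    | succ L =>
      rw [h2]
      have : 0 ≤ e * (1 / 2) ^ L := by positivity
      linarith
  · rintro ⟨j, x⟩ hq ⟨j', x'⟩ hq' heq
    simp only [Finset.coe_product, Set.mem_prod, Finset.mem_coe, Finset.mem_range] at hq hq' heq
    obtain ⟨h1, h2⟩ := hdm j x hq.2
    obtain ⟨h3, h4⟩ := hdm j' x' hq'.2
    rw [heq] at h1 h2
    rw [← h1, ← h2, h3, h4]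

theorem isDP_output {n : ℕ} (d : Fin n → Fin n → ℝ) {e ε : ℝ} (f : ℝ) (hn : 0 < n) (he : 0 < e)
    (heε : e ≤ ε) (M : ℕ) : IsDP ε fun N => tapeMeasure.map fun ω : Tape =>
      (finChosen d e f N ω, levelDist (finLabel d e f ω.1) M) := by
  intro N N' hN T hT
  simp only
  rw [Measure.map_apply (measurable_output d e f M N) hT,
    Measure.map_apply (measurable_output d e f M N') hT, tapeMeasure,
    Measure.prod_apply (measurable_output d e f M N hT),
    Measure.prod_apply (measurable_output d e f M N' hT),
    ← lintegral_const_mul' _ _ ENNReal.ofReal_ne_top]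
  -- With the uniform samples fixed, the clustering and the metric are the same for both client
  -- vectors. Only the chosen set reacts, and shifting the Laplace samples compensates this exactly.
  refine lintegral_mono fun ω₁ => ?_
  set L := numLevels (extend d) e f n with hL
  set lab := clusterLabel (extend d) e f n ω₁ with hlab
  set c := counts lab (extendNat N) n L with hc
  set c' := counts lab (extendNat N') n L with hc'
  set A := (Finset.range L ×ˢ Finset.range n).image fun q => q.1 * n + q.2 with hA
  have hlt : ∀ i u, lab i u < n := by
    intro i u
    rw [hlab, clusterLabel]
    split_ifs
    · exact label_lt _ hn _ _
    · exact hn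
  have hAm : ∀ j < L, ∀ x < n, j * n + x ∈ A := fun j hj x hx =>
    Finset.mem_image.2 ⟨(j, x), by simp [hj, hx], rfl⟩
  have hdep : ∀ ω₂ : ℕ → ℝ, finChosen d e f N (ω₁, ω₂) = finChosen d e f N'
      (ω₁, fun k => if k ∈ A then ω₂ k + noiseShift n e c c' k else ω₂ k) := by
    intro ω₂
    have h1 : depth (extend d) e f n (extendNat N) (ω₁, ω₂) = depth (extend d) e f n (extendNat N')
        (ω₁, fun k => if k ∈ A then ω₂ k + noiseShift n e c c' k else ω₂ k) := by
      funext u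
      exact activeLevels_congr hlt (fun j hj1 hj x hx =>
        isMarked_shift he c c' ω₂ hAm hj1 hj hx) le_rfl u
    rw [finChosen, finChosen, h1]
  have hset : (Prod.mk ω₁ ⁻¹' ((fun ω : Tape =>
      (finChosen d e f N ω, levelDist (finLabel d e f ω.1) M)) ⁻¹' T)) =
      {ω₂ : ℕ → ℝ | (fun k => if k ∈ A then ω₂ k + noiseShift n e c c' k else ω₂ k) ∈
        (Prod.mk ω₁ ⁻¹' ((fun ω : Tape =>
          (finChosen d e f N' ω, levelDist (finLabel d e f ω.1) M)) ⁻¹' T))} := by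
    ext ω₂
    simp only [Set.mem_preimage, Set.mem_ofPred_eq, hdep]
  rw [hset]
  refine (infinitePi_laplace_shift_le A _ (measurable_prodMk_left
    (measurable_output d e f M N' hT))).trans ?_
  refine mul_le_mul_left (ENNReal.ofReal_le_ofReal (Real.exp_le_exp.2 ?_)) _
  refine (sum_noiseShift_le he fun j => ?_).trans heε
  refine sum_abs_counts_le.trans (le_of_eq ?_)
  rw [Finset.sum_range]
  simp only [extendNat_coe]
  exact_mod_cast hN

/-! ### The probability that two points are separated -/

theorem one_le_harmonic {n : ℕ} (hn : 0 < n) : (1 : ℝ) ≤ harmonic n := by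
  have h : (1 : ℚ) ≤ harmonic n := by
    obtain ⟨k, rfl⟩ := Nat.exists_eq_succ_of_ne_zero hn.ne'
    rw [harmonic, Finset.sum_range_succ']
    have : (0 : ℚ) ≤ ∑ i ∈ Finset.range k, ((i + 1 + 1 : ℕ) : ℚ)⁻¹ :=
      Finset.sum_nonneg fun i _ => by positivity
    simpa using this
  exact_mod_cast h

/-- Insert the elements in increasing order of `D`: a new maximum has rank equal to the new size,
and old ranks can only grow. Ties only enlarge ranks. -/
theorem sum_inv_card_le_harmonic {ι : Type*} (D : ι → ℝ) (A : Finset ι) :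
    ∑ w ∈ A, ((A.filter fun x => D x ≤ D w).card : ℝ)⁻¹ ≤ (harmonic A.card : ℝ) := by
  classical
  induction A using Finset.induction_on_max_value D with
  | empty => simp
  | insert a s ha hmax ih =>
    rw [Finset.sum_insert ha, Finset.card_insert_of_notMem ha, harmonic_succ]
    have h1 : (insert a s).filter (fun x => D x ≤ D a) = insert a s :=
      Finset.filter_true_of_mem fun x hx => by
        rcases Finset.mem_insert.1 hx with rfl | hx
        · exact le_rfl
        · exact hmax x hx
    have h2 : ∑ w ∈ s, (((insert a s).filter fun x => D x ≤ D w).card : ℝ)⁻¹ ≤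
        ∑ w ∈ s, ((s.filter fun x => D x ≤ D w).card : ℝ)⁻¹ := by
      refine Finset.sum_le_sum fun w hw => ?_
      have h3 : 0 < (s.filter fun x => D x ≤ D w).card :=
        Finset.card_pos.2 ⟨w, Finset.mem_filter.2 ⟨hw, le_rfl⟩⟩
      have h4 := Finset.card_le_card
        (Finset.filter_subset_filter (fun x => D x ≤ D w) (Finset.subset_insert a s))
      gcongr
    rw [h1, Finset.card_insert_of_notMem ha]
    push_cast at *
    linarith

/-- Stating the bound with min r a lets the induction peel off the largest radius: either it is
below a and the whole series is at most 4 r / 3, or it contributes nothing. -/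
theorem sum_geometric_lt_le {r a : ℝ} (hr : 0 ≤ r) (ha : 0 ≤ a) (L : ℕ) :
    ∑ j ∈ Finset.range L, (if r / 4 ^ j < a then r / 4 ^ j else 0) ≤ 4 / 3 * min r a := by
  induction L generalizing r with
  | zero =>
    rw [Finset.range_zero, Finset.sum_empty]
    exact mul_nonneg (by norm_num) (le_min hr ha)
  | succ L ih =>
    rw [Finset.sum_range_succ']
    have h1 := ih (r := r / 4) (by positivity)
    have h2 : ∀ j : ℕ, r / 4 / 4 ^ j = r / 4 ^ (j + 1) := fun j => by
      rw [pow_succ, div_div, mul_comm]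
    simp only [h2] at h1
    rw [pow_zero, div_one]
    split_ifs with h
    · rw [min_eq_left h.le]
      have := min_le_left (r / 4) a
      linarith
    · rw [min_eq_right (not_lt.1 h)]
      have := min_le_right (r / 4) a
      linarith

/-- As 1 / 4 < 3 / 8, the annuli between 3 / 8 of a radius and the radius are disjoint, so at most
one of them contains a. -/
theorem sum_annuli_le {r a c : ℝ} (hr : 0 < r) (hc : 0 ≤ c) (L : ℕ) :
    ∑ j ∈ Finset.range L, (if 3 / 8 * (r / 4 ^ j) ≤ a ∧ a ≤ r / 4 ^ j then c else 0) ≤ c := by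
  rw [← Finset.sum_filter, Finset.sum_const, nsmul_eq_mul]
  refine mul_le_of_le_one_left hc ?_
  have key : ∀ j k : ℕ, 3 / 8 * (r / 4 ^ j) ≤ a → a ≤ r / 4 ^ k → k ≤ j := by
    intro j k h1 h2
    by_contra hjk
    obtain ⟨i, rfl⟩ := Nat.exists_eq_add_of_lt (not_le.1 hjk)
    have h3 : r / 4 ^ (j + i + 1) ≤ r / 4 ^ j / 4 := by
      rw [div_div, ← pow_succ]
      gcongr
      · norm_num
      · omega
    have h4 : 0 < r / 4 ^ j := by positivity
    linarith
  have h : ((Finset.range L).filter fun j => 3 / 8 * (r / 4 ^ j) ≤ a ∧ a ≤ r / 4 ^ j).card ≤ 1 :=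
    Finset.card_le_one.2 fun j hj k hk => by
      rw [Finset.mem_filter] at hj hk
      exact le_antisymm (key k j hk.2.1 hj.2.2) (key j k hj.2.1 hk.2.2)
  exact_mod_cast h

/-- The radius is affine in t with slope r / 2, so the admissible t fill an interval of length 2 (b
- a) / r. -/
theorem volume_between_le {a b r : ℝ} (hr : 0 < r) :
    (volume : Measure unitInterval) {t | a ≤ (1 + (t : ℝ)) / 2 * r ∧ (1 + (t : ℝ)) / 2 * r < b} ≤
      ENNReal.ofReal (2 * (b - a) / r) := by
  rw [unitInterval.volume_apply]
  refine (measure_mono (t := Set.Icc (2 * a / r - 1) (2 * b / r - 1)) ?_).trans_eq ?_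
  · rintro _ ⟨t, ⟨h1, h2⟩, rfl⟩
    constructor
    · rw [sub_le_iff_le_add, div_le_iff₀ hr]
      linarith
    · rw [le_sub_iff_add_le, le_div_iff₀ hr]
      linarith
  · rw [Real.volume_Icc]
    congr 1
    ring

section Separation

variable {n : ℕ} {d : Fin n → Fin n → ℝ} {e f : ℝ}

/-- The rank of `w` in the order of the distances to `{u, v}`. -/
def rank (d : Fin n → Fin n → ℝ) (u v w : Fin n) : ℕ :=
  (Finset.univ.filter fun x => min (d u x) (d v x) ≤ min (d u w) (d v w)).card

theorem rank_pos (d : Fin n → Fin n → ℝ) (u v w : Fin n) : 0 < rank d u v w :=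
  Finset.card_pos.2 ⟨w, Finset.mem_filter.2 ⟨Finset.mem_univ _, le_rfl⟩⟩

theorem measure_min_rank (d : Fin n → Fin n → ℝ) (u v w : Fin n) :
    (Measure.infinitePi fun _ : ℕ => (volume : Measure unitInterval))
      {ω | ∀ x : Fin n, min (d u x) (d v x) ≤ min (d u w) (d v w) → ω (w + 1) ≤ ω (x + 1)} =
      (rank d u v w : ℝ≥0∞)⁻¹ := by
  classical
  set A := (Finset.univ.filter fun x => min (d u x) (d v x) ≤ min (d u w) (d v w)).image
    fun x : Fin n => (x : ℕ) + 1 with hA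
  have h1 : A.card = rank d u v w := Finset.card_image_of_injective _ fun x y hxy => by
    simpa [Fin.ext_iff] using hxy
  have h2 : (w : ℕ) + 1 ∈ A := Finset.mem_image_of_mem _
    (Finset.mem_filter.2 ⟨Finset.mem_univ _, le_rfl⟩)
  rw [← h1, ← infinitePi_min_eq h2]
  congr 1
  ext ω
  simp only [hA, Set.mem_ofPred_eq, Finset.forall_mem_image, Finset.mem_filter, Finset.mem_univ,
    true_and]

theorem measure_finCenter_ne_le (hd : IsMetric d) {j : ℕ} (hef : 0 < e * f)
    (hj : j < numLevels (extend d) e f n) (u v : Fin n) :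
    (Measure.infinitePi fun _ : ℕ => (volume : Measure unitInterval))
      {ω | finCenter d e f ω j u ≠ finCenter d e f ω j v} ≤
      ∑ w, if min (d u w) (d v w) ≤ e * f / 4 ^ j ∧ e * f / 4 ^ j / 2 < max (d u w) (d v w) then
        ENNReal.ofReal (2 * d u v / (e * f / 4 ^ j)) * (rank d u v w : ℝ≥0∞)⁻¹ else 0 := by
  set r := e * f / 4 ^ j with hr
  have hr0 : 0 < r := by positivity
  set I : Fin n → Set unitInterval := fun w =>
    {t | min (d u w) (d v w) ≤ (1 + (t : ℝ)) / 2 * r ∧ (1 + (t : ℝ)) / 2 * r < max (d u w) (d v w)}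
    with hI
  set B : Fin n → Set (ℕ → unitInterval) := fun w =>
    {ω | ∀ x : Fin n, min (d u x) (d v x) ≤ min (d u w) (d v w) → ω (w + 1) ≤ ω (x + 1)} with hB
  have hIm : ∀ w, MeasurableSet (I w) := fun w =>
    have hg : Measurable fun t : unitInterval => (1 + (t : ℝ)) / 2 * r :=
      ((measurable_subtype_coe.const_add 1).div_const 2).mul_const r
    (measurableSet_le measurable_const hg).inter (measurableSet_lt hg measurable_const)
  have hBm : ∀ w, MeasurableSet (B w) := fun w => by
    refine measurableSet_setOfPred.2 (Measurable.forall fun x => Measurable.imp measurable_const ?_)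
    exact measurableSet_setOfPred.1
      (measurableSet_le (measurable_pi_apply _) (measurable_pi_apply _))
  have hsub : {ω | finCenter d e f ω j u ≠ finCenter d e f ω j v} ⊆
      ⋃ w, ({ω : ℕ → unitInterval | ω 0 ∈ I w} ∩ B w) := by
    intro ω hω
    -- If w lies in one of the balls, then so does every x at least as close to {u, v}. Hence the
    -- minimality of w over the union of the balls contains the event B w, which does not involve
    -- the scale.
    obtain ⟨w, hw, hx, hmin⟩ := exists_cut hj u.2 v.2 (inBall_self hd hef.le (ω 0) j u)
      (inBall_self hd hef.le (ω 0) j v) hω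
    have hball : ∀ y x : Fin n, InBall (extend d) (ω 0) e f j y x ↔
        d y x ≤ (1 + (ω 0 : ℝ)) / 2 * r := fun y x => by rw [inBall_iff, extend_coe]
    have hmem : min (d u ⟨w, hw⟩) (d v ⟨w, hw⟩) ≤ (1 + (ω 0 : ℝ)) / 2 * r ∧
        (1 + (ω 0 : ℝ)) / 2 * r < max (d u ⟨w, hw⟩) (d v ⟨w, hw⟩) := by
      have h1 := hball u ⟨w, hw⟩
      have h2 := hball v ⟨w, hw⟩
      simp only at h1 h2
      rw [h1, h2, not_le, not_le] at hx
      rw [min_le_iff, lt_max_iff]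
      tauto
    refine Set.mem_iUnion.2 ⟨⟨w, hw⟩, hmem, fun x hx => ?_⟩
    have h1 := hmin x x.2 (by
      rw [hball u x, hball v x, ← min_le_iff]
      exact hx.trans hmem.1)
    rw [priority, priority, if_pos hw, if_pos x.2] at h1
    exact h1
  refine (measure_mono hsub).trans ((measure_iUnion_le _).trans ?_)
  rw [tsum_fintype]
  refine Finset.sum_le_sum fun w _ => ?_
  -- The scale is sample 0 and the priorities are the samples w + 1, so the two events are
  -- independent.
  rw [infinitePi_inter_eq_mul _ 0 (hIm w) (hBm w), measure_min_rank]
  · split_ifs with h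
    · refine mul_le_mul_left ((volume_between_le hr0).trans (ENNReal.ofReal_le_ofReal ?_)) _
      have h1 := hd.triangle u v w
      have h2 := hd.triangle v u w
      rw [hd.symm v u] at h2
      have h3 : max (d u w) (d v w) - min (d u w) (d v w) ≤ d u v := by
        rw [max_sub_min_eq_abs, abs_le]
        constructor <;> linarith
      gcongr
    · have hempty : I w = ∅ := by
        refine Set.eq_empty_of_forall_notMem fun t ht => h ⟨ht.1.trans ?_, lt_of_le_of_lt ?_ ht.2⟩
        · exact mul_le_of_le_one_left hr0.le (by linarith [t.2.2])
        · have := mul_nonneg t.2.1 hr0.le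
          linarith
      rw [hempty, measure_empty, zero_mul]
  · intro ω x
    simp only [hB, Set.mem_ofPred_eq]
    simp

/-- The sum of the radii of the levels at which `u` and `v` have different centers. -/
def separation (d : Fin n → Fin n → ℝ) (e f : ℝ) (u v : Fin n) (ω : ℕ → unitInterval) : ℝ :=
  open Classical in
  ∑ j ∈ Finset.range (numLevels (extend d) e f n),
    if finCenter d e f ω j u ≠ finCenter d e f ω j v then e * f / 4 ^ j else 0

theorem separation_nonneg (hef : 0 ≤ e * f) (u v : Fin n) (ω : ℕ → unitInterval) :
    0 ≤ separation d e f u v ω :=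
  Finset.sum_nonneg fun j _ => by split_ifs <;> positivity

/-- Clusters split at level j + 1 because the centers differ at some level i ≤ j, whose radius is no
smaller. -/
theorem le_separation (hef : 0 ≤ e * f) {u v : Fin n} {ω : ℕ → unitInterval} {j : ℕ}
    (hj : j < numLevels (extend d) e f n)
    (h : finLabel d e f ω (j + 1) u ≠ finLabel d e f ω (j + 1) v) :
    e * f / 4 ^ j ≤ separation d e f u v ω := by
  classical
  obtain ⟨i, hi, hne⟩ := exists_finCenter_ne ω (by omega) h
  have h1 : e * f / 4 ^ i ≤ separation d e f u v ω := by
    have := Finset.single_le_sum (s := Finset.range (numLevels (extend d) e f n))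
      (f := fun j => if finCenter d e f ω j u ≠ finCenter d e f ω j v then e * f / 4 ^ j else 0)
      (fun j _ => by split_ifs <;> positivity)
      (Finset.mem_range.2 (show i < _ by omega))
    rw [if_pos hne] at this
    exact this
  refine le_trans ?_ h1
  gcongr
  · norm_num
  · omega

theorem measurable_separation (u v : Fin n) : Measurable (separation d e f u v) := by
  refine Finset.measurable_sum _ fun j _ => ?_
  refine Measurable.ite (measurableSet_setOfPred.2 (Measurable.not (measurable_eq_nat
    (measurable_finCenter d e f j u) (measurable_finCenter d e f j v)))) measurable_const
    measurable_const

theorem radius_mul_measure_le (hd : IsMetric d) {j : ℕ} (hef : 0 < e * f)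
    (hj : j < numLevels (extend d) e f n) (u v : Fin n) :
    ENNReal.ofReal (e * f / 4 ^ j) *
      (Measure.infinitePi fun _ : ℕ => (volume : Measure unitInterval))
        {ω | finCenter d e f ω j u ≠ finCenter d e f ω j v} ≤
      ENNReal.ofReal ((if e * f / 4 ^ j < 8 * d u v then e * f / 4 ^ j else 0) +
        ∑ w, if 3 / 8 * (e * f / 4 ^ j) ≤ min (d u w) (d v w) ∧
          min (d u w) (d v w) ≤ e * f / 4 ^ j then 2 * d u v * (rank d u v w : ℝ)⁻¹ else 0) := by
  set r := e * f / 4 ^ j with hr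
  have hr0 : 0 < r := by positivity
  have hduv := hd.nonneg u v
  have hterm : ∀ w, 0 ≤ if 3 / 8 * r ≤ min (d u w) (d v w) ∧
          min (d u w) (d v w) ≤ r then 2 * d u v * (rank d u v w : ℝ)⁻¹ else 0 := fun w => by
    split_ifs <;> positivity
  -- Radii below 8 d(u, v) are summed geometrically with probability at most 1. For the others, max
  -- > r / 2 and max - min ≤ d(u, v) ≤ r / 8 give min ≥ 3 r / 8, an annulus.
  by_cases h8 : r < 8 * d u v
  · rw [if_pos h8]
    refine (mul_le_of_le_one_right zero_le prob_le_one).trans (ENNReal.ofReal_le_ofReal ?_)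
    exact le_add_of_nonneg_right (Finset.sum_nonneg fun w _ => hterm w)
  · rw [if_neg h8, zero_add, ENNReal.ofReal_sum_of_nonneg fun w _ => hterm w]
    refine (mul_le_mul_right (measure_finCenter_ne_le hd hef hj u v) _).trans ?_
    rw [Finset.mul_sum]
    refine Finset.sum_le_sum fun w _ => ?_
    rw [← hr]
    split_ifs with h1 h2 h2
    · have hrank : (0 : ℝ) < rank d u v w := by exact_mod_cast rank_pos d u v w
      rw [← ENNReal.ofReal_natCast, ← ENNReal.ofReal_inv_of_pos hrank,
        ← ENNReal.ofReal_mul (by positivity), ← ENNReal.ofReal_mul hr0.le]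
      refine ENNReal.ofReal_le_ofReal (le_of_eq ?_)
      field_simp
    · refine absurd ⟨?_, h1.1⟩ h2
      have h3 := hd.triangle u v w
      have h4 := hd.triangle v u w
      rw [hd.symm v u] at h4
      have h5 : max (d u w) (d v w) - min (d u w) (d v w) ≤ d u v := by
        rw [max_sub_min_eq_abs, abs_le]
        constructor <;> linarith
      linarith [h1.2]
    · rw [mul_zero]; exact zero_le
    · rw [mul_zero]; exact zero_le

/-- The clustering preserves distances in expectation up to a logarithmic factor. -/
theorem lintegral_separation_le (hd : IsMetric d) (hef : 0 ≤ e * f) (u v : Fin n) :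
    ∫⁻ ω, ENNReal.ofReal (separation d e f u v ω)
        ∂(Measure.infinitePi fun _ : ℕ => (volume : Measure unitInterval)) ≤
      ENNReal.ofReal (13 * harmonic n * d u v) := by
  classical
  rcases hef.eq_or_lt with h0 | hef
  · have : ∀ ω, separation d e f u v ω = 0 := fun ω =>
      Finset.sum_eq_zero fun j _ => by rw [← h0, zero_div, ite_self]
    simp [this]
  have hduv := hd.nonneg u v
  set L := numLevels (extend d) e f n with hL
  have hm : ∀ j, MeasurableSet {ω | finCenter d e f ω j u ≠ finCenter d e f ω j v} := fun j =>
    measurableSet_setOfPred.2 (Measurable.not (measurable_eq_nat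
      (measurable_finCenter d e f j u) (measurable_finCenter d e f j v)))
  have h1 : ∀ ω, ENNReal.ofReal (separation d e f u v ω) = ∑ j ∈ Finset.range L,
      {ω | finCenter d e f ω j u ≠ finCenter d e f ω j v}.indicator
        (fun _ => ENNReal.ofReal (e * f / 4 ^ j)) ω := by
    intro ω
    rw [separation, ENNReal.ofReal_sum_of_nonneg fun j _ => by split_ifs <;> positivity]
    refine Finset.sum_congr rfl fun j _ => ?_
    rw [Set.indicator_apply]
    by_cases h : finCenter d e f ω j u = finCenter d e f ω j v <;> simp [h]
  simp_rw [h1]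
  rw [lintegral_finsetSum _ fun j _ => measurable_const.indicator (hm j)]
  simp_rw [lintegral_indicator_const (hm _)]
  refine (Finset.sum_le_sum fun j hj =>
    radius_mul_measure_le hd hef (Finset.mem_range.1 hj) u v).trans ?_
  have hterm : ∀ j, ∀ w, 0 ≤ if 3 / 8 * (e * f / 4 ^ j) ≤ min (d u w) (d v w) ∧
      min (d u w) (d v w) ≤ e * f / 4 ^ j then 2 * d u v * (rank d u v w : ℝ)⁻¹ else 0 :=
    fun j w => by split_ifs <;> positivity
  rw [← ENNReal.ofReal_sum_of_nonneg fun j _ => add_nonneg (by split_ifs <;> positivity)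
    (Finset.sum_nonneg fun w _ => hterm j w)]
  refine ENNReal.ofReal_le_ofReal ?_
  rw [Finset.sum_add_distrib, Finset.sum_comm]
  -- The small radii contribute 4 / 3 · 8 = 32 / 3 times d(u, v) and the annuli 2 H times d(u, v).
  -- With H ≥ 1 the total is at most 13 H d(u, v).
  have h2 := (sum_geometric_lt_le hef.le (a := 8 * d u v) (by positivity) L).trans
    (mul_le_mul_of_nonneg_left (min_le_right _ _) (by norm_num))
  have h3 : ∑ w, ∑ j ∈ Finset.range L, (if 3 / 8 * (e * f / 4 ^ j) ≤ min (d u w) (d v w) ∧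
      min (d u w) (d v w) ≤ e * f / 4 ^ j then 2 * d u v * (rank d u v w : ℝ)⁻¹ else 0) ≤
      2 * d u v * harmonic n := by
    refine (Finset.sum_le_sum fun w _ => sum_annuli_le hef (by positivity) L).trans ?_
    rw [← Finset.mul_sum]
    refine mul_le_mul_of_nonneg_left ?_ (by positivity)
    have := sum_inv_card_le_harmonic (fun x => min (d u x) (d v x)) Finset.univ
    rwa [Finset.card_univ, Fintype.card_fin] at this
  have h4 := one_le_harmonic u.pos
  have h5 := mul_le_mul_of_nonneg_right h4 hduv
  linarith

end Separation

/-! ### The expected cost -/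

section Noise

theorem lintegral_abs_noise_le (n L j x : ℕ) :
    ∫⁻ ω, ENNReal.ofReal |noise n L ω j x| ∂(Measure.infinitePi fun _ : ℕ => laplace) ≤ 1 := by
  unfold noise
  split_ifs
  · have h := (measurePreserving_eval_infinitePi (fun _ : ℕ => laplace) (j * n + x)).lintegral_comp
      (f := fun x => ENNReal.ofReal |x|) (by fun_prop)
    rw [lintegral_abs_laplace] at h
    exact h.le
  · simp

theorem measurable_noise (n L j x : ℕ) : Measurable fun ω : ℕ → ℝ => noise n L ω j x := by
  unfold noise
  split_ifs
  · exact measurable_pi_apply _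
  · exact measurable_const

theorem measure_le_noise_le {n L j x : ℕ} (hj : j < L) (hx : x < n) {a : ℝ} (ha : 0 ≤ a) :
    (Measure.infinitePi fun _ : ℕ => laplace) {ω | a ≤ noise n L ω j x} ≤
      ENNReal.ofReal (Real.exp (-a)) := by
  have h := (measurePreserving_eval_infinitePi (fun _ : ℕ => laplace) (j * n + x)).measure_preimage
    (measurableSet_Ici (a := a)).nullMeasurableSet
  refine le_trans (le_of_eq ?_) (laplace_Ici_le ha)
  rw [← h]
  congr 1
  ext ω
  simp [noise, hj, hx]

theorem sum_range_half_pow_le (L : ℕ) :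
    ∑ j ∈ Finset.range L, (if 1 ≤ j then (1 / 2 : ℝ) ^ j else 0) ≤ 1 ∧
      ∑ j ∈ Finset.range L, (1 / 2 : ℝ) ^ j ≤ 2 := by
  have h1 : ∑ j ∈ Finset.range L, (1 / 2 : ℝ) ^ j = 2 - 2 * (1 / 2) ^ L := by
    rw [geom_sum_eq (by norm_num)]
    ring
  have h2 : (0 : ℝ) < (1 / 2) ^ L := by positivity
  refine ⟨?_, by linarith⟩
  cases L with
  | zero => simp
  | succ L =>
    rw [Finset.sum_range_succ'] at h1 ⊢
    simp only [Nat.le_add_left, if_true, pow_zero, nonpos_iff_eq_zero, one_ne_zero, if_false,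
      add_zero] at h1 ⊢
    linarith

/-- There are n labels per level, and at level j ≥ 1 each gives a false mark with probability at
most exp (-2 H 2 ^ j) ≤ exp (-H) / 2 ^ j. Since H ≥ log n, level j contributes at most 2 ^ (-j). -/
theorem lintegral_card_falseMarks_le {n : ℕ} (hn : 0 < n) (L : ℕ) :
    ∫⁻ ω, ((falseMarks n L (harmonic n) (noise n L ω)).card : ℝ≥0∞)
      ∂(Measure.infinitePi fun _ : ℕ => laplace) ≤ 1 := by
  classical
  set H : ℝ := ((harmonic n : ℚ) : ℝ) with hH
  have hH1 : 1 ≤ H := one_le_harmonic hn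
  have hHn : n * Real.exp (-H) ≤ 1 := by
    have h1 : Real.log n ≤ H := (Real.log_le_log (by positivity)
      (by exact_mod_cast n.le_succ)).trans (log_add_one_le_harmonic n)
    rw [Real.exp_neg, ← div_eq_mul_inv, div_le_one (Real.exp_pos _)]
    exact (Real.log_le_iff_le_exp (by positivity)).1 h1
  have hcard : ∀ ω : ℕ → ℝ, ((falseMarks n L H (noise n L ω)).card : ℝ≥0∞) =
      ∑ q ∈ Finset.range L ×ˢ Finset.range n,
        {ω | 1 ≤ q.1 ∧ 2 * H * 2 ^ q.1 ≤ noise n L ω q.1 q.2}.indicator 1 ω := by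
    intro ω
    rw [falseMarks, Finset.card_filter]
    push_cast
    refine Finset.sum_congr rfl fun q _ => ?_
    rw [Set.indicator_apply]
    rfl
  have hm : ∀ q : ℕ × ℕ,
      MeasurableSet {ω : ℕ → ℝ | 1 ≤ q.1 ∧ 2 * H * 2 ^ q.1 ≤ noise n L ω q.1 q.2} := fun q =>
    (MeasurableSet.const _).inter (measurableSet_le measurable_const (measurable_noise n L _ _))
  simp_rw [hcard]
  rw [lintegral_finsetSum _ fun q _ => measurable_one.indicator (hm q)]
  simp_rw [lintegral_indicator_one (hm _)]
  have hterm : ∀ q ∈ Finset.range L ×ˢ Finset.range n,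
      (Measure.infinitePi fun _ : ℕ => laplace)
        {ω | 1 ≤ q.1 ∧ 2 * H * 2 ^ q.1 ≤ noise n L ω q.1 q.2} ≤
      ENNReal.ofReal (if 1 ≤ q.1 then Real.exp (-H) * (1 / 2) ^ q.1 else 0) := by
    rintro ⟨j, x⟩ hq
    rw [Finset.mem_product, Finset.mem_range, Finset.mem_range] at hq
    dsimp only at hq ⊢
    split_ifs with hj
    · refine (measure_mono fun ω hω => hω.2).trans
        ((measure_le_noise_le hq.1 hq.2 (by positivity)).trans (ENNReal.ofReal_le_ofReal ?_))
      have h1 : (j : ℝ) + 1 ≤ 2 ^ j := by exact_mod_cast Nat.lt_two_pow_self (n := j)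
      have h2 : (1 / 2 : ℝ) ^ j ≥ Real.exp (-1) ^ j := by
        refine pow_le_pow_left₀ (Real.exp_pos _).le ?_ j
        rw [Real.exp_neg, one_div]
        exact inv_anti₀ (by norm_num) (by linarith [Real.add_one_le_exp (1 : ℝ)])
      rw [← Real.exp_nat_mul] at h2
      refine le_trans ?_ (mul_le_mul_of_nonneg_left h2 (Real.exp_pos _).le)
      rw [← Real.exp_add]
      refine Real.exp_le_exp.2 ?_
      have h3 : H * ((j : ℝ) + 1) ≤ H * 2 ^ j := mul_le_mul_of_nonneg_left h1 (by linarith)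
      have h4 : (j : ℝ) ≤ H * j := le_mul_of_one_le_left (Nat.cast_nonneg j) hH1
      have h5 : 0 ≤ H * 2 ^ j := by positivity
      linarith
    · simp [hj]
  refine (Finset.sum_le_sum hterm).trans ?_
  rw [← ENNReal.ofReal_sum_of_nonneg fun q _ => by split_ifs <;> positivity, ← ENNReal.ofReal_one,
    Finset.sum_product]
  refine ENNReal.ofReal_le_ofReal ?_
  simp only [Finset.sum_const, Finset.card_range, nsmul_eq_mul]
  calc ∑ j ∈ Finset.range L, (n : ℝ) * (if 1 ≤ j then Real.exp (-H) * (1 / 2) ^ j else 0)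
      = (n * Real.exp (-H)) * ∑ j ∈ Finset.range L, (if 1 ≤ j then (1 / 2 : ℝ) ^ j else 0) := by
        rw [Finset.mul_sum]
        refine Finset.sum_congr rfl fun j _ => ?_
        split_ifs
        · ring
        · simp
    _ ≤ 1 * 1 := mul_le_mul hHn (sum_range_half_pow_le L).1
        (Finset.sum_nonneg fun j _ => by split_ifs <;> positivity) zero_le_one
    _ = 1 := one_mul 1

end Noise

/-! ### Expectation over the noise, then over the clustering. -/

section Cost

variable {n : ℕ} {d : Fin n → Fin n → ℝ} {e f : ℝ}

theorem one_le_numLevels (D : ℕ → ℕ → ℝ) (e f : ℝ) (n : ℕ) : 1 ≤ numLevels D e f n :=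
  Nat.le_add_left 1 _

theorem isChosenSet_finChosen (N : Fin n → ℕ) (ω : Tape) :
    IsChosenSet (finLabel d e f ω.1) (finDepth d e f N ω) (finChosen d e f N ω) :=
  mem_finChosen N ω

theorem connectedCost_eq_ofReal (hd : IsMetric d) (hf : 0 ≤ f) (N : Fin n → ℕ)
    (ρ : Fin n → Fin n → ℝ) (R : Finset (Fin n)) :
    connectedCost d f N ρ R = ENNReal.ofReal
      ((opened ρ R N).card * f + ∑ v, (N v : ℝ) * d v (connect ρ R v)) := by
  have h : ∀ v, 0 ≤ (N v : ℝ) * d v (connect ρ R v) := fun v =>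
    mul_nonneg (Nat.cast_nonneg _) (hd.nonneg _ _)
  rw [ENNReal.ofReal_add (by positivity) (Finset.sum_nonneg fun v _ => h v),
    ENNReal.ofReal_sum_of_nonneg fun v _ => h v, connectedCost,
    ENNReal.ofReal_mul (Nat.cast_nonneg _), ENNReal.ofReal_natCast]
  congr 1
  refine Finset.sum_congr rfl fun v _ => ?_
  rw [ENNReal.ofReal_mul (Nat.cast_nonneg _), ENNReal.ofReal_natCast]

theorem cost_opened_le_connectedCost (d : Fin n → Fin n → ℝ) (f : ℝ) (N : Fin n → ℕ)
    (ρ : Fin n → Fin n → ℝ) (R : Finset (Fin n)) :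
    cost d f N (opened ρ R N) ≤ connectedCost d f N ρ R := by
  refine add_le_add le_rfl (Finset.sum_le_sum fun v _ => ?_)
  rcases Nat.eq_zero_or_pos (N v) with h | h
  · simp [h]
  · refine mul_le_mul_right (iInf₂_le _ ?_) _
    exact Finset.mem_image_of_mem _ (Finset.mem_filter.2 ⟨Finset.mem_univ _, h⟩)

/-- The expected cost for a fixed hierarchy. -/
theorem lintegral_connectedCost_le_of_clustering (hd : IsMetric d) (hn : 0 < n) (he : 0 < e)
    (he1 : e ≤ 1) (hf : 0 ≤ f) (N : Fin n → ℕ) {S : Finset (Fin n)} {near : Fin n → Fin n}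
    (hnear : ∀ v, near v ∈ S) (ω : ℕ → unitInterval) :
    ∫⁻ ω', connectedCost d f N (levelDist (finLabel d e f ω) (numLevels (extend d) e f n))
        (finChosen d e f N (ω, ω')) ∂(Measure.infinitePi fun _ : ℕ => laplace) ≤
      ENNReal.ofReal (50 * harmonic n * (S.card * f) +
        9 * e⁻¹ * ∑ v, (N v : ℝ) * separation d e f v (near v) ω) := by
  set L := numLevels (extend d) e f n with hL
  set H : ℝ := ((harmonic n : ℚ) : ℝ) with hH
  have hH1 : 1 ≤ H := one_le_harmonic hn
  have hef : 0 ≤ e * f := by positivity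
  have hS : (1 : ℝ) ≤ S.card := by
    exact_mod_cast Finset.card_pos.2 ⟨near ⟨0, hn⟩, hnear ⟨0, hn⟩⟩
  set T : Fin n → ℝ := fun v => separation d e f v (near v) ω with hT
  have hT0 : ∀ v, 0 ≤ T v := fun v => separation_nonneg hef _ _ _
  have hTle : ∀ v, ∀ j < L, (∀ s ∈ S, finLabel d e f ω (j + 1) v ≠ finLabel d e f ω (j + 1) s) →
      e * f / 4 ^ j ≤ T v := fun v j hj h => le_separation hef hj (h _ (hnear v))
  set W := ∑ v, (N v : ℝ) * T v with hW
  have hW0 : 0 ≤ W := Finset.sum_nonneg fun v _ => mul_nonneg (Nat.cast_nonneg _) (hT0 v)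
  have he1' : 1 ≤ e⁻¹ := (one_le_inv₀ he).2 he1
  have hhier := isHierarchy_finLabel hd hef ω
  -- The sum of the two deterministic bounds. The noise appears only in the number of false marks
  -- and in absolute values at labels fixed by the clustering.
  have hpt : ∀ ω', connectedCost d f N (levelDist (finLabel d e f ω) L)
      (finChosen d e f N (ω, ω')) ≤
      ENNReal.ofReal (S.card * f + e⁻¹ * W + 8 * W + 32 * H * (S.card * f)) +
        (((falseMarks n L H (noise n L ω')).card : ℝ≥0∞) * ENNReal.ofReal f +
        ∑ s ∈ S, ∑ j ∈ Finset.range L, ENNReal.ofReal (8 * f * (1 / 2) ^ j) *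
          ENNReal.ofReal |noise n L ω' j (finLabel d e f ω (j + 1) s)|) := by
    intro ω'
    have h1 := connection_le (d := d) (S := S) (T := T) hhier (one_le_numLevels _ _ _ _)
      (isDepth_finDepth N (ω, ω')) (isChosenSet_finChosen N (ω, ω'))
      (fun u => (hd.eq_zero_iff u u).2 rfl) he hf (by linarith)
      (fun j hj u v => diam_finLabel hd hef ω hj) hT0 hTle
    have h2 := facilities_le (S := S) (T := T) hhier (one_le_numLevels _ _ _ _)
      (isDepth_finDepth N (ω, ω')) (isChosenSet_finChosen N (ω, ω')) he he1 hf hH1 hT0 hTle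
    have h3 : ∀ s, ∀ j, 0 ≤ 8 * f * (1 / 2) ^ j * |noise n L ω' j (finLabel d e f ω (j + 1) s)| :=
      fun s j => by positivity
    have h4 : ∑ s ∈ S, ∑ j ∈ Finset.range L, ENNReal.ofReal (8 * f * (1 / 2) ^ j) *
        ENNReal.ofReal |noise n L ω' j (finLabel d e f ω (j + 1) s)| =
        ENNReal.ofReal (∑ s ∈ S, ∑ j ∈ Finset.range L,
          8 * f * (1 / 2) ^ j * |noise n L ω' j (finLabel d e f ω (j + 1) s)|) := by
      rw [ENNReal.ofReal_sum_of_nonneg fun s _ => Finset.sum_nonneg fun j _ => h3 s j]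
      refine Finset.sum_congr rfl fun s _ => ?_
      rw [ENNReal.ofReal_sum_of_nonneg fun j _ => h3 s j]
      exact Finset.sum_congr rfl fun j _ => (ENNReal.ofReal_mul (by positivity)).symm
    rw [h4, ← ENNReal.ofReal_natCast, ← ENNReal.ofReal_mul (Nat.cast_nonneg _),
      ← ENNReal.ofReal_add (by positivity)
        (Finset.sum_nonneg fun s _ => Finset.sum_nonneg fun j _ => h3 s j),
      ← ENNReal.ofReal_add (by positivity) (add_nonneg (by positivity)
        (Finset.sum_nonneg fun s _ => Finset.sum_nonneg fun j _ => h3 s j)),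
      connectedCost_eq_ofReal hd hf]
    refine ENNReal.ofReal_le_ofReal ?_
    have h5 : 8 * ∑ s ∈ S, (4 * H * f + f * ∑ j ∈ Finset.range L,
        (1 / 2) ^ j * |noise n L ω' j (finLabel d e f ω (j + 1) s)|) =
        32 * H * (S.card * f) + ∑ s ∈ S, ∑ j ∈ Finset.range L,
          8 * f * (1 / 2) ^ j * |noise n L ω' j (finLabel d e f ω (j + 1) s)| := by
      rw [Finset.sum_add_distrib, Finset.sum_const, nsmul_eq_mul, mul_add, Finset.mul_sum]
      congr 1
      · ring
      · refine Finset.sum_congr rfl fun s _ => ?_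
        rw [Finset.mul_sum, Finset.mul_sum]
        exact Finset.sum_congr rfl fun j _ => by ring
    linarith
  refine (lintegral_mono hpt).trans ?_
  have hmY : ∀ j x, Measurable fun ω' : ℕ → ℝ => ENNReal.ofReal |noise n L ω' j x| := fun j x =>
    ENNReal.measurable_ofReal.comp (measurable_norm.comp (measurable_noise n L j x))
  have hmS : Measurable fun ω' : ℕ → ℝ => ∑ s ∈ S, ∑ j ∈ Finset.range L,
      ENNReal.ofReal (8 * f * (1 / 2) ^ j) *
        ENNReal.ofReal |noise n L ω' j (finLabel d e f ω (j + 1) s)| :=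
    Finset.measurable_sum _ fun s _ => Finset.measurable_sum _ fun j _ => (hmY _ _).const_mul _
  rw [lintegral_add_left measurable_const, lintegral_const, measure_univ, mul_one,
    lintegral_add_right _ hmS, lintegral_mul_const' _ _ ENNReal.ofReal_ne_top,
    lintegral_finsetSum _ fun s _ => Finset.measurable_sum _ fun j _ => (hmY _ _).const_mul _]
  simp_rw [lintegral_finsetSum _ fun j _ => (hmY j _).const_mul _,
    lintegral_const_mul' _ _ ENNReal.ofReal_ne_top]
  have hsum : ∑ s ∈ S, ∑ j ∈ Finset.range L, ENNReal.ofReal (8 * f * (1 / 2) ^ j) *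
      ∫⁻ ω', ENNReal.ofReal |noise n L ω' j (finLabel d e f ω (j + 1) s)|
        ∂(Measure.infinitePi fun _ : ℕ => laplace) ≤ ENNReal.ofReal (16 * (S.card * f)) := by
    have h1 : ∀ s ∈ S, ∑ j ∈ Finset.range L, ENNReal.ofReal (8 * f * (1 / 2) ^ j) *
        ∫⁻ ω', ENNReal.ofReal |noise n L ω' j (finLabel d e f ω (j + 1) s)|
          ∂(Measure.infinitePi fun _ : ℕ => laplace) ≤ ENNReal.ofReal (16 * f) := by
      intro s _
      refine (Finset.sum_le_sum fun j _ =>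
        mul_le_of_le_one_right zero_le (lintegral_abs_noise_le n L j _)).trans ?_
      rw [← ENNReal.ofReal_sum_of_nonneg fun j _ => by positivity, ← Finset.mul_sum]
      refine ENNReal.ofReal_le_ofReal ?_
      have := mul_le_mul_of_nonneg_left (sum_range_half_pow_le L).2
        (show 0 ≤ 8 * f by positivity)
      linarith
    refine (Finset.sum_le_sum h1).trans (le_of_eq ?_)
    rw [Finset.sum_const, nsmul_eq_mul, ← ENNReal.ofReal_natCast,
      ← ENNReal.ofReal_mul (Nat.cast_nonneg _)]
    congr 1
    ring
  refine (add_le_add le_rfl (add_le_add (mul_le_of_le_one_left zero_le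
    (lintegral_card_falseMarks_le hn L)) hsum)).trans ?_
  rw [← ENNReal.ofReal_add hf (by positivity),
    ← ENNReal.ofReal_add (by positivity) (by positivity)]
  refine ENNReal.ofReal_le_ofReal ?_
  -- The coefficient 50 is 1 + 32 + 1 + 16: facilities of S, thresholds, false marks (using that S
  -- is nonempty) and noise. The coefficient 9 is 1 + 8.
  have h1 : f ≤ S.card * f := le_mul_of_one_le_left hf hS
  have h2 : (S.card : ℝ) * f ≤ H * (S.card * f) := le_mul_of_one_le_left (by positivity) hH1
  have h3 : W ≤ e⁻¹ * W := le_mul_of_one_le_left hW0 he1'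
  linarith

theorem exists_distTo_eq (d : Fin n → Fin n → ℝ) {S : Finset (Fin n)} (hS : S.Nonempty)
    (v : Fin n) : ∃ s ∈ S, distTo d v S = ENNReal.ofReal (d v s) := by
  obtain ⟨s, hs, hmin⟩ := S.exists_min_image (fun s => ENNReal.ofReal (d v s)) hS
  exact ⟨s, hs, le_antisymm (iInf₂_le s hs) (le_iInf₂ hmin)⟩

theorem lintegral_connectedCost_le_cost (hd : IsMetric d) (hn : 0 < n) (he : 0 < e)
    (he1 : e ≤ 1) (hf : 0 ≤ f) (N : Fin n → ℕ) {S : Finset (Fin n)} (hS : S.Nonempty) :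
    ∫⁻ ω, connectedCost d f N (levelDist (finLabel d e f ω.1) (numLevels (extend d) e f n))
        (finChosen d e f N ω) ∂tapeMeasure ≤
      ENNReal.ofReal (117 * harmonic n * e⁻¹) * cost d f N S := by
  choose near hnear hdist using exists_distTo_eq d hS
  have hH1 : (1 : ℝ) ≤ harmonic n := one_le_harmonic hn
  have he1' : 1 ≤ e⁻¹ := (one_le_inv₀ he).2 he1
  have hef : 0 ≤ e * f := by positivity
  -- This direction of Tonelli needs no measurability of the integrand.
  refine (lintegral_prod_le _).trans ((lintegral_mono fun ω =>
    lintegral_connectedCost_le_of_clustering hd hn he he1 hf N hnear ω).trans ?_)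
  have hterm : ∀ ω, ∀ v, 0 ≤ (N v : ℝ) * separation d e f v (near v) ω := fun ω v =>
    mul_nonneg (Nat.cast_nonneg _) (separation_nonneg hef _ _ _)
  have hsplit : ∀ ω, ENNReal.ofReal (50 * harmonic n * (S.card * f) +
      9 * e⁻¹ * ∑ v, (N v : ℝ) * separation d e f v (near v) ω) =
      ENNReal.ofReal (50 * harmonic n * (S.card * f)) + ENNReal.ofReal (9 * e⁻¹) *
        ∑ v, (N v : ℝ≥0∞) * ENNReal.ofReal (separation d e f v (near v) ω) := by
    intro ω
    rw [ENNReal.ofReal_add (by positivity)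
      (mul_nonneg (by positivity) (Finset.sum_nonneg fun v _ => hterm ω v)),
      ENNReal.ofReal_mul (p := 9 * e⁻¹) (by positivity),
      ENNReal.ofReal_sum_of_nonneg fun v _ => hterm ω v]
    simp_rw [ENNReal.ofReal_mul (Nat.cast_nonneg _), ENNReal.ofReal_natCast]
  have hm : ∀ v, Measurable fun ω => ENNReal.ofReal (separation d e f v (near v) ω) := fun v =>
    ENNReal.measurable_ofReal.comp (measurable_separation _ _)
  simp_rw [hsplit]
  rw [lintegral_add_left measurable_const, lintegral_const, measure_univ, mul_one,
    lintegral_const_mul' _ _ ENNReal.ofReal_ne_top,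
    lintegral_finsetSum _ fun v _ => (hm v).const_mul _]
  simp_rw [lintegral_const_mul' _ _ (ENNReal.natCast_ne_top _)]
  rw [cost, mul_add, Finset.mul_sum, Finset.mul_sum]
  refine add_le_add ?_ (Finset.sum_le_sum fun v _ => ?_)
  · rw [ENNReal.ofReal_mul (by positivity), ENNReal.ofReal_mul (p := (S.card : ℝ))
      (Nat.cast_nonneg _), ENNReal.ofReal_natCast]
    refine mul_le_mul_left (ENNReal.ofReal_le_ofReal ?_) _
    have : (harmonic n : ℝ) ≤ harmonic n * e⁻¹ := le_mul_of_one_le_right (by linarith) he1'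
    linarith
  · rw [hdist v]
    calc ENNReal.ofReal (9 * e⁻¹) * ((N v : ℝ≥0∞) *
          ∫⁻ ω, ENNReal.ofReal (separation d e f v (near v) ω)
            ∂(Measure.infinitePi fun _ : ℕ => (volume : Measure unitInterval)))
        ≤ ENNReal.ofReal (9 * e⁻¹) * ((N v : ℝ≥0∞) *
          ENNReal.ofReal (13 * harmonic n * d v (near v))) := by
          gcongr
          exact lintegral_separation_le hd hef v (near v)
      _ = ENNReal.ofReal (117 * harmonic n * e⁻¹) *
          ((N v : ℝ≥0∞) * ENNReal.ofReal (d v (near v))) := by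
          rw [show 117 * (harmonic n : ℝ) * e⁻¹ = 9 * e⁻¹ * (13 * harmonic n) by ring,
            ENNReal.ofReal_mul (p := 9 * e⁻¹) (by positivity),
            ENNReal.ofReal_mul (p := 13 * (harmonic n : ℝ)) (by positivity)]
          ring

theorem lintegral_connectedCost_le_opt {ε : ℝ} (hd : IsMetric d) (hn : 2 ≤ n) (hε : 0 < ε)
    (hf : 0 ≤ f) (N : Fin n → ℕ) :
    ∫⁻ ω, connectedCost d f N (levelDist (finLabel d (min ε 1) f ω.1)
        (numLevels (extend d) (min ε 1) f n)) (finChosen d (min ε 1) f N ω) ∂tapeMeasure ≤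
      ENNReal.ofReal (351 * Real.log n * max 1 ε⁻¹) * opt d f N := by
  have hlog : 1 / 2 ≤ Real.log n := by
    have h1 : Real.log 2 ≤ Real.log n := Real.log_le_log (by norm_num) (by exact_mod_cast hn)
    linarith [Real.log_two_gt_d9]
  have hmax : (1 : ℝ) ≤ max 1 ε⁻¹ := le_max_left _ _
  obtain ⟨S, hS⟩ := exists_eq_ciInf_of_finite (f := cost d f N)
  rw [opt, ← hS]
  -- The empty set is optimal only without clients, when nothing is opened, or when opt is infinite.
  rcases S.eq_empty_or_nonempty with rfl | hne
  · by_cases hN : N = 0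
    · have h0 : ∀ ρ R, connectedCost d f N ρ R = 0 := fun ρ R => by
        simp [connectedCost, opened, hN]
      simp [h0]
    · obtain ⟨v, hv⟩ := Function.ne_iff.1 hN
      have h1 : cost d f N ∅ = ⊤ := by
        refine top_le_iff.1 (le_trans ?_ le_add_self)
        refine le_trans (le_of_eq ?_) (Finset.single_le_sum
          (f := fun v => (N v : ℝ≥0∞) * distTo d v ∅) (fun _ _ => zero_le) (Finset.mem_univ v))
        simp only [distTo, Finset.notMem_empty, iInf_false, iInf_top]
        exact (ENNReal.mul_top (by exact_mod_cast hv)).symm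
      rw [h1, ENNReal.mul_top]
      · exact le_top
      · exact (ENNReal.ofReal_pos.2 (by positivity)).ne'
  · refine (lintegral_connectedCost_le_cost hd (by omega) (lt_min hε one_pos) (min_le_right _ _) hf
      N hne).trans (mul_le_mul_left (ENNReal.ofReal_le_ofReal ?_) _)
    have h1 : (min ε 1)⁻¹ = max 1 ε⁻¹ := by
      rcases le_total ε 1 with h | h
      · rw [min_eq_left h, max_eq_right ((one_le_inv₀ hε).2 h)]
      · rw [min_eq_right h, max_eq_left (inv_le_one_of_one_le₀ h), inv_one]
    rw [h1]
    have h2 := harmonic_le_one_add_log n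
    refine mul_le_mul_of_nonneg_right ?_ (by linarith)
    -- As log n ≥ 1 / 2, the bound H ≤ 1 + log n ≤ 3 log n turns 117 into 351.
    linarith

end Cost

end UFL
end

/-! ### The main theorem. -/

theorem theorem3 :
    ∃ (A : UFL.Program) (p : Polynomial ℕ) (C : ℝ),
      ∀ (n : ℕ) (d : Fin n → Fin n → ℝ) (f ε : ℝ),
        2 ≤ n → UFL.IsMetric d → 0 ≤ f → 0 < ε →
        ∃ (ρ : UFL.Tape → Fin n → Fin n → ℝ)
          (R : (Fin n → ℕ) → UFL.Tape → Finset (Fin n)),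
          -- on every input and every tape, `A` halts in polynomial time with output `(R, ρ)`
          (∀ (N : Fin n → ℕ) (ω : UFL.Tape), ∃ (t : ℕ) (s : UFL.State),
            UFL.Exec ω A (UFL.initialState n d f ε N) t s ∧
            t ≤ p.eval (UFL.inputSize d f) ∧
            UFL.outputSet n s = R N ω ∧
            UFL.outputMetric n s = ρ ω) ∧
          -- the output is valid and is a random variable
          (∀ (N : Fin n → ℕ) (ω : UFL.Tape), (R N ω).Nonempty) ∧
          (∀ ω : UFL.Tape, UFL.IsMetric (ρ ω)) ∧
          (∀ N : Fin n → ℕ, Measurable fun ω : UFL.Tape => (R N ω, ρ ω)) ∧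
          -- privacy of the whole output
          UFL.IsDP ε (fun N => UFL.tapeMeasure.map fun ω : UFL.Tape => (R N ω, ρ ω)) ∧
          -- expected cost
          (∀ N : Fin n → ℕ,
            ∫⁻ ω, UFL.cost d f N (UFL.opened (ρ ω) (R N ω) N) ∂UFL.tapeMeasure
              ≤ ENNReal.ofReal (C * Real.log n * max 1 ε⁻¹) * UFL.opt d f N) ∧
          (∀ N : Fin n → ℕ,
            ∫⁻ ω, UFL.connectedCost d f N (ρ ω) (R N ω) ∂UFL.tapeMeasure
              ≤ ENNReal.ofReal (C * Real.log n * max 1 ε⁻¹) * UFL.opt d f N) := by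
  refine ⟨UFL.algorithm, UFL.timeBound, 351, fun n d f ε hn hd hf hε => ?_⟩
  have he : 0 < min ε 1 := lt_min hε one_pos
  have hef : 0 ≤ min ε 1 * f := mul_nonneg he.le hf
  have hcost := UFL.lintegral_connectedCost_le_opt hd hn hε hf
  refine ⟨fun ω => UFL.levelDist (UFL.finLabel d (min ε 1) f ω.1)
      (UFL.numLevels (UFL.extend d) (min ε 1) f n), UFL.finChosen d (min ε 1) f,
    UFL.exists_run hn hd hf, fun N ω => ?_,
    fun ω => (UFL.isHierarchy_finLabel hd hef ω.1).isMetric_levelDist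
      (UFL.one_le_numLevels _ _ _ _),
    UFL.measurable_output d _ f _,
    UFL.isDP_output d f (by omega) he (min_le_left _ _) _, fun N => ?_, hcost⟩
  · obtain ⟨u, hu, -⟩ := (UFL.isChosenSet_finChosen N ω).exists_mem
      (UFL.isHierarchy_finLabel hd hef ω.1) (UFL.isDepth_finDepth N ω) ⟨0, by omega⟩
    exact ⟨u, hu⟩
  · exact (lintegral_mono fun ω => UFL.cost_opened_le_connectedCost d f N _ _).trans (hcost N)
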